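/- **Theorem.** There is an algorithm that solves Directed Maximum Leaf in time $O(1.9973^n)$ on digraphs with $n$ vertices. Here an *out-branching* of a digraph $D$ is a spanning subgraph $T$ of $D$ that is an oriented tree with exactly one vertex of in-degree zero (the root); the *leaves* of $T$ are its vertices of out-degree zero. *Directed Maximum Leaf* asks, given $D$, to find an out-branching of $D$ with the maximum number of leaves, together with that number, or to report that $D$ has no out-branching. An algorithm is a fixed program (independent of $n$ and $D$) for a random access machine with finitely many registers and finitely many arrays of natural numbers, whose elementary instructions are: do nothing, load a constant, copy a register, add one, subtract one, read from and write to an array at a computed index, and whose control structures are sequencing, conditionals and while loops with tests on registers. Its running time is the number of elementary instructions executed and tests evaluated. The input is $n$ together with the adjacency matrix of $D$, and the out-branching is output as an adjacency matrix. Precisely: there are such a program and a constant $C$ such that, for every $n\ge 0$ and every digraph $D$ on $n$ vertices, the program halts on $D$ with a correct answer after at most $C\cdot 1.9973^n$ steps. -/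

import Mathlib

/-! ### Out-branchings of digraphs -/

/-- `T` is an out-branching of `D`: a spanning subgraph of `D` that is an oriented tree (an
orientation of a tree: no loops, no opposite arcs, and the underlying undirected graph is a tree)
with exactly one vertex of in-degree zero, the root. -/
structure IsOutBranching {V : Type*} (D T : Digraph V) : Prop where
  le : T ≤ D
  asymm : ∀ u v, T.Adj u v → ¬ T.Adj v u
  isTree : T.toSimpleGraphInclusive.IsTree
  root : ∃! r, ∀ u, ¬ T.Adj u r

/-- The number of leaves of `T`, that is, of vertices of out-degree zero. -/
noncomputable def leafCount {V : Type*} (T : Digraph V) : ℕ :=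
  {v : V | ∀ u, ¬ T.Adj v u}.ncard

/-- `T` is an optimal solution of Directed Maximum Leaf on `D`. -/
def IsMaxLeafOutBranching {V : Type*} (D T : Digraph V) : Prop :=
  IsOutBranching D T ∧ ∀ T', IsOutBranching D T' → leafCount T' ≤ leafCount T

/-! ### A random access machine with a step count -/

namespace RAM

/-- A memory state: registers and arrays, all holding natural numbers. A program names only
finitely many registers and arrays, and arrays are accessed with computed indices. -/
structure State where
  reg : ℕ → ℕ
  arr : ℕ → ℕ → ℕ

/-- Tests on registers. -/
inductive Test where
  | eq (x y : ℕ)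
  | lt (x y : ℕ)
  | not (b : Test)

/-- Whether a test succeeds. -/
def Test.Holds : Test → State → Prop
  | .eq x y, s => s.reg x = s.reg y
  | .lt x y, s => s.reg x < s.reg y
  | .not b, s => ¬ b.Holds s

/-- Programs. The only arithmetic is adding or subtracting one, so that after `t` steps all numbers
in memory are at most `t` plus a bound on the input and on the constants of the program; charging
one unit per elementary instruction is therefore a realistic cost measure. -/
inductive Prog where
  /-- do nothing -/
  | skip
  /-- `x := c` -/
  | const (x c : ℕ)
  /-- `x := y` -/
  | copy (x y : ℕ)
  /-- `x := x + 1` -/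
  | succ (x : ℕ)
  /-- `x := x - 1`, truncated at zero -/
  | pred (x : ℕ)
  /-- `x := a[y]` -/
  | load (x a y : ℕ)
  /-- `a[x] := y` -/
  | store (a x y : ℕ)
  /-- `p; q` -/
  | seq (p q : Prog)
  /-- if `b` then `p` else `q` -/
  | ite (b : Test) (p q : Prog)
  /-- while `b` do `p` -/
  | loop (b : Test) (p : Prog)

/-- Assign a value to a register. -/
def State.setReg (s : State) (x v : ℕ) : State :=
  { s with reg := Function.update s.reg x v }

/-- Assign a value to an array entry. -/
def State.setArr (s : State) (a i v : ℕ) : State :=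
  { s with arr := Function.update s.arr a (Function.update (s.arr a) i v) }

/-- `Exec p s t s'`: started in state `s`, the program `p` halts in state `s'` after exactly `t`
steps. Every elementary instruction and every evaluation of the test of a conditional or of a loop
is one step. -/
inductive Exec : Prog → State → ℕ → State → Prop where
  | skip (s : State) : Exec .skip s 1 s
  | const (x c : ℕ) (s : State) : Exec (.const x c) s 1 (s.setReg x c)
  | copy (x y : ℕ) (s : State) : Exec (.copy x y) s 1 (s.setReg x (s.reg y))
  | succ (x : ℕ) (s : State) : Exec (.succ x) s 1 (s.setReg x (s.reg x + 1))
  | pred (x : ℕ) (s : State) : Exec (.pred x) s 1 (s.setReg x (s.reg x - 1))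
  | load (x a y : ℕ) (s : State) : Exec (.load x a y) s 1 (s.setReg x (s.arr a (s.reg y)))
  | store (a x y : ℕ) (s : State) : Exec (.store a x y) s 1 (s.setArr a (s.reg x) (s.reg y))
  | seq {p q : Prog} {s₁ s₂ s₃ : State} {t₁ t₂ : ℕ} :
      Exec p s₁ t₁ s₂ → Exec q s₂ t₂ s₃ → Exec (.seq p q) s₁ (t₁ + t₂) s₃
  | iteTrue {b : Test} {p q : Prog} {s s' : State} {t : ℕ} :
      b.Holds s → Exec p s t s' → Exec (.ite b p q) s (t + 1) s'
  | iteFalse {b : Test} {p q : Prog} {s s' : State} {t : ℕ} :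
      ¬ b.Holds s → Exec q s t s' → Exec (.ite b p q) s (t + 1) s'
  | loopTrue {b : Test} {p : Prog} {s₁ s₂ s₃ : State} {t₁ t₂ : ℕ} :
      b.Holds s₁ → Exec p s₁ t₁ s₂ → Exec (.loop b p) s₂ t₂ s₃ →
        Exec (.loop b p) s₁ (t₁ + t₂ + 1) s₃
  | loopFalse {b : Test} {p : Prog} {s : State} :
      ¬ b.Holds s → Exec (.loop b p) s 1 s

open Classical in
/-- The adjacency matrix of a digraph on `n` vertices, stored row by row in an array: the entry
with index `i * n + j` is `1` if there is an arc from `i` to `j`; all other entries are `0`. -/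
noncomputable def adjArray {n : ℕ} (D : Digraph (Fin n)) (m : ℕ) : ℕ :=
  if ∃ i j : Fin n, m = (i : ℕ) * n + (j : ℕ) ∧ D.Adj i j then 1 else 0

/-- The input state: register `0` holds the number `n` of vertices, array `0` holds the adjacency
matrix, and everything else is zero. -/
noncomputable def input {n : ℕ} (D : Digraph (Fin n)) : State where
  reg x := if x = 0 then n else 0
  arr a := if a = 0 then adjArray D else fun _ => 0

/-- The state `s` holds a correct answer to Directed Maximum Leaf on `D`: register `0` tells
whether `D` has an out-branching; if it has, then array `1` begins with the adjacency matrix of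
an out-branching with the maximum number of leaves, and register `1` holds that number. -/
def IsAnswer {n : ℕ} (D : Digraph (Fin n)) (s : State) : Prop :=
  (s.reg 0 = 0 ∧ ∀ T, ¬ IsOutBranching D T) ∨
  (s.reg 0 = 1 ∧ ∃ T, IsMaxLeafOutBranching D T ∧ s.reg 1 = leafCount T ∧
    ∀ m < n * n, s.arr 1 m = adjArray T m)

end RAM

/-! Fix a root `r`. If every vertex of `J` is reachable from `r` through `J`, then `r` and the
out-neighbours of `J` carry an out-tree with at least `|dom J| - |J|` leaves. If moreover `r`
reaches all vertices, attaching the uncovered ones does not lower this bound: each of them forces at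
most one new internal vertex. Conversely, the internal vertices of an out-branching attain the bound
exactly. So it suffices, for every root, to maximise `|dom J| - |J|` over such `J`.

This is done by branching on an undecided covered vertex `v`. Let its fresh vertices be its
out-neighbours not yet covered, and its rivals the other undecided, non-fresh vertices with an arc
to a fresh one. Exchange arguments (`Choice.ach_erase`, `Choice.ach_insert`) restrict the cases.
With at most one fresh vertex, `v` is a leaf or its fresh vertex is internal too. With two fresh
vertices and no rivals, `v` may be taken internal. With two fresh vertices and rivals, an internal
`v` either has an internal fresh vertex, or both fresh vertices and all rivals are leaves: an
internal rival would cover one fresh vertex, and turning `v` into a leaf would lose nothing. With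
three or more, `v` is a leaf or internal. `Choice.exists_ach` collects the cases.

The measure gives weight 20 to an undecided uncovered vertex, 19 to an undecided covered one and 1
to an uncovered leaf. `Choice.sum_branches_le` shows that the sum of `1.035 ^ measure` over the
children is at most 0.99 times the value at the parent. Hence 100 times the sum over the queue drops
by at least 1 in every iteration, and it starts at no more than `100 n * 1.035 ^ (20 n)`. Each
iteration costs polynomially many steps, and `1.035 ^ 20 < 1.99 < 1.9973` absorbs the polynomial.

For the machine model, a small language with sums over the vertices is compiled to programs with
polynomial cost bounds (`Cmd.run_compile`). The queue, the branching and the growing of spanning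
trees are written in that language. -/

namespace RAM

/-! ### A structured language with loops over `0, …, n - 1` -/

/-- Started in `s`, the program `p` halts after at most `T` steps in a state satisfying `Q`. -/
def Run (p : Prog) (s : State) (T : ℕ) (Q : State → Prop) : Prop :=
  ∃ t s', Exec p s t s' ∧ t ≤ T ∧ Q s'

theorem Run.mono {p : Prog} {s : State} {T T' : ℕ} {Q Q' : State → Prop} (h : Run p s T Q)
    (hT : T ≤ T') (hQ : ∀ s', Q s' → Q' s') : Run p s T' Q' := by
  obtain ⟨t, s', he, ht, hq⟩ := h
  exact ⟨t, s', he, ht.trans hT, hQ s' hq⟩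

theorem Run.seq {p q : Prog} {s : State} {T₁ T₂ : ℕ} {Q Q' : State → Prop} (h : Run p s T₁ Q)
    (h' : ∀ s', Q s' → Run q s' T₂ Q') : Run (.seq p q) s (T₁ + T₂) Q' := by
  obtain ⟨t, s', he, ht, hq⟩ := h
  obtain ⟨t', s'', he', ht', hq'⟩ := h' s' hq
  exact ⟨t + t', s'', .seq he he', by omega, hq'⟩

/-- The costs of the two branches are added rather than compared: only polynomial bounds are needed.
-/
theorem Run.ite {b : Test} {p q : Prog} {s : State} {T₁ T₂ : ℕ} {Q : State → Prop}
    (h₁ : b.Holds s → Run p s T₁ Q) (h₂ : ¬ b.Holds s → Run q s T₂ Q) :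
    Run (.ite b p q) s (T₁ + T₂ + 1) Q := by
  by_cases hb : b.Holds s
  · obtain ⟨t, s', he, ht, hq⟩ := h₁ hb
    exact ⟨t + 1, s', .iteTrue hb he, by omega, hq⟩
  · obtain ⟨t, s', he, ht, hq⟩ := h₂ hb
    exact ⟨t + 1, s', .iteFalse hb he, by omega, hq⟩

theorem Run.skip {s : State} {Q : State → Prop} (h : Q s) : Run .skip s 1 Q :=
  ⟨1, s, .skip s, le_rfl, h⟩

theorem Run.const {x c : ℕ} {s : State} {Q : State → Prop} (h : Q (s.setReg x c)) :
    Run (.const x c) s 1 Q := ⟨1, _, .const x c s, le_rfl, h⟩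

theorem Run.copy {x y : ℕ} {s : State} {Q : State → Prop} (h : Q (s.setReg x (s.reg y))) :
    Run (.copy x y) s 1 Q := ⟨1, _, .copy x y s, le_rfl, h⟩

theorem Run.succ {x : ℕ} {s : State} {Q : State → Prop} (h : Q (s.setReg x (s.reg x + 1))) :
    Run (.succ x) s 1 Q := ⟨1, _, .succ x s, le_rfl, h⟩

theorem Run.load {x a y : ℕ} {s : State} {Q : State → Prop}
    (h : Q (s.setReg x (s.arr a (s.reg y)))) : Run (.load x a y) s 1 Q :=
  ⟨1, _, .load x a y s, le_rfl, h⟩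

theorem Run.store {a x y : ℕ} {s : State} {Q : State → Prop}
    (h : Q (s.setArr a (s.reg x) (s.reg y))) : Run (.store a x y) s 1 Q :=
  ⟨1, _, .store a x y s, le_rfl, h⟩

/-- A loop whose counter `x` runs from `0` up to the contents `n` of register `2`. -/
theorem Run.forLoop {x n T : ℕ} {body : Prog} {Inv : ℕ → State → Prop}
    (hI : ∀ i s, Inv i s → s.reg x = i ∧ s.reg 2 = n)
    (hb : ∀ i s, i < n → Inv i s → Run body s T (Inv (i + 1))) {s : State} (h : Inv 0 s) :
    Run (.loop (.lt x 2) body) s (n * (T + 1) + 1) (Inv n) := by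
  have key : ∀ k i s, i + k = n → Inv i s →
      Run (.loop (.lt x 2) body) s (k * (T + 1) + 1) (Inv n) := by
    intro k
    induction k with
    | zero =>
      intro i s hi h
      obtain ⟨h1, h2⟩ := hI i s h
      refine ⟨1, s, .loopFalse ?_, by omega, ?_⟩
      · simp only [Test.Holds]; omega
      · rwa [← hi]
    | succ k ih =>
      intro i s hi h
      obtain ⟨h1, h2⟩ := hI i s h
      obtain ⟨t, s', he, ht, hq⟩ := hb i s (by omega) h
      obtain ⟨t', s'', he', ht', hq'⟩ := ih (i + 1) s' (by omega) hq
      refine ⟨t + t' + 1, s'', .loopTrue ?_ he he', ?_, hq'⟩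
      · simp only [Test.Holds]; omega
      · rw [add_mul]; omega
  exact key n 0 s (by omega) h

/-! ### Memory updates and the expression language -/

@[simp] theorem State.setReg_reg (s : State) (x v j : ℕ) :
    (s.setReg x v).reg j = if j = x then v else s.reg j := by
  simp [State.setReg, Function.update_apply]

@[simp] theorem State.setReg_arr (s : State) (x v : ℕ) : (s.setReg x v).arr = s.arr := rfl

@[simp] theorem State.setArr_reg (s : State) (a i v : ℕ) : (s.setArr a i v).reg = s.reg := rfl

@[simp] theorem State.setArr_arr (s : State) (a i v b m : ℕ) :
    (s.setArr a i v).arr b m = if b = a ∧ m = i then v else s.arr b m := by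
  by_cases hb : b = a
  · subst hb; by_cases hm : m = i <;> simp [State.setArr, hm]
  · simp [State.setArr, hb]

/-- Assign values to the `n` entries of an array from index `o` on. -/
def State.setBlock (s : State) (a o : ℕ) (f : ℕ → ℕ) : State where
  reg := s.reg
  arr b m := if b = a ∧ o ≤ m ∧ m < o + s.reg 2 then f (m - o) else s.arr b m

@[simp] theorem State.setBlock_reg (s : State) (a o : ℕ) (f : ℕ → ℕ) :
    (s.setBlock a o f).reg = s.reg := rfl

@[simp] theorem State.setBlock_arr (s : State) (a o : ℕ) (f : ℕ → ℕ) (b m : ℕ) :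
    (s.setBlock a o f).arr b m =
      if b = a ∧ o ≤ m ∧ m < o + s.reg 2 then f (m - o) else s.arr b m := rfl

/-- Expressions. Register `2` is reserved for the number of vertices. -/
inductive Expr where
  | reg (x : ℕ)
  | lit (c : ℕ)
  | get (a : ℕ) (e : Expr)
  | eq (e f : Expr)
  | lt (e f : Expr)
  | cond (c e f : Expr)
  | add (e f : Expr)
  | sum (x : ℕ) (e : Expr)

namespace Expr

/-- The value of an expression. In sums, the second summand or the summands are capped by the
number of vertices, which bounds the cost of their evaluation. -/
def eval : Expr → State → ℕ
  | reg x, s => s.reg x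
  | lit c, _ => c
  | get a e, s => s.arr a (e.eval s)
  | eq e f, s => if e.eval s = f.eval s then 1 else 0
  | lt e f, s => if e.eval s < f.eval s then 1 else 0
  | cond c e f, s => if c.eval s = 0 then f.eval s else e.eval s
  | add e f, s => e.eval s + min (f.eval s) (s.reg 2)
  | sum x e, s => ∑ i ∈ Finset.range (s.reg 2), min (e.eval (s.setReg x i)) (s.reg 2)

/-- All registers are below `K`, and register `2` is not a bound variable. -/
def ok (K : ℕ) : Expr → Bool
  | reg x => x < K
  | lit _ => true
  | get _ e => e.ok K
  | eq e f => e.ok K && f.ok K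
  | lt e f => e.ok K && f.ok K
  | cond c e f => c.ok K && e.ok K && f.ok K
  | add e f => e.ok K && f.ok K
  | sum x e => decide (x < K) && decide (x ≠ 2) && e.ok K

/-- The array `a` does not occur. -/
def avoids (a : ℕ) : Expr → Bool
  | reg _ => true
  | lit _ => true
  | get b e => decide (b ≠ a) && e.avoids a
  | eq e f => e.avoids a && f.avoids a
  | lt e f => e.avoids a && f.avoids a
  | cond c e f => c.avoids a && e.avoids a && f.avoids a
  | add e f => e.avoids a && f.avoids a
  | sum _ e => e.avoids a

/-- The arrays in `A` are those in which the states may differ. With `A` empty this discards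
temporaries; with `A` a single array it allows `fill` to evaluate its expression while that array is
half overwritten. -/
theorem eval_congr {K : ℕ} (hK : 2 < K) (A : ℕ → Prop) {e : Expr} (he : e.ok K)
    (hA : ∀ a, A a → e.avoids a) {s s' : State} (hr : ∀ j < K, s.reg j = s'.reg j)
    (ha : ∀ a, ¬ A a → s.arr a = s'.arr a) : e.eval s = e.eval s' := by
  induction e generalizing s s' with
  | reg x => exact hr x (by simpa [ok] using he)
  | lit c => rfl
  | get a e ih =>
    simp only [ok] at he
    have : ¬ A a := fun h => by simpa [avoids] using hA a h
    simp only [eval, ha a this]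
    rw [ih he (fun b hb => by have := hA b hb; simp [avoids] at this; exact this.2) hr ha]
  | eq e f ih1 ih2 =>
    simp only [ok, Bool.and_eq_true] at he
    simp only [avoids, Bool.and_eq_true] at hA
    simp only [eval, ih1 he.1 (fun b hb => (hA b hb).1) hr ha,
      ih2 he.2 (fun b hb => (hA b hb).2) hr ha]
  | lt e f ih1 ih2 =>
    simp only [ok, Bool.and_eq_true] at he
    simp only [avoids, Bool.and_eq_true] at hA
    simp only [eval, ih1 he.1 (fun b hb => (hA b hb).1) hr ha,
      ih2 he.2 (fun b hb => (hA b hb).2) hr ha]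
  | cond c e f ih1 ih2 ih3 =>
    simp only [ok, Bool.and_eq_true] at he
    simp only [avoids, Bool.and_eq_true] at hA
    simp only [eval, ih1 he.1.1 (fun b hb => (hA b hb).1.1) hr ha,
      ih2 he.1.2 (fun b hb => (hA b hb).1.2) hr ha, ih3 he.2 (fun b hb => (hA b hb).2) hr ha]
  | add e f ih1 ih2 =>
    simp only [ok, Bool.and_eq_true] at he
    simp only [avoids, Bool.and_eq_true] at hA
    simp only [eval, ih1 he.1 (fun b hb => (hA b hb).1) hr ha,
      ih2 he.2 (fun b hb => (hA b hb).2) hr ha, hr 2 hK]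
  | sum x e ih =>
    simp only [ok, Bool.and_eq_true] at he
    simp only [eval, hr 2 hK]
    refine Finset.sum_congr rfl fun i _ => ?_
    rw [ih he.2 hA (s' := s'.setReg x i)]
    · intro j hj; simp only [State.setReg_reg, hr j hj]
    · simpa using ha

/-- Add register `j`, capped by the number of vertices, to register `k`, with counter `l`. -/
def addTo (k j l : ℕ) : Prog :=
  .seq (.const l 0) (.loop (.lt l 2) (.seq (.ite (.lt l j) (.succ k) .skip) (.succ l)))

/-- The machine can only add one, so a sum is formed by counting; the counter stops at `n`, whence
the cap. One round costs the loop test and at most four further steps. -/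
theorem run_addTo {k j l : ℕ} (h1 : k ≠ j) (h2 : k ≠ l) (h3 : j ≠ l) (h4 : k ≠ 2) (h5 : l ≠ 2)
    (s : State) : Run (addTo k j l) s (5 * s.reg 2 + 2) (fun s' =>
      s'.reg k = s.reg k + min (s.reg j) (s.reg 2) ∧ (∀ i, i ≠ k → i ≠ l → s'.reg i = s.reg i) ∧
      s'.arr = s.arr) := by
  have := Run.forLoop (x := l) (n := s.reg 2) (T := 4)
    (body := .seq (.ite (.lt l j) (.succ k) .skip) (.succ l))
    (Inv := fun i s' => s'.reg l = i ∧ s'.reg k = s.reg k + min (s.reg j) i ∧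
      (∀ i, i ≠ k → i ≠ l → s'.reg i = s.reg i) ∧ s'.arr = s.arr) (s := s.setReg l 0)
    (fun i s' h => ⟨h.1, h.2.2.1 2 h4.symm h5.symm⟩) ?_ ?_
  · refine (Run.seq (Run.const (Q := fun s' => s' = s.setReg l 0) rfl)
      (fun s' hs' => hs' ▸ this)).mono (by omega) fun s' h => h.2
  · rintro i s' hi ⟨hl, hk, hr, ha⟩
    refine Run.seq (T₁ := 3) (T₂ := 1) (Q := fun s' => s'.reg l = i ∧
      s'.reg k = s.reg k + min (s.reg j) (i + 1) ∧
      (∀ i, i ≠ k → i ≠ l → s'.reg i = s.reg i) ∧ s'.arr = s.arr) (Run.ite (T₁ := 1) (T₂ := 1) ?_ ?_) ?_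
    · intro ht
      simp only [Test.Holds, hl, hr j h1.symm h3] at ht
      refine Run.succ ⟨?_, ?_, ?_, ?_⟩
      · simp [h2.symm, hl]
      · simp [hk]; omega
      · intro i hi1 hi2; simp [hi1, hr i hi1 hi2]
      · simpa using ha
    · intro ht
      simp only [Test.Holds, hl, hr j h1.symm h3] at ht
      refine Run.skip ⟨hl, ?_, hr, ha⟩
      rw [hk]; omega
    · rintro s'' ⟨hl, hk, hr, ha⟩
      refine Run.succ ⟨by simp [hl], by simp [h2, hk], ?_, by simpa using ha⟩
      intro i hi1 hi2; simp [hi2, hr i hi1 hi2]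
  · refine ⟨by simp, by simp [h2], ?_, by simp⟩
    intro i hi1 hi2; simp [hi2]

/-- A program which computes an expression in register `k`, using only the registers from `k`. -/
def compile (k : ℕ) : Expr → Prog
  | reg x => .copy k x
  | lit c => .const k c
  | get a e => .seq (e.compile k) (.load k a k)
  | eq e f => .seq (e.compile k) (.seq (f.compile (k + 1))
      (.ite (.eq k (k + 1)) (.const k 1) (.const k 0)))
  | lt e f => .seq (e.compile k) (.seq (f.compile (k + 1))
      (.ite (.lt k (k + 1)) (.const k 1) (.const k 0)))
  | cond c e f => .seq (c.compile k) (.seq (.const (k + 1) 0)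
      (.ite (.eq k (k + 1)) (f.compile k) (e.compile k)))
  | add e f => .seq (e.compile k) (.seq (f.compile (k + 1)) (addTo k (k + 1) (k + 2)))
  | sum x e => .seq (.copy (k + 1) x) (.seq (.const k 0) (.seq (.const x 0) (.seq
      (.loop (.lt x 2) (.seq (e.compile (k + 2)) (.seq (addTo k (k + 2) (k + 3)) (.succ x))))
      (.copy x (k + 1)))))

/-- A bound for the number of steps of `compile`. -/
def cost : Expr → ℕ → ℕ
  | reg _, _ => 1
  | lit _, _ => 1
  | get _ e, n => e.cost n + 1
  | eq e f, n => e.cost n + (f.cost n + 3)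
  | lt e f, n => e.cost n + (f.cost n + 3)
  | cond c e f, n => c.cost n + (1 + (f.cost n + e.cost n + 1))
  | add e f, n => e.cost n + (f.cost n + (5 * n + 2))
  | sum _ e, n => 1 + (1 + (1 + (n * (e.cost n + ((5 * n + 2) + 1) + 1) + 1 + 1)))

/-- Temporaries are stacked: the value of a subexpression stays in register `k` while the next one
is compiled from a higher register on. A bound variable lies below `k`, so `sum` saves it in `k + 1`
and restores it at the end. -/
theorem run_compile {K : ℕ} (hK : 2 < K) {e : Expr} (he : e.ok K) {k : ℕ} (hk : K ≤ k)
    (s : State) : Run (e.compile k) s (e.cost (s.reg 2)) (fun s' =>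
      s'.reg k = e.eval s ∧ (∀ j < k, s'.reg j = s.reg j) ∧ s'.arr = s.arr) := by
  have congr : ∀ {e : Expr}, e.ok K → ∀ {s s' : State}, (∀ j < K, s.reg j = s'.reg j) →
      s.arr = s'.arr → e.eval s = e.eval s' := fun he s s' hr ha =>
    eval_congr hK (fun _ => False) he (by simp) hr (by simp [ha])
  induction e generalizing s k with
  | reg x =>
    exact Run.copy ⟨by simp [eval], fun j hj => by simp [hj.ne], rfl⟩
  | lit c =>
    exact Run.const ⟨by simp [eval], fun j hj => by simp [hj.ne], rfl⟩
  | get a e ih =>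
    refine Run.seq (ih he hk s) ?_
    rintro s' ⟨h1, h2, h3⟩
    refine Run.load ⟨by simp [eval, h1, h3], fun j hj => by simp [hj.ne, h2 j hj], h3⟩
  | eq e f ih1 ih2 =>
    simp only [ok, Bool.and_eq_true] at he
    refine Run.seq (ih1 he.1 hk s) ?_
    rintro s1 ⟨h1, h2, h3⟩
    have e2 : s1.reg 2 = s.reg 2 := h2 2 (by omega)
    rw [← e2]
    refine Run.seq (ih2 he.2 (by omega) s1) ?_
    rintro s2 ⟨g1, g2, g3⟩
    have ef : f.eval s1 = f.eval s := congr he.2 (fun j hj => h2 j (by omega)) h3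
    refine Run.ite (T₁ := 1) (T₂ := 1) ?_ ?_ <;> intro ht <;>
      simp only [Test.Holds, g1, g2 k (by omega), h1, ef] at ht
    · exact Run.const ⟨by simp [eval, ht],
        fun j hj => by simp [hj.ne, g2 j (by omega), h2 j hj], by simp [g3, h3]⟩
    · exact Run.const ⟨by simp [eval, ht],
        fun j hj => by simp [hj.ne, g2 j (by omega), h2 j hj], by simp [g3, h3]⟩
  | lt e f ih1 ih2 =>
    simp only [ok, Bool.and_eq_true] at he
    refine Run.seq (ih1 he.1 hk s) ?_
    rintro s1 ⟨h1, h2, h3⟩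
    have e2 : s1.reg 2 = s.reg 2 := h2 2 (by omega)
    rw [← e2]
    refine Run.seq (ih2 he.2 (by omega) s1) ?_
    rintro s2 ⟨g1, g2, g3⟩
    have ef : f.eval s1 = f.eval s := congr he.2 (fun j hj => h2 j (by omega)) h3
    refine Run.ite (T₁ := 1) (T₂ := 1) ?_ ?_ <;> intro ht <;>
      simp only [Test.Holds, g1, g2 k (by omega), h1, ef] at ht
    · exact Run.const ⟨by simp [eval, ht],
        fun j hj => by simp [hj.ne, g2 j (by omega), h2 j hj], by simp [g3, h3]⟩
    · exact Run.const ⟨by simp [eval, ht],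
        fun j hj => by simp [hj.ne, g2 j (by omega), h2 j hj], by simp [g3, h3]⟩
  | cond c e f ih1 ih2 ih3 =>
    simp only [ok, Bool.and_eq_true] at he
    refine Run.seq (ih1 he.1.1 hk s) ?_
    rintro s1 ⟨h1, h2, h3⟩
    refine Run.seq (Run.const (Q := fun s' => s' = s1.setReg (k + 1) 0) rfl) ?_
    rintro s2 rfl
    have e2 : (s1.setReg (k + 1) 0).reg 2 = s.reg 2 := by
      rw [State.setReg_reg, if_neg (by omega), h2 2 (by omega)]
    have hr : ∀ j < k, (s1.setReg (k + 1) 0).reg j = s.reg j := by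
      intro j hj
      rw [State.setReg_reg, if_neg (by omega), h2 j (by omega)]
    rw [← e2]
    refine Run.ite ?_ ?_ <;> intro ht <;> simp [Test.Holds, h1] at ht
    · refine (ih3 he.2 hk _).mono le_rfl ?_
      rintro s3 ⟨g1, g2, g3⟩
      refine ⟨?_, fun j hj => (g2 j hj).trans (hr j hj), by simp [g3, h3]⟩
      rw [g1, congr he.2 (fun j hj => hr j (by omega)) h3]; simp [eval, ht]
    · refine (ih2 he.1.2 hk _).mono le_rfl ?_
      rintro s3 ⟨g1, g2, g3⟩
      refine ⟨?_, fun j hj => (g2 j hj).trans (hr j hj), by simp [g3, h3]⟩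
      rw [g1, congr he.1.2 (fun j hj => hr j (by omega)) h3]; simp [eval, ht]
  | add e f ih1 ih2 =>
    simp only [ok, Bool.and_eq_true] at he
    refine Run.seq (ih1 he.1 hk s) ?_
    rintro s1 ⟨h1, h2, h3⟩
    have e2 : s1.reg 2 = s.reg 2 := h2 2 (by omega)
    rw [← e2]
    refine Run.seq (ih2 he.2 (by omega) s1) ?_
    rintro s2 ⟨g1, g2, g3⟩
    have ef : f.eval s1 = f.eval s := congr he.2 (fun j hj => h2 j (by omega)) h3
    rw [← g2 2 (by omega)]
    refine (run_addTo (by omega) (by omega) (by omega) (by omega) (by omega) s2).mono le_rfl ?_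
    rintro s3 ⟨f1, f2, f3⟩
    refine ⟨?_, ?_, by rw [f3, g3, h3]⟩
    · rw [f1, g1, g2 k (by omega), h1, g2 2 (by omega), e2, ef]; rfl
    · intro j hj
      rw [f2 j (by omega) (by omega), g2 j (by omega), h2 j hj]
  | sum x e ih =>
    simp only [ok, Bool.and_eq_true, decide_eq_true_eq] at he
    obtain ⟨⟨hx, hx2⟩, he⟩ := he
    refine Run.seq (Run.copy (Q := fun s' => s' = s.setReg (k + 1) (s.reg x)) rfl) ?_
    rintro _ rfl
    refine Run.seq (Run.const (Q := fun s' => s' = (s.setReg (k + 1) (s.reg x)).setReg k 0) rfl) ?_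
    rintro _ rfl
    refine Run.seq (Run.const (Q := fun s' =>
      s' = ((s.setReg (k + 1) (s.reg x)).setReg k 0).setReg x 0) rfl) ?_
    rintro _ rfl
    refine Run.seq (Run.forLoop (n := s.reg 2)
      (Inv := fun i s' => s'.reg x = i ∧ s'.reg (k + 1) = s.reg x ∧
        s'.reg k = ∑ i ∈ Finset.range i, min (e.eval (s.setReg x i)) (s.reg 2) ∧
        (∀ j < k, j ≠ x → s'.reg j = s.reg j) ∧ s'.arr = s.arr) ?_ ?_ ?_) ?_
    · rintro i s' ⟨h1, h2, h3, h4, h5⟩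
      exact ⟨h1, h4 2 (by omega) (by omega)⟩
    · rintro i s' hi ⟨h1, h2, h3, h4, h5⟩
      have e2 : s'.reg 2 = s.reg 2 := h4 2 (by omega) (by omega)
      rw [← e2]
      refine Run.seq (ih he (by omega) s') ?_
      rintro s1 ⟨g1, g2, g3⟩
      rw [← g2 2 (by omega)]
      refine Run.seq
        (run_addTo (by omega) (by omega) (by omega) (by omega) (by omega) s1) ?_
      rintro s2 ⟨f1, f2, f3⟩
      have ev : e.eval s' = e.eval (s.setReg x i) := by
        refine congr he (fun j hj => ?_) h5
        by_cases hj' : j = x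
        · subst hj'; simp [h1]
        · simp [hj', h4 j (by omega) hj']
      refine Run.succ ⟨?_, ?_, ?_, ?_, ?_⟩
      · simp only [State.setReg_reg, if_true]
        rw [f2 x (by omega) (by omega), g2 x (by omega), h1]
      · rw [State.setReg_reg, if_neg (by omega), f2 _ (by omega) (by omega), g2 _ (by omega), h2]
      · rw [State.setReg_reg, if_neg (by omega), f1, g1, g2 k (by omega), h3, g2 2 (by omega), e2,
          ev, Finset.sum_range_succ]
      · intro j hj hjx
        rw [State.setReg_reg, if_neg hjx, f2 _ (by omega) (by omega), g2 _ (by omega), h4 j hj hjx]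
      · simp [f3, g3, h5]
    · refine ⟨by simp, ?_, ?_, ?_, by simp⟩
      · rw [State.setReg_reg, if_neg (by omega), State.setReg_reg, if_neg (by omega)]; simp
      · rw [State.setReg_reg, if_neg (by omega)]; simp
      · intro j hj hjx
        rw [State.setReg_reg, if_neg hjx, State.setReg_reg, if_neg (by omega), State.setReg_reg,
          if_neg (by omega)]
    · rintro s' ⟨h1, h2, h3, h4, h5⟩
      refine Run.copy ⟨?_, ?_, by simp [h5]⟩
      · rw [State.setReg_reg, if_neg (by omega), h3]; rfl
      · intro j hj
        by_cases hjx : j = x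
        · subst hjx; simp [h2]
        · simp [hjx, h4 j hj hjx]

end Expr

/-- Commands. `fill a x off e` assigns `e` to the entries `off + x` of the array `a`, for all
`x < n`, and `rep p` executes `p` exactly `n` times. -/
inductive Cmd where
  | skip
  | assign (x : ℕ) (e : Expr)
  | store (a : ℕ) (i e : Expr)
  | fill (a x : ℕ) (off e : Expr)
  | seq (p q : Cmd)
  | ite (c : Expr) (p q : Cmd)
  | rep (p : Cmd)

/-! ### Commands: semantics, frame properties, compilation -/

namespace Cmd

def eval : Cmd → State → State
  | skip, s => s
  | assign x e, s => s.setReg x (e.eval s)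
  | store a i e, s => s.setArr a (i.eval s) (e.eval s)
  | fill a x off e, s => s.setBlock a (off.eval s) fun i => e.eval (s.setReg x i)
  | seq p q, s => q.eval (p.eval s)
  | ite c p q, s => if c.eval s = 0 then q.eval s else p.eval s
  | rep p, s => p.eval^[s.reg 2] s

/-- All registers are below `K`, register `2` is not assigned to, and in `fill` the array is not
read. -/
def ok (K : ℕ) : Cmd → Bool
  | skip => true
  | assign x e => decide (x < K) && decide (x ≠ 2) && e.ok K
  | store _ i e => i.ok K && e.ok K
  | fill a x off e => decide (x < K) && decide (x ≠ 2) && off.ok K && e.ok K && e.avoids a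
  | seq p q => p.ok K && q.ok K
  | ite c p q => c.ok K && p.ok K && q.ok K
  | rep p => p.ok K

/-- Assignments to register `x` do not occur. -/
def keepsReg (x : ℕ) : Cmd → Bool
  | skip => true
  | assign y _ => decide (y ≠ x)
  | store _ _ _ => true
  | fill _ _ _ _ => true
  | seq p q => p.keepsReg x && q.keepsReg x
  | ite _ p q => p.keepsReg x && q.keepsReg x
  | rep p => p.keepsReg x

/-- Assignments to the array `a` do not occur. -/
def keepsArr (a : ℕ) : Cmd → Bool
  | skip => true
  | assign _ _ => true
  | store b _ _ => decide (b ≠ a)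
  | fill b _ _ _ => decide (b ≠ a)
  | seq p q => p.keepsArr a && q.keepsArr a
  | ite _ p q => p.keepsArr a && q.keepsArr a
  | rep p => p.keepsArr a

/-- Frame property. Its hypothesis is a Boolean computation, so for concrete commands it is
discharged by `rfl`. -/
theorem eval_reg {x : ℕ} {c : Cmd} (h : c.keepsReg x) (s : State) :
    (c.eval s).reg x = s.reg x := by
  induction c generalizing s with
  | skip => rfl
  | assign y e =>
    simp only [keepsReg, decide_eq_true_eq] at h
    simp [eval, h.symm]
  | store a i e => rfl
  | fill a x off e => rfl
  | seq p q ih1 ih2 =>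
    simp only [keepsReg, Bool.and_eq_true] at h
    simp [eval, ih2 h.2, ih1 h.1]
  | ite c p q ih1 ih2 =>
    simp only [keepsReg, Bool.and_eq_true] at h
    simp only [eval]; split_ifs
    · exact ih2 h.2 s
    · exact ih1 h.1 s
  | rep p ih =>
    simp only [eval]
    generalize s.reg 2 = k
    induction k with
    | zero => rfl
    | succ k ihk => rw [Function.iterate_succ_apply', ih h, ihk]

theorem eval_arr {a : ℕ} {c : Cmd} (h : c.keepsArr a) (s : State) :
    (c.eval s).arr a = s.arr a := by
  induction c generalizing s with
  | skip => rfl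
  | assign y e => rfl
  | store b i e =>
    simp only [keepsArr, decide_eq_true_eq] at h
    funext m; simp [eval, h.symm]
  | fill b x off e =>
    simp only [keepsArr, decide_eq_true_eq] at h
    funext m; simp [eval, h.symm]
  | seq p q ih1 ih2 =>
    simp only [keepsArr, Bool.and_eq_true] at h
    simp [eval, ih2 h.2, ih1 h.1]
  | ite c p q ih1 ih2 =>
    simp only [keepsArr, Bool.and_eq_true] at h
    simp only [eval]; split_ifs
    · exact ih2 h.2 s
    · exact ih1 h.1 s
  | rep p ih =>
    simp only [eval]
    generalize s.reg 2 = k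
    induction k with
    | zero => rfl
    | succ k ihk => rw [Function.iterate_succ_apply', ih h, ihk]

theorem keepsReg_of_ok {K x : ℕ} (hx : x = 2 ∨ K ≤ x) {c : Cmd} (h : c.ok K) : c.keepsReg x := by
  induction c with
  | skip => rfl
  | assign y e =>
    simp only [ok, Bool.and_eq_true, decide_eq_true_eq] at h
    simp only [keepsReg, decide_eq_true_eq]; omega
  | store a i e => rfl
  | fill a x off e => rfl
  | seq p q ih1 ih2 =>
    simp only [ok, Bool.and_eq_true] at h
    simp only [keepsReg, Bool.and_eq_true]
    exact ⟨ih1 h.1, ih2 h.2⟩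
  | ite c p q ih1 ih2 =>
    simp only [ok, Bool.and_eq_true] at h
    simp only [keepsReg, Bool.and_eq_true]
    exact ⟨ih1 h.1.2, ih2 h.2⟩
  | rep p ih => exact ih h

/-- Agreement of states up to registers from `k` on. -/
def Agree (k : ℕ) (s s' : State) : Prop := (∀ j < k, s'.reg j = s.reg j) ∧ s'.arr = s.arr

theorem Agree.trans {k : ℕ} {s s' s'' : State} (h : Agree k s s') (h' : Agree k s' s'') :
    Agree k s s'' :=
  ⟨fun j hj => (h'.1 j hj).trans (h.1 j hj), h'.2.trans h.2⟩

theorem _root_.RAM.Expr.eval_agree {K k : ℕ} (hK : 2 < K) {e : Expr} (he : e.ok K) (hk : K ≤ k)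
    {s s' : State} (h : Agree k s s') : e.eval s' = e.eval s :=
  Expr.eval_congr hK (fun _ => False) he (by simp) (fun j hj => h.1 j (by omega)) (by simp [h.2])

/-- A command mentions no register from `K` on, so the garbage that compiled code leaves there does
not propagate. -/
theorem eval_agree {K k : ℕ} (hK : 2 < K) {c : Cmd} (hc : c.ok K) (hk : K ≤ k)
    {s s' : State} (h : Agree k s s') : Agree k (c.eval s) (c.eval s') := by
  have h2 : s'.reg 2 = s.reg 2 := h.1 2 (by omega)
  induction c generalizing s s' with
  | skip => exact h
  | assign y e =>
    simp only [ok, Bool.and_eq_true] at hc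
    refine ⟨fun j hj => ?_, h.2⟩
    simp [eval, Expr.eval_agree hK hc.2 hk h, h.1 j hj]
  | store a i e =>
    simp only [ok, Bool.and_eq_true] at hc
    refine ⟨h.1, ?_⟩
    funext b m
    simp [eval, Expr.eval_agree hK hc.1 hk h, Expr.eval_agree hK hc.2 hk h, h.2]
  | fill a x off e =>
    simp only [ok, Bool.and_eq_true] at hc
    refine ⟨h.1, ?_⟩
    funext b m
    have : ∀ v, e.eval (s'.setReg x v) = e.eval (s.setReg x v) := fun v =>
      Expr.eval_agree hK hc.1.2 hk ⟨fun j hj => by simp [h.1 j hj], h.2⟩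
    simp only [eval, Expr.eval_agree hK hc.1.1.2 hk h, this, State.setBlock_arr, h2, h.2]
  | seq p q ih1 ih2 =>
    simp only [ok, Bool.and_eq_true] at hc
    have := ih1 hc.1 h h2
    exact ih2 hc.2 this (this.1 2 (by omega))
  | ite c p q ih1 ih2 =>
    simp only [ok, Bool.and_eq_true] at hc
    simp only [eval, Expr.eval_agree hK hc.1.1 hk h]
    split_ifs
    · exact ih2 hc.2 h h2
    · exact ih1 hc.1.2 h h2
  | rep p ih =>
    simp only [eval, h2]
    generalize s.reg 2 = m
    induction m with
    | zero => exact h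
    | succ m ihm =>
      rw [Function.iterate_succ_apply', Function.iterate_succ_apply']
      exact ih hc ihm (ihm.1 2 (by omega))

/-- Translation to a program; registers from `k` on are used for temporary values. -/
def compile (k : ℕ) : Cmd → Prog
  | skip => .skip
  | assign x e => .seq (e.compile k) (.copy x k)
  | store a i e => .seq (i.compile k) (.seq (e.compile (k + 1)) (.store a k (k + 1)))
  | fill a x off e => .seq (off.compile k) (.seq (.copy (k + 1) x) (.seq (.const x 0) (.seq
      (.loop (.lt x 2) (.seq (e.compile (k + 2)) (.seq (.store a k (k + 2))
        (.seq (.succ k) (.succ x)))))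
      (.copy x (k + 1)))))
  | seq p q => .seq (p.compile k) (q.compile k)
  | ite c p q => .seq (c.compile k) (.seq (.const (k + 1) 0)
      (.ite (.eq k (k + 1)) (q.compile k) (p.compile k)))
  | rep p => .seq (.const k 0) (.loop (.lt k 2) (.seq (p.compile (k + 1)) (.succ k)))

/-- A bound for the number of steps of `compile`. -/
def cost : Cmd → ℕ → ℕ
  | skip, _ => 1
  | assign _ e, n => e.cost n + 1
  | store _ i e, n => i.cost n + (e.cost n + 1)
  | fill _ _ off e, n => off.cost n + (1 + (1 + ((n * ((e.cost n + (1 + (1 + 1))) + 1) + 1) + 1)))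
  | seq p q, n => p.cost n + q.cost n
  | ite c p q, n => c.cost n + (1 + (q.cost n + p.cost n + 1))
  | rep p, n => 1 + (n * (p.cost n + 1 + 1) + 1)

theorem run_compile {K : ℕ} (hK : 2 < K) {c : Cmd} (hc : c.ok K) {k : ℕ} (hk : K ≤ k)
    (s : State) :
    Run (c.compile k) s (c.cost (s.reg 2)) (Agree k (c.eval s)) := by
  induction c generalizing s k with
  | skip => exact Run.skip ⟨fun _ _ => rfl, rfl⟩
  | assign x e =>
    simp only [ok, Bool.and_eq_true] at hc
    refine Run.seq (Expr.run_compile hK hc.2 hk s) ?_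
    rintro s' ⟨h1, h2, h3⟩
    refine Run.copy ⟨fun j hj => ?_, by simpa [eval] using h3⟩
    simp [eval, h1, h2 j hj]
  | store a i e =>
    simp only [ok, Bool.and_eq_true] at hc
    refine Run.seq (Expr.run_compile hK hc.1 hk s) ?_
    rintro s1 ⟨h1, h2, h3⟩
    rw [← h2 2 (by omega)]
    refine Run.seq (Expr.run_compile hK hc.2 (by omega) s1) ?_
    rintro s2 ⟨g1, g2, g3⟩
    refine Run.store ⟨fun j hj => ?_, ?_⟩
    · simp [eval, g2 j (by omega), h2 j hj]
    · funext b m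
      simp [eval, g1, g2 k (by omega), h1, g3, h3, Expr.eval_agree hK hc.2 hk ⟨h2, h3⟩]
  | fill a x off e =>
    simp only [ok, Bool.and_eq_true, decide_eq_true_eq] at hc
    obtain ⟨⟨⟨⟨hx, hx2⟩, ho⟩, he⟩, hav⟩ := hc
    refine Run.seq (Expr.run_compile hK ho hk s) ?_
    rintro s1 ⟨h1, h2, h3⟩
    refine Run.seq (Run.copy (Q := fun s' => s' = s1.setReg (k + 1) (s1.reg x)) rfl) ?_
    rintro _ rfl
    refine Run.seq (Run.const (Q := fun s' =>
      s' = (s1.setReg (k + 1) (s1.reg x)).setReg x 0) rfl) ?_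
    rintro _ rfl
    refine Run.seq (Run.forLoop (n := s.reg 2)
      (Inv := fun i s' => s'.reg x = i ∧ s'.reg (k + 1) = s.reg x ∧ s'.reg k = off.eval s + i ∧
        (∀ j < k, j ≠ x → s'.reg j = s.reg j) ∧ s'.arr = fun b m =>
          if b = a ∧ off.eval s ≤ m ∧ m < off.eval s + i then
            e.eval (s.setReg x (m - off.eval s)) else s.arr b m) ?_ ?_ ?_) ?_
    · rintro i s' ⟨f1, f2, f3, f4, f5⟩
      exact ⟨f1, f4 2 (by omega) (by omega)⟩
    · rintro i s' hi ⟨f1, f2, f3, f4, f5⟩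
      rw [← f4 2 (by omega) (by omega)]
      refine Run.seq (Expr.run_compile hK he (by omega) s') ?_
      rintro s2 ⟨g1, g2, g3⟩
      refine Run.seq (T₁ := 1) (T₂ := 2) (Run.store (Q := fun s' => s' =
        s2.setArr a (s2.reg k) (s2.reg (k + 2))) rfl) ?_
      rintro _ rfl
      refine Run.seq (T₁ := 1) (T₂ := 1) (Run.succ (Q := fun s' => s' = (s2.setArr a (s2.reg k)
        (s2.reg (k + 2))).setReg k (s2.reg k + 1)) rfl) ?_
      rintro _ rfl
      -- The memory differs from the original one only inside the array being filled, which `e`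
      -- avoids; hence writing entry by entry equals the simultaneous assignment of the semantics.
      have ev : e.eval s' = e.eval (s.setReg x i) := by
        refine Expr.eval_congr hK (fun b => b = a) he (by rintro _ rfl; exact hav) ?_ ?_
        · intro j hj
          by_cases hjx : j = x
          · subst hjx; simp [f1]
          · simp [hjx, f4 j (by omega) hjx]
        · intro b hb; funext m; simp [f5, hb]
      refine Run.succ ⟨?_, ?_, ?_, ?_, ?_⟩
      · have : x ≠ k := by omega
        simp [this, g2 x (by omega), f1]
      · have : k + 1 ≠ x := by omega
        simp [this, g2 (k + 1) (by omega), f2]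
      · have : k ≠ x := by omega
        simp [this, g2 k (by omega), f3]; omega
      · intro j hj hjx
        simp [hj.ne, hjx, g2 j (by omega), f4 j hj hjx]
      · funext b m
        simp only [State.setReg_arr, State.setArr_arr, g1, g2 k (by omega), f3, g3, f5, ev]
        by_cases hb : b = a
        · by_cases hm : m = off.eval s + i
          · subst hm; simp [hb]
          · have : (off.eval s ≤ m ∧ m < off.eval s + (i + 1)) ↔
              (off.eval s ≤ m ∧ m < off.eval s + i) := by omega
            simp [hb, hm, this]
        · simp [hb]
    · refine ⟨by simp, ?_, ?_, ?_, ?_⟩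
      · have : k + 1 ≠ x := by omega
        simp [this, h2 x (by omega)]
      · have : k ≠ x := by omega
        simp [this, h1]
      · intro j hj hjx
        have : j ≠ k + 1 := by omega
        simp [hjx, h2 j hj, this]
      · funext b m
        have : ¬ (b = a ∧ off.eval s ≤ m ∧ m < off.eval s + 0) := by omega
        rw [if_neg this]
        simp [h3]
    · rintro s' ⟨f1, f2, f3, f4, f5⟩
      refine Run.copy ⟨fun j hj => ?_, f5⟩
      by_cases hjx : j = x
      · subst hjx; simp [f2, eval]
      · simp [hjx, f4 j hj hjx, eval]
  | seq p q ih1 ih2 =>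
    have hc' := hc
    simp only [ok, Bool.and_eq_true] at hc
    refine Run.seq (ih1 hc.1 hk s) ?_
    intro s1 h1
    have e2 : s1.reg 2 = s.reg 2 :=
      (h1.1 2 (by omega)).trans (eval_reg (keepsReg_of_ok (.inl rfl) hc.1) s)
    rw [← e2]
    exact (ih2 hc.2 hk s1).mono le_rfl fun s' h => (eval_agree hK hc.2 hk h1).trans h
  | ite c p q ih1 ih2 =>
    simp only [ok, Bool.and_eq_true] at hc
    refine Run.seq (Expr.run_compile hK hc.1.1 hk s) ?_
    rintro s1 ⟨h1, h2, h3⟩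
    refine Run.seq (Run.const (Q := fun s' => s' = s1.setReg (k + 1) 0) rfl) ?_
    rintro _ rfl
    have ha : Agree k s (s1.setReg (k + 1) 0) := by
      refine ⟨fun j hj => ?_, h3⟩
      rw [State.setReg_reg, if_neg (by omega), h2 j hj]
    rw [← ha.1 2 (by omega)]
    refine Run.ite ?_ ?_ <;> intro ht <;> simp [Test.Holds, h1] at ht <;> simp only [eval, ht]
    · exact (ih2 hc.2 hk _).mono le_rfl fun s' h => (eval_agree hK hc.2 hk ha).trans h
    · exact (ih1 hc.1.2 hk _).mono le_rfl fun s' h => (eval_agree hK hc.1.2 hk ha).trans h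
  | rep p ih =>
    simp only [ok] at hc
    refine Run.seq (Run.const (Q := fun s' => s' = s.setReg k 0) rfl) ?_
    rintro _ rfl
    have keep2 : ∀ i, (p.eval^[i] s).reg 2 = s.reg 2 := by
      intro i
      induction i with
      | zero => rfl
      | succ i ihi =>
        rw [Function.iterate_succ_apply', eval_reg (keepsReg_of_ok (.inl rfl) hc), ihi]
    refine (Run.forLoop (n := s.reg 2) (T := p.cost (s.reg 2) + 1)
      (Inv := fun i s' => s'.reg k = i ∧ Agree k (p.eval^[i] s) s') ?_ ?_ ?_).mono le_rfl
      fun s' h => h.2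
    · rintro i s' ⟨h1, h2⟩
      exact ⟨h1, (h2.1 2 (by omega)).trans (keep2 i)⟩
    · rintro i s' hi ⟨h1, h2⟩
      rw [← keep2 i, ← h2.1 2 (by omega)]
      refine Run.seq (ih hc (by omega) s') ?_
      intro s1 h3
      refine Run.succ ⟨?_, ?_⟩
      · simp [h3.1 k (by omega), eval_reg (keepsReg_of_ok (K := K) (.inr hk) hc), h1]
      · rw [Function.iterate_succ_apply']
        refine (eval_agree hK hc hk h2).trans ⟨fun j hj => ?_, h3.2⟩
        simp [hj.ne, h3.1 j (by omega)]
    · exact ⟨by simp, fun j hj => by simp [hj.ne], rfl⟩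

end Cmd

/-! ### Polynomial bounds -/

/-- Polynomially bounded functions. -/
def PolyBdd (f : ℕ → ℕ) : Prop := ∃ c d, ∀ n, f n ≤ c * (n + 1) ^ d

theorem PolyBdd.const (c : ℕ) : PolyBdd fun _ => c := ⟨c, 0, by simp⟩

theorem PolyBdd.id : PolyBdd fun n => n := ⟨1, 1, fun n => by simp⟩

theorem PolyBdd.add {f g : ℕ → ℕ} (hf : PolyBdd f) (hg : PolyBdd g) :
    PolyBdd fun n => f n + g n := by
  obtain ⟨c, d, h⟩ := hf
  obtain ⟨c', d', h'⟩ := hg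
  refine ⟨c + c', d + d', fun n => ?_⟩
  have h1 : (n + 1) ^ d ≤ (n + 1) ^ (d + d') := Nat.pow_le_pow_right (by omega) (by omega)
  have h2 : (n + 1) ^ d' ≤ (n + 1) ^ (d + d') := Nat.pow_le_pow_right (by omega) (by omega)
  calc f n + g n ≤ c * (n + 1) ^ d + c' * (n + 1) ^ d' := add_le_add (h n) (h' n)
    _ ≤ c * (n + 1) ^ (d + d') + c' * (n + 1) ^ (d + d') := by gcongr
    _ = _ := by ring

theorem PolyBdd.mul {f g : ℕ → ℕ} (hf : PolyBdd f) (hg : PolyBdd g) :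
    PolyBdd fun n => f n * g n := by
  obtain ⟨c, d, h⟩ := hf
  obtain ⟨c', d', h'⟩ := hg
  refine ⟨c * c', d + d', fun n => ?_⟩
  calc f n * g n ≤ (c * (n + 1) ^ d) * (c' * (n + 1) ^ d') := Nat.mul_le_mul (h n) (h' n)
    _ = _ := by ring

theorem Expr.polyBdd_cost (e : Expr) : PolyBdd e.cost := by
  induction e with
  | reg x => exact .const 1
  | lit c => exact .const 1
  | get a e ih => exact ih.add (.const 1)
  | eq e f ih1 ih2 => exact ih1.add (ih2.add (.const 3))
  | lt e f ih1 ih2 => exact ih1.add (ih2.add (.const 3))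
  | cond c e f ih1 ih2 ih3 => exact ih1.add ((PolyBdd.const 1).add ((ih3.add ih2).add (.const 1)))
  | add e f ih1 ih2 =>
    exact ih1.add (ih2.add (((PolyBdd.const 5).mul .id).add (.const 2)))
  | sum x e ih =>
    exact (PolyBdd.const 1).add ((PolyBdd.const 1).add ((PolyBdd.const 1).add
      (((PolyBdd.id.mul ((ih.add ((((PolyBdd.const 5).mul .id).add (.const 2)).add
        (.const 1))).add (.const 1))).add (.const 1)).add (.const 1))))

theorem Cmd.polyBdd_cost (c : Cmd) : PolyBdd c.cost := by
  induction c with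
  | skip => exact .const 1
  | assign x e => exact e.polyBdd_cost.add (.const 1)
  | store a i e => exact i.polyBdd_cost.add (e.polyBdd_cost.add (.const 1))
  | fill a x off e =>
    exact off.polyBdd_cost.add ((PolyBdd.const 1).add ((PolyBdd.const 1).add
      ((((PolyBdd.id.mul ((e.polyBdd_cost.add (.const (1 + (1 + 1)))).add (.const 1)))).add
        (.const 1)).add (.const 1))))
  | seq p q ih1 ih2 => exact ih1.add ih2
  | ite c p q ih1 ih2 =>
    exact c.polyBdd_cost.add ((PolyBdd.const 1).add ((ih2.add ih1).add (.const 1)))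
  | rep p ih =>
    exact (PolyBdd.const 1).add ((PolyBdd.id.mul ((ih.add (.const 1)).add (.const 1))).add
      (.const 1))

/-- A loop terminates if its body preserves an invariant and decreases a potential. -/
theorem Run.whileLoop {K : ℕ} (hK : 2 < K) {c : Cmd} (hc : c.ok K) {x y : ℕ} (hx : x < K)
    (hy : y < K) {n : ℕ} {Inv : State → ℝ → Prop} (hn : ∀ s φ, Inv s φ → s.reg 2 = n)
    (hΦ : ∀ s φ, Inv s φ → 0 ≤ φ)
    (hb : ∀ s φ, Inv s φ → s.reg x < s.reg y → ∃ φ', Inv (c.eval s) φ' ∧ φ' + 1 ≤ φ)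
    {s s₀ : State} {φ : ℝ} (hs : Cmd.Agree K s₀ s) (h : Inv s₀ φ) :
    ∃ t s', Exec (.loop (.lt x y) (c.compile K)) s t s' ∧
      (t : ℝ) ≤ φ * (c.cost n + 1) + 1 ∧ ∃ s₁ φ₁, Cmd.Agree K s₁ s' ∧ Inv s₁ φ₁ ∧
        ¬ s₁.reg x < s₁.reg y := by
  -- The potential is real, so the induction runs on a natural number above it.
  obtain ⟨m, hm⟩ := exists_nat_gt φ
  induction m generalizing s s₀ φ with
  | zero => exact absurd (hΦ s₀ φ h) (by simpa using hm)
  | succ m ih =>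
    by_cases hlt : s₀.reg x < s₀.reg y
    · obtain ⟨φ', h1, h2⟩ := hb s₀ φ h hlt
      obtain ⟨t, s', he, ht, ha⟩ := Cmd.run_compile hK hc le_rfl s
      have ha' := (Cmd.eval_agree hK hc le_rfl hs).trans ha
      obtain ⟨t', s'', he', ht', s₁, hs₁⟩ := ih ha' h1 (by push_cast at hm; linarith)
      refine ⟨t + t' + 1, s'', .loopTrue ?_ he he', ?_, s₁, hs₁⟩
      · simpa [Test.Holds, hs.1 x hx, hs.1 y hy] using hlt
      · rw [hs.1 2 hK, hn s₀ φ h] at ht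
        have ht2 : (t : ℝ) ≤ c.cost n := by exact_mod_cast ht
        have h3 : (φ' + 1) * ((c.cost n : ℝ) + 1) ≤ φ * (c.cost n + 1) :=
          mul_le_mul_of_nonneg_right h2 (by positivity)
        push_cast
        linarith
    · refine ⟨1, s, .loopFalse ?_, ?_, s₀, φ, hs, h, hlt⟩
      · simpa [Test.Holds, hs.1 x hx, hs.1 y hy] using hlt
      · have := mul_nonneg (hΦ s₀ φ h) (by positivity : (0 : ℝ) ≤ c.cost n + 1)
        push_cast; linarith

end RAM

/-! ### Branching for Directed Maximum Leaf -/

namespace MaxLeaf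

open Classical in
/-- The root `r` together with the out-neighbours of `J`. -/
noncomputable def dom {V : Type*} [Fintype V] (D : Digraph V) (r : V) (J : Finset V) : Finset V :=
  Finset.univ.filter fun w => w = r ∨ ∃ u ∈ J, D.Adj u w

/-- Reachability from `r` along paths all of whose vertices but the last are in `J`. -/
inductive Reach {V : Type*} (D : Digraph V) (r : V) (J : Finset V) : V → Prop where
  | root : Reach D r J r
  | step {u w : V} : Reach D r J u → u ∈ J → D.Adj u w → Reach D r J w

/-- `J` can be the set of internal vertices of an out-tree with root `r`. -/
def Good {V : Type*} (D : Digraph V) (r : V) (J : Finset V) : Prop := ∀ u ∈ J, Reach D r J u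

open Classical in
/-- The vertices decided to be internal: those of status `1`. -/
noncomputable def ones {V : Type*} [Fintype V] (st : V → ℕ) : Finset V :=
  Finset.univ.filter fun u => st u = 1

/-- Some set `J` of internal vertices which is compatible with the status function `st` (`0`:
undecided, `1`: internal, at least `2`: leaf) gives rise to an out-tree with `k` leaves. -/
def Ach {V : Type*} [Fintype V] (D : Digraph V) (r : V) (st : V → ℕ) (k : ℕ) : Prop :=
  ∃ J, Good D r J ∧ (∀ u, st u = 1 → u ∈ J) ∧ (∀ u ∈ J, ¬ 1 < st u) ∧
    k + J.card ≤ (dom D r J).card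

open Classical in
/-- The vertices which enter the tree when `v` becomes internal. -/
noncomputable def fresh {V : Type*} [Fintype V] (D : Digraph V) (r : V) (st : V → ℕ) (v : V) :
    Finset V :=
  Finset.univ.filter fun w => D.Adj v w ∧ w ∉ dom D r (ones st)

open Classical in
/-- The undecided vertices other than `v` which could be parents of vertices in `fresh`. -/
noncomputable def rivals {V : Type*} [Fintype V] (D : Digraph V) (r : V) (st : V → ℕ) (v : V) :
    Finset V :=
  Finset.univ.filter fun u => st u = 0 ∧ u ≠ v ∧ u ∉ fresh D r st v ∧
    ∃ x ∈ fresh D r st v, D.Adj u x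

open Classical in
noncomputable def optLeaf {V : Type*} (st : V → ℕ) (v : V) : V → ℕ :=
  fun w => if w = v then 2 else st w

open Classical in
noncomputable def optPath {V : Type*} (st : V → ℕ) (v x : V) : V → ℕ :=
  fun w => if w = v ∨ w = x then 1 else st w

-- Meant for `y` internal and `x` not: the case of an internal `x` is left to `optPath`, and
-- deciding `x` here as well lowers the measure further.
open Classical in
noncomputable def optSecond {V : Type*} (st : V → ℕ) (v x y : V) : V → ℕ :=
  fun w => if w = v ∨ w = y then 1 else if w = x then 2 else st w

-- `S` is the set of vertices which may be assumed to be leaves: empty in general, and all fresh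
-- vertices and rivals when there are two fresh vertices and some rival.
open Classical in
noncomputable def optInternal {V : Type*} (st : V → ℕ) (v : V) (S : Finset V) : V → ℕ :=
  fun w => if w = v then 1 else if w ∈ S then 2 else st w

open Classical in
/-- The branches for the undecided vertex `v`. -/
noncomputable def branches {V : Type*} [Fintype V] (D : Digraph V) (r : V) (st : V → ℕ)
    (v x y : V) : List (V → ℕ) :=
  (if (fresh D r st v).card = 2 ∧ rivals D r st v = ∅ then [] else [optLeaf st v]) ++
  ((if ((fresh D r st v).card = 1 ∨ (fresh D r st v).card = 2 ∧ rivals D r st v ≠ ∅) ∧ st x = 0 then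
    [optPath st v x] else []) ++
  ((if ((fresh D r st v).card = 2 ∧ rivals D r st v ≠ ∅) ∧ st y = 0 then
    [optSecond st v x y] else []) ++
  (if 2 ≤ (fresh D r st v).card then
    [optInternal st v (if (fresh D r st v).card = 2 ∧ rivals D r st v ≠ ∅ then
      fresh D r st v ∪ rivals D r st v else ∅)] else [])))

/-- The choice of `v`, `x` and `y`. -/
structure Choice {V : Type*} [Fintype V] (D : Digraph V) (r : V) (st : V → ℕ) (v x y : V) :
    Prop where
  good : Good D r (ones st)
  undecided : st v = 0
  mem_dom : v ∈ dom D r (ones st)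
  first : 1 ≤ (fresh D r st v).card → x ∈ fresh D r st v
  second : 2 ≤ (fresh D r st v).card → y ∈ fresh D r st v ∧ y ≠ x

/-! ### Reachability and covered vertices -/

section

variable {V : Type*} [Fintype V] {D : Digraph V} {r : V}

theorem mem_dom_iff {J : Finset V} {w : V} : w ∈ dom D r J ↔ w = r ∨ ∃ u ∈ J, D.Adj u w := by
  simp [dom]

theorem mem_ones {st : V → ℕ} {u : V} : u ∈ ones st ↔ st u = 1 := by simp [ones]

theorem mem_fresh {st : V → ℕ} {v w : V} :
    w ∈ fresh D r st v ↔ D.Adj v w ∧ w ∉ dom D r (ones st) := by simp [fresh]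

theorem mem_rivals {st : V → ℕ} {v u : V} : u ∈ rivals D r st v ↔ st u = 0 ∧ u ≠ v ∧
    u ∉ fresh D r st v ∧ ∃ x ∈ fresh D r st v, D.Adj u x := by simp [rivals]

omit [Fintype V] in
theorem Reach.mono {J J' : Finset V} (h : J ⊆ J') {u : V} (hu : Reach D r J u) :
    Reach D r J' u := by
  induction hu with
  | root => exact .root
  | step _ h2 h3 ih => exact .step ih (h h2) h3

theorem dom_mono {J J' : Finset V} (h : J ⊆ J') : dom D r J ⊆ dom D r J' := by
  intro w hw
  rw [mem_dom_iff] at hw ⊢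
  exact hw.imp_right fun ⟨u, hu, hw⟩ => ⟨u, h hu, hw⟩

theorem Reach.mem_dom {J : Finset V} {u : V} (hu : Reach D r J u) : u ∈ dom D r J := by
  rw [mem_dom_iff]
  cases hu with
  | root => exact .inl rfl
  | step _ h2 h3 => exact .inr ⟨_, h2, h3⟩

theorem Good.reach {J : Finset V} (h : Good D r J) {w : V} (hw : w ∈ dom D r J) :
    Reach D r J w := by
  rcases mem_dom_iff.1 hw with rfl | ⟨u, hu, huw⟩
  · exact .root
  · exact .step (h u hu) hu huw

open Classical in
theorem Good.insert {J : Finset V} (h : Good D r J) {v : V} (hv : v ∈ dom D r J) :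
    Good D r (insert v J) := by
  intro u hu
  refine Reach.mono (Finset.subset_insert v J) ?_
  rcases Finset.mem_insert.1 hu with rfl | hu
  · exact h.reach hv
  · exact h u hu

/-- A vertex decided to be internal is reachable through decided internal vertices and therefore
covered, unlike a fresh one. -/
theorem Choice.st_fresh {st : V → ℕ} {v x y : V} (h : Choice D r st v x y) {w : V}
    (hw : w ∈ fresh D r st v) : st w ≠ 1 := fun h1 =>
  (mem_fresh.1 hw).2 (h.good w (mem_ones.2 h1)).mem_dom

theorem Choice.not_mem_fresh {st : V → ℕ} {v x y : V} (h : Choice D r st v x y) :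
    v ∉ fresh D r st v := fun hw => (mem_fresh.1 hw).2 h.mem_dom

theorem Choice.ne_of_mem {st : V → ℕ} {v x y w : V} (h : Choice D r st v x y)
    (hw : w ∈ fresh D r st v) : w ≠ v := fun e => h.not_mem_fresh (e ▸ hw)

/-! #### Exchange arguments -/

section Exchange

open Classical

variable {st : V → ℕ} {v x y : V} (hc : Choice D r st v x y) {J : Finset V} (hJ : Good D r J)
  (h1 : ∀ u, st u = 1 → u ∈ J)

include hc hJ h1

/-- Only the fresh vertices can depend on `v` for being reached, and none of them is in `J`, so none
is passed on the way to another vertex. -/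
theorem Choice.good_erase (hN : ∀ w ∈ fresh D r st v, w ∉ J) : Good D r (J.erase v) := by
  have hI : ones st ⊆ J.erase v := fun u hu => by
    rw [mem_ones] at hu
    refine Finset.mem_erase.2 ⟨?_, h1 u hu⟩
    rintro rfl
    simp [hc.undecided] at hu
  have key : ∀ u, Reach D r J u → u ∈ fresh D r st v ∨ Reach D r (J.erase v) u := by
    intro u hu
    induction hu with
    | root => exact .inr .root
    | @step u w hu huJ huw ih =>
      have ih := ih.resolve_left fun h => hN u h huJ
      -- An arc from `v` to a vertex that is not fresh can be bypassed through `ones st`, which does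
      -- not contain `v`.
      by_cases huv : u = v
      · subst huv
        by_cases hw : w ∈ dom D r (ones st)
        · exact .inr ((hc.good.reach hw).mono hI)
        · exact .inl (mem_fresh.2 ⟨huw, hw⟩)
      · exact .inr (.step ih (Finset.mem_erase.2 ⟨huv, huJ⟩) huw)
  intro u hu
  exact (key u (hJ u (Finset.mem_of_mem_erase hu))).resolve_left
    fun h => hN u h (Finset.mem_of_mem_erase hu)

/-- Turning `v` into a leaf removes one element of `J` and uncovers at most the single vertex
allowed in `S`, so `|dom J| - |J|` does not drop. -/
theorem Choice.ach_erase (h2 : ∀ u ∈ J, ¬ 1 < st u) {k : ℕ} (hk : k + J.card ≤ (dom D r J).card)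
    (hN : ∀ w ∈ fresh D r st v, w ∉ J) {S : Finset V} (hS : S.card ≤ 1)
    (hdom : ∀ w ∈ fresh D r st v, w ∉ S → ∃ u ∈ J, u ≠ v ∧ D.Adj u w) :
    Ach D r (optLeaf st v) k := by
  have hsub : dom D r J ⊆ dom D r (J.erase v) ∪ (if v ∈ J then S else ∅) := by
    intro w hw
    rw [Finset.mem_union, mem_dom_iff]
    rcases mem_dom_iff.1 hw with rfl | ⟨u, hu, huw⟩
    · exact .inl (.inl rfl)
    · by_cases huv : u = v
      · subst huv
        by_cases hwd : w ∈ dom D r (ones st)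
        · rcases mem_dom_iff.1 hwd with h | ⟨u', hu', hw'⟩
          · exact .inl (.inl h)
          · rw [mem_ones] at hu'
            refine .inl (.inr ⟨u', Finset.mem_erase.2 ⟨?_, h1 u' hu'⟩, hw'⟩)
            rintro rfl
            simp [hc.undecided] at hu'
        · by_cases hwS : w ∈ S
          · right; simpa [hu] using hwS
          · obtain ⟨u', hu', hne, hw'⟩ := hdom w (mem_fresh.2 ⟨huw, hwd⟩) hwS
            exact .inl (.inr ⟨u', Finset.mem_erase.2 ⟨hne, hu'⟩, hw'⟩)
      · exact .inl (.inr ⟨u, Finset.mem_erase.2 ⟨huv, hu⟩, huw⟩)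
  refine ⟨J.erase v, hc.good_erase hJ h1 hN, ?_, ?_, ?_⟩
  · intro u hu
    unfold optLeaf at hu
    split_ifs at hu with huv
    · simp at hu
    exact Finset.mem_erase.2 ⟨huv, h1 u hu⟩
  · intro u hu
    rw [Finset.mem_erase] at hu
    simpa [optLeaf, hu.1] using h2 u hu.2
  · have h3 := (Finset.card_le_card hsub).trans (Finset.card_union_le _ _)
    by_cases hv : v ∈ J
    · rw [if_pos hv] at h3
      have := Finset.card_erase_add_one hv
      omega
    · rw [if_neg hv, Finset.card_empty] at h3
      rw [Finset.erase_eq_of_notMem hv] at h3 ⊢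
      omega

-- Without rivals, a set `J` that avoids `v` cannot reach any fresh vertex. Adding `v` costs one
-- internal vertex and covers at least one new vertex.
omit h1 in
theorem Choice.ach_insert (h1 : ∀ u, st u = 1 → u ∈ J) (h2 : ∀ u ∈ J, ¬ 1 < st u) {k : ℕ}
    (hk : k + J.card ≤ (dom D r J).card)
    (hN : (fresh D r st v).Nonempty) (hE : rivals D r st v = ∅) (hv : v ∉ J) :
    Ach D r (optInternal st v ∅) k := by
  have hI : ones st ⊆ J := fun u hu => h1 u (mem_ones.1 hu)
  -- Outside the fresh set such a `u` would be a rival: it is not `v`, not a leaf, and not decided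
  -- internal, since then `w` would be covered.
  have step : ∀ u w, u ∈ J → D.Adj u w → w ∈ fresh D r st v → u ∈ fresh D r st v := by
    intro u w hu huw hw
    by_contra hne
    have h0 : st u = 0 := by
      have h01 : st u ≠ 1 := fun h => (mem_fresh.1 hw).2 (mem_dom_iff.2 (.inr ⟨u, mem_ones.2 h, huw⟩))
      have := h2 u hu
      omega
    have : u ∈ rivals D r st v := mem_rivals.2 ⟨h0, fun e => hv (e ▸ hu), hne, w, hw, huw⟩
    simp [hE] at this
  have key : ∀ u, Reach D r J u → u ∉ fresh D r st v := by
    intro u hu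
    induction hu with
    | root => exact fun h => (mem_fresh.1 h).2 (mem_dom_iff.2 (.inl rfl))
    | step _ huJ huw ih => exact fun hw => ih (step _ _ huJ huw hw)
  obtain ⟨w, hw⟩ := hN
  have hwJ : w ∉ dom D r J := fun h => key w (hJ.reach h) hw
  refine ⟨Insert.insert v J, hJ.insert (dom_mono hI hc.mem_dom), ?_, ?_, ?_⟩
  · intro u hu
    unfold optInternal at hu
    split_ifs at hu with huv hmem
    · exact huv ▸ Finset.mem_insert_self v J
    · simp at hu
    · exact Finset.mem_insert_of_mem (h1 u hu)
  · intro u hu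
    by_cases huv : u = v
    · simp [optInternal, huv]
    · simpa [optInternal, huv] using h2 u (Finset.mem_of_mem_insert_of_ne hu huv)
  · have h3 : Insert.insert w (dom D r J) ⊆ dom D r (Insert.insert v J) := by
      refine Finset.insert_subset (mem_dom_iff.2 (.inr ⟨v, Finset.mem_insert_self v J,
        (mem_fresh.1 hw).1⟩)) (dom_mono (Finset.subset_insert v J))
    have := Finset.card_le_card h3
    rw [Finset.card_insert_of_notMem hwJ] at this
    rw [Finset.card_insert_of_notMem hv]
    omega

end Exchange

/-- Soundness of branching: the witness `J` either fits one of the children as it is, or is first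
changed by an exchange that preserves the bound `k`. -/
theorem Choice.exists_ach {st : V → ℕ} {v x y : V} (hc : Choice D r st v x y) {k : ℕ}
    (h : Ach D r st k) : ∃ c ∈ branches D r st v x y, Ach D r c k := by
  classical
  obtain ⟨J, hJ, h1, h2, hk⟩ := h
  have hA : ¬ ((fresh D r st v).card = 2 ∧ rivals D r st v = ∅) →
      Ach D r (optLeaf st v) k → ∃ c ∈ branches D r st v x y, Ach D r c k := fun h h' =>
    ⟨_, by simp [branches, h], h'⟩
  by_cases hv : v ∈ J
  swap
  -- Here `v ∉ J`. The branch with `v` a leaf is missing only for two fresh vertices without rivals,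
  -- and then `v` can be added to `J`.
  · by_cases hE : (fresh D r st v).card = 2 ∧ rivals D r st v = ∅
    · refine ⟨_, ?_, hc.ach_insert hJ h1 h2 hk (Finset.card_pos.1 (by omega)) hE.2 hv⟩
      simp [branches, hE]
    · refine hA hE ⟨J, hJ, ?_, ?_, hk⟩
      · intro u hu
        unfold optLeaf at hu
        split_ifs at hu with huv
        · simp at hu
        · exact h1 u hu
      · intro u hu
        have : u ≠ v := fun e => hv (e ▸ hu)
        simpa [optLeaf, this] using h2 u hu
  by_cases hd : 2 ≤ (fresh D r st v).card
  swap
  -- At most one fresh vertex: if it is not internal, removing `v` from `J` uncovers at most this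
  -- vertex.
  · by_cases hN : ∀ w ∈ fresh D r st v, w ∉ J
    · refine hA (by omega) (hc.ach_erase hJ h1 h2 hk hN (S := fresh D r st v) (by omega)
        fun w hw hw' => absurd hw hw')
    · push Not at hN
      obtain ⟨w, hw, hwJ⟩ := hN
      have hcard : (fresh D r st v).card = 1 := by
        have := Finset.card_pos.2 ⟨w, hw⟩; omega
      obtain ⟨z, hz⟩ := Finset.card_eq_one.1 hcard
      have hx := hc.first (by omega)
      obtain rfl : w = x := by simp [hz] at hw hx; rw [hw, hx]
      have h0 : st w = 0 := by
        have := hc.st_fresh hw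
        have := h2 w hwJ
        omega
      refine ⟨optPath st v w, by simp [branches, hcard, h0], J, hJ, ?_, ?_, hk⟩
      · intro u hu
        unfold optPath at hu
        split_ifs at hu with huv
        · rcases huv with rfl | rfl <;> assumption
        · exact h1 u hu
      · intro u hu
        unfold optPath
        split_ifs with huv
        · simp
        · exact h2 u hu
  by_cases hcd : (fresh D r st v).card = 2 ∧ rivals D r st v ≠ ∅
  swap
  · refine ⟨optInternal st v ∅, by simp [branches, hd, hcd], J, hJ, ?_, ?_, hk⟩
    · intro u hu
      unfold optInternal at hu
      split_ifs at hu with huv hmem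
      · exact huv ▸ hv
      · simp at hu
      · exact h1 u hu
    · intro u hu
      by_cases huv : u = v
      · simp [optInternal, huv]
      · simpa [optInternal, huv] using h2 u hu
  have hx := hc.first (by omega)
  obtain ⟨hy, hyx⟩ := hc.second hd
  have hN : fresh D r st v = {x, y} := by
    refine (Finset.eq_of_subset_of_card_le ?_ ?_).symm
    · intro w hw
      simp only [Finset.mem_insert, Finset.mem_singleton] at hw
      rcases hw with rfl | rfl <;> assumption
    · rw [Finset.card_pair hyx.symm]; omega
  have hst : ∀ w ∈ fresh D r st v, w ∈ J → st w = 0 := fun w hw hwJ => by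
    have := hc.st_fresh hw
    have := h2 w hwJ
    omega
  by_cases hxJ : x ∈ J
  · refine ⟨optPath st v x, by simp [branches, hcd, hst x hx hxJ], J, hJ, ?_, ?_, hk⟩
    · intro u hu
      unfold optPath at hu
      split_ifs at hu with huv
      · rcases huv with rfl | rfl <;> assumption
      · exact h1 u hu
    · intro u hu
      unfold optPath
      split_ifs with huv
      · simp
      · exact h2 u hu
  by_cases hyJ : y ∈ J
  · refine ⟨optSecond st v x y, by simp [branches, hcd, hst y hy hyJ], J, hJ, ?_, ?_, hk⟩
    · intro u hu
      unfold optSecond at hu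
      split_ifs at hu with huv hux
      · rcases huv with rfl | rfl <;> assumption
      · simp at hu
      · exact h1 u hu
    · intro u hu
      unfold optSecond
      split_ifs with huv hux
      · simp
      · exact absurd (hux ▸ hu) hxJ
      · exact h2 u hu
  have hNJ : ∀ w ∈ fresh D r st v, w ∉ J := by
    intro w hw
    simp only [hN, Finset.mem_insert, Finset.mem_singleton] at hw
    rcases hw with rfl | rfl <;> assumption
  -- Neither fresh vertex is internal. An internal rival covers one of them, so removing `v`
  -- uncovers at most the other.
  by_cases hR : ∃ e ∈ rivals D r st v, e ∈ J
  · obtain ⟨e, he, heJ⟩ := hR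
    obtain ⟨-, hev, -, z, hz, hez⟩ := mem_rivals.1 he
    refine hA (fun h => hcd.2 h.2) (hc.ach_erase hJ h1 h2 hk hNJ
      (S := (fresh D r st v).erase z) ?_ ?_)
    · rw [Finset.card_erase_of_mem hz]; omega
    · intro w hw hwS
      have : w = z := by
        by_contra hne
        exact hwS (Finset.mem_erase.2 ⟨hne, hw⟩)
      exact ⟨e, heJ, hev, this ▸ hez⟩
  · push Not at hR
    refine ⟨optInternal st v (fresh D r st v ∪ rivals D r st v),
      by simp [branches, hcd], J, hJ, ?_, ?_, hk⟩
    · intro u hu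
      unfold optInternal at hu
      split_ifs at hu with huv hmem
      · exact huv ▸ hv
      · simp at hu
      · exact h1 u hu
    · intro u hu
      unfold optInternal
      split_ifs with huv hmem
      · simp
      · rcases Finset.mem_union.1 hmem with h | h
        · exact absurd hu (hNJ u h)
        · exact absurd hu (hR u h)
      · exact h2 u hu

open Classical in
theorem Choice.good_branches {st : V → ℕ} {v x y : V} (hc : Choice D r st v x y) {c : V → ℕ}
    (h : c ∈ branches D r st v x y) : Good D r (ones c) := by
  have h0 : Good D r (ones st) := hc.good
  have h1 : Good D r (insert v (ones st)) := h0.insert hc.mem_dom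
  have h2 : ∀ w ∈ fresh D r st v, Good D r (insert w (insert v (ones st))) := fun w hw =>
    h1.insert (mem_dom_iff.2 (.inr ⟨v, Finset.mem_insert_self _ _, (mem_fresh.1 hw).1⟩))
  simp only [branches, List.mem_append] at h
  rcases h with h | h | h | h
  · split_ifs at h with hh
    · simp at h
    · rw [List.mem_singleton] at h
      convert h0 using 1
      ext u
      rw [h, mem_ones, mem_ones, optLeaf]
      split_ifs with hu
      · simp [hu, hc.undecided]
      · rfl
  · split_ifs at h with hh
    · rw [List.mem_singleton] at h
      convert h2 x (hc.first (by omega)) using 1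
      ext u
      rw [h, Finset.mem_insert, Finset.mem_insert, mem_ones, mem_ones, optPath]
      split_ifs with hu
      · simp; tauto
      · tauto
    · simp at h
  · split_ifs at h with hh
    · rw [List.mem_singleton] at h
      have hx := hc.st_fresh (hc.first (by omega))
      obtain ⟨hy, hyx⟩ := hc.second (by omega)
      convert h2 y hy using 1
      ext u
      rw [h, Finset.mem_insert, Finset.mem_insert, mem_ones, mem_ones, optSecond]
      split_ifs with hu hux
      · simp; tauto
      · subst hux
        simp only [OfNat.ofNat_ne_one, hx, or_false, false_iff]
        tauto
      · tauto
    · simp at h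
  · split_ifs at h with hh hh2
    · rw [List.mem_singleton] at h
      convert h1 using 1
      ext u
      rw [h, Finset.mem_insert, mem_ones, mem_ones, optInternal]
      split_ifs with hu hux
      · simp [hu]
      · have : st u ≠ 1 := by
          rcases Finset.mem_union.1 hux with h | h
          · exact hc.st_fresh h
          · rw [(mem_rivals.1 h).1]; simp
        simp [hu, this]
      · simp [hu]
    · rw [List.mem_singleton] at h
      convert h1 using 1
      ext u
      rw [h, Finset.mem_insert, mem_ones, mem_ones, optInternal]
      by_cases hu : u = v <;> simp [hu]
    · simp at h

/-- If no vertex of the tree is undecided, the tree is determined. -/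
theorem Ach.of_decided {st : V → ℕ} (hst : ∀ v ∈ dom D r (ones st), st v ≠ 0) {k : ℕ}
    (h : Ach D r st k) : k + (ones st).card ≤ (dom D r (ones st)).card := by
  obtain ⟨J, hJ, h1, h2, hk⟩ := h
  have key : ∀ u, Reach D r J u → u ∈ dom D r (ones st) := by
    intro u hu
    induction hu with
    | root => exact mem_dom_iff.2 (.inl rfl)
    | @step u w _ huJ huw ih =>
      have := h2 u huJ
      have := hst u ih
      exact mem_dom_iff.2 (.inr ⟨u, mem_ones.2 (by omega), huw⟩)
  have : J = ones st := by
    ext u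
    refine ⟨fun hu => ?_, fun hu => h1 u (mem_ones.1 hu)⟩
    have := h2 u hu
    have := hst u (key u (hJ u hu))
    exact mem_ones.2 (by omega)
  rwa [this] at hk

/-! #### The measure -/

open Classical in
/-- The weight of a vertex. -/
noncomputable def weight (D : Digraph V) (r : V) (st : V → ℕ) (w : V) : ℕ :=
  if st w = 0 then (if w ∈ dom D r (ones st) then 19 else 20)
  else if 1 < st w ∧ w ∉ dom D r (ones st) then 1 else 0

/-- The measure which governs the number of branches. -/
noncomputable def measure (D : Digraph V) (r : V) (st : V → ℕ) : ℕ := ∑ w, weight D r st w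

theorem measure_le (st : V → ℕ) : measure D r st ≤ 20 * Fintype.card V := by
  have : ∀ w ∈ Finset.univ, weight D r st w ≤ 20 := fun w _ => by
    unfold weight; split_ifs <;> omega
  exact (Finset.sum_le_card_nsmul _ _ _ this).trans (by simp [mul_comm])

/-- Deciding vertices enlarges `ones` and with it the covered set, so no weight increases; `dec`
lists guaranteed drops. Becoming covered lowers an undecided vertex from 20 to 19 and a leaf from 1
to 0, so every fresh vertex contributes when `v` becomes internal. -/
theorem measure_add_le {st c : V → ℕ} (h : ∀ w, st w = 0 ∨ c w = st w ∨ 1 < st w ∧ 1 < c w)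
    {dec : V → ℕ} (hdec : dom D r (ones st) ⊆ dom D r (ones c) →
      ∀ w, dec w = 0 ∨ weight D r c w + dec w ≤ weight D r st w) :
    measure D r c + ∑ w, dec w ≤ measure D r st := by
  have hones : ones st ⊆ ones c := by
    intro w hw
    rw [mem_ones] at hw ⊢
    have := h w
    omega
  have hdom := dom_mono (D := D) (r := r) hones
  rw [measure, ← Finset.sum_add_distrib]
  refine Finset.sum_le_sum fun w _ => ?_
  rcases hdec hdom w with h0 | h0
  · rw [h0, add_zero]
    have hw := h w
    have hd := @hdom w
    unfold weight
    by_cases h1 : w ∈ dom D r (ones st) <;> by_cases h2 : w ∈ dom D r (ones c) <;>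
      simp only [h1, h2, not_true, not_false_eq_true, and_true, and_false, if_true, if_false] <;>
      first | (exfalso; exact h2 (hd h1)) | (split_ifs <;> omega)
  · exact h0

end

end MaxLeaf

/-! ### Measure drops and the branching inequality -/

namespace MaxLeaf

section

variable {V : Type*} [Fintype V] {D : Digraph V} {r : V} {st : V → ℕ} {v x y : V}

open Classical in
theorem Choice.measure_optLeaf (hc : Choice D r st v x y) :
    measure D r (optLeaf st v) + 19 ≤ measure D r st := by
  have := measure_add_le (D := D) (r := r) (st := st) (c := optLeaf st v)
    (dec := fun w => if w = v then 19 else 0) ?_ ?_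
  · simpa using this
  · intro w
    by_cases hw : w = v
    · exact .inl (hw ▸ hc.undecided)
    · simp [optLeaf, hw]
  · intro hd w
    by_cases hw : w = v
    · subst hw
      have h1 := hc.mem_dom
      have h2 := hd h1
      right
      rw [weight, weight, hc.undecided]
      simp [optLeaf, h1, h2]
    · simp [hw]

open Classical in
theorem Choice.measure_optInternal (hc : Choice D r st v x y) :
    measure D r (optInternal st v ∅) + (19 + (fresh D r st v).card) ≤ measure D r st := by
  have := measure_add_le (D := D) (r := r) (st := st) (c := optInternal st v ∅)
    (dec := fun w => (if w = v then 19 else 0) + (if w ∈ fresh D r st v then 1 else 0)) ?_ ?_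
  · simpa [Finset.sum_add_distrib] using this
  · intro w
    by_cases hw : w = v
    · exact .inl (hw ▸ hc.undecided)
    · simp [optInternal, hw]
  · intro hd w
    by_cases hw : w = v
    · subst hw
      have h1 := hc.mem_dom
      have h2 := hd h1
      right
      rw [weight, weight, hc.undecided]
      simp [optInternal, h1, hc.not_mem_fresh]
    · by_cases hf : w ∈ fresh D r st v
      · have h1 := (mem_fresh.1 hf).2
        have h2 : w ∈ dom D r (ones (optInternal st v ∅)) :=
          mem_dom_iff.2 (.inr ⟨v, mem_ones.2 (by simp [optInternal]), (mem_fresh.1 hf).1⟩)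
        have h3 := hc.st_fresh hf
        right
        have h4 : optInternal st v ∅ w = st w := by simp [optInternal, hw]
        simp only [weight, h1, h2, h4, if_true, if_false, hw, hf, not_true,
          not_false_eq_true, and_true, and_false]
        split_ifs <;> omega
      · simp [hw, hf]

-- The drop is 19 for `v`, 20 for `x`, which is undecided and uncovered before, and 1 for every
-- other fresh vertex.
open Classical in
theorem Choice.measure_optPath (hc : Choice D r st v x y) (hx : x ∈ fresh D r st v)
    (h0 : st x = 0) :
    measure D r (optPath st v x) + (38 + (fresh D r st v).card) ≤ measure D r st := by
  have hxv := hc.ne_of_mem hx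
  have := measure_add_le (D := D) (r := r) (st := st) (c := optPath st v x)
    (dec := fun w => (if w = v then 19 else 0) + ((if w = x then 19 else 0) +
      (if w ∈ fresh D r st v then 1 else 0))) ?_ ?_
  · simp [Finset.sum_add_distrib] at this
    omega
  · intro w
    by_cases hw : w = v
    · exact .inl (hw ▸ hc.undecided)
    · by_cases hwx : w = x
      · exact .inl (hwx ▸ h0)
      · simp [optPath, hw, hwx]
  · intro hd w
    by_cases hw : w = v
    · subst hw
      have h1 := hc.mem_dom
      have h2 := hd h1
      right
      rw [weight, weight, hc.undecided]
      simp [optPath, h1, hxv.symm, hc.not_mem_fresh]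
    · by_cases hf : w ∈ fresh D r st v
      · have h1 := (mem_fresh.1 hf).2
        have h2 : w ∈ dom D r (ones (optPath st v x)) :=
          mem_dom_iff.2 (.inr ⟨v, mem_ones.2 (by simp [optPath]), (mem_fresh.1 hf).1⟩)
        have h3 := hc.st_fresh hf
        right
        by_cases hwx : w = x
        · subst hwx
          simp [weight, h0, h1, hf, hw, optPath]
        · have h4 : optPath st v x w = st w := by simp [optPath, hw, hwx]
          simp only [weight, h1, h2, h4, if_true, if_false, hw, hf, hwx, not_true,
            not_false_eq_true, and_true, and_false]
          split_ifs <;> omega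
      · have hwx : w ≠ x := fun e => hf (e ▸ hx)
        simp [hw, hf, hwx]

-- The drop is 19 for `v`, 20 for `y`, and for `x` its whole weight: 20 if undecided, 1 if already a
-- leaf.
open Classical in
theorem Choice.measure_optSecond (hc : Choice D r st v x y) (hx : x ∈ fresh D r st v)
    (hy : y ∈ fresh D r st v) (hyx : y ≠ x) (h0 : st y = 0) :
    measure D r (optSecond st v x y) + (39 + (if st x = 0 then 20 else 1)) ≤ measure D r st := by
  have hxv := hc.ne_of_mem hx
  have hyv := hc.ne_of_mem hy
  have hx1 := hc.st_fresh hx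
  have := measure_add_le (D := D) (r := r) (st := st) (c := optSecond st v x y)
    (dec := fun w => (if w = v then 19 else 0) + ((if w = y then 20 else 0) +
      (if w = x then (if st x = 0 then 20 else 1) else 0))) ?_ ?_
  · simp only [Finset.sum_add_distrib, Finset.sum_ite_eq', Finset.mem_univ, if_true] at this
    omega
  · intro w
    by_cases hw : w = v
    · exact .inl (hw ▸ hc.undecided)
    · by_cases hwy : w = y
      · exact .inl (hwy ▸ h0)
      · by_cases hwx : w = x
        · subst hwx
          have : optSecond st v w y w = 2 := by simp [optSecond, hw, hwy]
          omega
        · simp [optSecond, hw, hwy, hwx]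
  · intro hd w
    by_cases hw : w = v
    · subst hw
      have h1 := hc.mem_dom
      right
      rw [weight, weight, hc.undecided]
      simp [optSecond, h1, hxv.symm, hyv.symm]
    · by_cases hwy : w = y
      · subst hwy
        have h1 := (mem_fresh.1 hy).2
        right
        simp [weight, h0, h1, hw, optSecond, hyx]
      · by_cases hwx : w = x
        · subst hwx
          have h1 := (mem_fresh.1 hx).2
          have h2 : w ∈ dom D r (ones (optSecond st v w y)) :=
            mem_dom_iff.2 (.inr ⟨v, mem_ones.2 (by simp [optSecond]), (mem_fresh.1 hx).1⟩)
          have h4 : optSecond st v w y w = 2 := by simp [optSecond, hw, hwy]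
          right
          simp only [weight, h1, h2, h4, if_true, if_false, hw, hwy, not_true,
            not_false_eq_true, and_true, and_false]
          split_ifs <;> first | contradiction | omega
        · simp [hw, hwx, hwy]

-- Both fresh vertices lose their whole weight. One rival suffices for a further 19: it falls from
-- 19 to 0 if covered, and from 20 to at most 1 otherwise.
open Classical in
theorem Choice.measure_optInternal_union (hc : Choice D r st v x y) (hx : x ∈ fresh D r st v)
    (hy : y ∈ fresh D r st v) (hyx : y ≠ x) (hR : rivals D r st v ≠ ∅) :
    measure D r (optInternal st v (fresh D r st v ∪ rivals D r st v)) +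
      (38 + (if st x = 0 then 20 else 1) + (if st y = 0 then 20 else 1)) ≤ measure D r st := by
  obtain ⟨e, he⟩ := Finset.nonempty_iff_ne_empty.2 hR
  obtain ⟨he0, hev, hef, -⟩ := mem_rivals.1 he
  have hxv := hc.ne_of_mem hx
  have hyv := hc.ne_of_mem hy
  have hex : e ≠ x := fun h => hef (h ▸ hx)
  have hey : e ≠ y := fun h => hef (h ▸ hy)
  have := measure_add_le (D := D) (r := r) (st := st)
    (c := optInternal st v (fresh D r st v ∪ rivals D r st v))
    (dec := fun w => (if w = v then 19 else 0) + ((if w = e then 19 else 0) +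
      ((if w = x then (if st x = 0 then 20 else 1) else 0) +
      (if w = y then (if st y = 0 then 20 else 1) else 0)))) ?_ ?_
  · simp only [Finset.sum_add_distrib, Finset.sum_ite_eq', Finset.mem_univ, if_true] at this
    omega
  · intro w
    by_cases hw : w = v
    · exact .inl (hw ▸ hc.undecided)
    · by_cases hf : w ∈ fresh D r st v
      · have h1 := hc.st_fresh hf
        have : optInternal st v (fresh D r st v ∪ rivals D r st v) w = 2 := by
          simp [optInternal, hw, hf]
        omega
      · by_cases hr : w ∈ rivals D r st v
        · exact .inl (mem_rivals.1 hr).1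
        · simp [optInternal, hw, hf, hr]
  · intro hd w
    have hmem : ∀ {w}, w ∈ fresh D r st v →
        w ∈ dom D r (ones (optInternal st v (fresh D r st v ∪ rivals D r st v))) := fun h =>
      mem_dom_iff.2 (.inr ⟨v, mem_ones.2 (by simp [optInternal]), (mem_fresh.1 h).1⟩)
    by_cases hw : w = v
    · subst hw
      have h1 := hc.mem_dom
      right
      rw [weight, weight, hc.undecided]
      simp [optInternal, h1, hxv.symm, hyv.symm, hev.symm]
    · by_cases hwe : w = e
      · subst hwe
        right
        simp only [weight, he0, hw, optInternal, hex, hey, if_true, if_false, Finset.mem_union,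
          he, or_true]
        split_ifs <;> first | omega | (exfalso; tauto)
      · have key : w ∈ fresh D r st v → weight D r (optInternal st v
            (fresh D r st v ∪ rivals D r st v)) w + (if st w = 0 then 20 else 1) ≤
            weight D r st w := by
          intro hf
          have h1 := (mem_fresh.1 hf).2
          have h2 := hmem hf
          have h3 := hc.st_fresh hf
          have h4 : optInternal st v (fresh D r st v ∪ rivals D r st v) w = 2 := by
            simp [optInternal, hw, hf]
          simp only [weight, h1, h2, h4, if_true, if_false, not_true,
          not_false_eq_true, and_true, and_false]
          split_ifs <;> first | contradiction | omega
        by_cases hwx : w = x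
        · subst hwx
          right
          simpa [hw, hwe, hyx.symm] using key hx
        · by_cases hwy : w = y
          · subst hwy
            right
            simpa [hw, hwe, hwx] using key hy
          · simp [hw, hwe, hwx, hwy]

/-- Here `a` is a decimal upper bound for `1.035 ^ (-k)`, so that the branching inequality becomes a
sum of decimals. -/
theorem pow_measure_le {m m' k : ℕ} {a : ℝ} (h : m' + k ≤ m) (ha : 1 ≤ a * (1.035 : ℝ) ^ k) :
    (1.035 : ℝ) ^ m' ≤ a * 1.035 ^ m := by
  have h1 : (1.035 : ℝ) ^ (m' + k) ≤ 1.035 ^ m := pow_le_pow_right₀ (by norm_num) h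
  have h2 : (0 : ℝ) < 1.035 ^ m' := by positivity
  have ha0 : 0 ≤ a := by
    by_contra hneg
    have : a * (1.035 : ℝ) ^ k ≤ 0 := mul_nonpos_of_nonpos_of_nonneg (by linarith) (by positivity)
    linarith
  calc (1.035 : ℝ) ^ m' = 1 * 1.035 ^ m' := by ring
    _ ≤ (a * 1.035 ^ k) * 1.035 ^ m' := by gcongr
    _ = a * 1.035 ^ (m' + k) := by ring
    _ ≤ _ := by gcongr

/-- The tight case is that of three or more fresh vertices, with drops 19 and 22: `0.5203 + 0.4693 =
0.9896`. Two undecided fresh vertices with rivals give drops 19, 40, 59 and 78, and `0.5203 + 0.253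
+ 0.132 + 0.069 = 0.9743`. -/
theorem Choice.sum_branches_le (hc : Choice D r st v x y) :
    ((branches D r st v x y).map fun c => (1.035 : ℝ) ^ measure D r c).sum ≤
      0.99 * 1.035 ^ measure D r st := by
  classical
  have p0 : (0 : ℝ) < 1.035 ^ measure D r st := by positivity
  have hA := pow_measure_le (a := 0.5203) hc.measure_optLeaf (by norm_num)
  by_cases h2 : (fresh D r st v).card = 2
  · have hx := hc.first (by omega)
    obtain ⟨hy, hyx⟩ := hc.second (by omega)
    by_cases hR : rivals D r st v = ∅
    · have hI := hc.measure_optInternal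
      rw [h2] at hI
      have := pow_measure_le (a := 0.99) hI (by norm_num)
      simpa [branches, h2, hR] using this
    · have hB := fun h0 => hc.measure_optPath hx h0
      have hC := fun h0 => hc.measure_optSecond hx hy hyx h0
      have hD := hc.measure_optInternal_union hx hy hyx hR
      rw [h2] at hB
      by_cases hx0 : st x = 0 <;> by_cases hy0 : st y = 0
      · have hB := pow_measure_le (a := 0.253) (hB hx0) (by norm_num)
        have hC := hC hy0
        simp only [hx0, hy0, if_true] at hC hD
        have hC := pow_measure_le (a := 0.132) hC (by norm_num)
        have hD := pow_measure_le (a := 0.069) hD (by norm_num)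
        simp [branches, h2, hR, hx0, hy0]
        linarith
      · have hB := pow_measure_le (a := 0.253) (hB hx0) (by norm_num)
        simp only [hx0, hy0, if_true, if_false] at hD
        have hD := pow_measure_le (a := 0.132) hD (by norm_num)
        simp [branches, h2, hR, hx0, hy0]
        linarith
      · have hC := hC hy0
        simp only [hx0, hy0, if_true, if_false] at hC hD
        have hC := pow_measure_le (a := 0.253) hC (by norm_num)
        have hD := pow_measure_le (a := 0.132) hD (by norm_num)
        simp [branches, h2, hR, hx0, hy0]
        linarith
      · simp only [hx0, hy0, if_false] at hD
        have hD := pow_measure_le (a := 0.253) hD (by norm_num)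
        simp [branches, h2, hR, hx0, hy0]
        linarith
  · by_cases h3 : 2 ≤ (fresh D r st v).card
    · have hI : measure D r (optInternal st v ∅) + 22 ≤ measure D r st := by
        have := hc.measure_optInternal
        omega
      have hI := pow_measure_le (a := 0.4693) hI (by norm_num)
      have h1 : (fresh D r st v).card ≠ 1 := by omega
      simp [branches, h2, h3, h1]
      linarith
    · by_cases h1 : (fresh D r st v).card = 1 ∧ st x = 0
      · have hB := hc.measure_optPath (hc.first (by omega)) h1.2
        rw [h1.1] at hB
        have hB := pow_measure_le (a := 0.262) hB (by norm_num)
        simp [branches, h1]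
        linarith
      · simp [branches, h2, h3, h1]
        linarith

end

end MaxLeaf

namespace MaxLeaf

/-! ### Out-branchings from parent functions -/

section

variable {V : Type*} {D : Digraph V} {r : V}

/-- The digraph in which every vertex other than `r` has its parent as only in-neighbour. -/
def treeOf (r : V) (par : V → V) : Digraph V where
  Adj u w := w ≠ r ∧ u = par w

/-- The rank decreases along parents, so every vertex is joined to `r`. The graph is connected with
at most one edge per vertex other than `r`, hence a tree. -/
theorem isOutBranching_treeOf [Finite V] {par : V → V} (hadj : ∀ w, w ≠ r → D.Adj (par w) w)
    {rk : V → ℕ} (hrk : ∀ w, w ≠ r → rk (par w) < rk w) : IsOutBranching D (treeOf r par) := by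
  classical
  have := Fintype.ofFinite V
  have hG : ∀ u w, w ≠ r → u = par w → (treeOf r par).toSimpleGraphInclusive.Adj u w := by
    intro u w hw hu
    rw [Digraph.toSimpleGraphInclusive, SimpleGraph.fromRel_adj]
    refine ⟨?_, .inl ⟨hw, hu⟩⟩
    rintro rfl
    have := hrk u hw
    rw [← hu] at this
    exact lt_irrefl _ this
  have hconn : (treeOf r par).toSimpleGraphInclusive.Connected := by
    have key : ∀ k w, rk w = k → (treeOf r par).toSimpleGraphInclusive.Reachable r w := by
      intro k
      induction k using Nat.strong_induction_on with
      | _ k ih =>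
        intro w hk
        by_cases hw : w = r
        · subst hw; exact SimpleGraph.Reachable.refl _
        · exact (ih _ (hk ▸ hrk w hw) _ rfl).trans (hG _ _ hw rfl).reachable
    have : Nonempty V := ⟨r⟩
    exact ⟨fun u w => (key _ u rfl).symm.trans (key _ w rfl)⟩
  refine ⟨?_, ?_, ?_, r, ?_, ?_⟩
  · rintro u w ⟨hw, rfl⟩
    exact hadj w hw
  · rintro u w ⟨hw, rfl⟩ ⟨hw', h⟩
    have h1 := hrk _ hw'
    have h2 := hrk _ hw
    rw [← h] at h1
    omega
  · rw [SimpleGraph.isTree_iff_connected_and_card]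
    refine ⟨hconn, le_antisymm ?_ hconn.card_vert_le_card_edgeSet_add_one⟩
    have hsub : (treeOf r par).toSimpleGraphInclusive.edgeSet ⊆
        (fun w => s(par w, w)) '' {w | w ≠ r} := by
      intro e
      induction e with
      | _ u w =>
        rw [SimpleGraph.mem_edgeSet, Digraph.toSimpleGraphInclusive, SimpleGraph.fromRel_adj]
        rintro ⟨-, ⟨hw, rfl⟩ | ⟨hw, rfl⟩⟩
        · exact ⟨w, hw, rfl⟩
        · exact ⟨u, hw, Sym2.eq_swap⟩
    have h1 := (Set.ncard_le_ncard hsub).trans (Set.ncard_image_le (Set.toFinite _))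
    have h2 : ({w | w ≠ r} : Set V).ncard + 1 = Nat.card V := by
      have := Set.ncard_compl ({r} : Set V)
      have h3 : 0 < Nat.card V := Nat.card_pos_iff.2 ⟨⟨r⟩, inferInstance⟩
      rw [Set.ncard_singleton] at this
      have h4 : ({r} : Set V)ᶜ = {w | w ≠ r} := rfl
      rw [← h4]
      omega
    rw [← h2]
    exact Nat.add_le_add_right h1 1
  · rintro u ⟨h, -⟩
    exact h rfl
  · intro w hw
    by_contra hne
    exact hw _ ⟨hne, rfl⟩

/-- A vertex that is not a leaf lies in `J` or is the parent of an uncovered vertex, so there are at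
most `|J| + |V| - |dom J|` of them. -/
theorem le_leafCount_treeOf [Fintype V] {par : V → V} {J : Finset V}
    (hJ : ∀ w ∈ dom D r J, w ≠ r → par w ∈ J) {k : ℕ} (hk : k + J.card ≤ (dom D r J).card) :
    k ≤ leafCount (treeOf r par) := by
  classical
  have hsub : ({v : V | ∀ u, ¬ (treeOf r par).Adj v u}ᶜ : Set V) ⊆
      ((J ∪ (dom D r J)ᶜ.image par : Finset V) : Set V) := by
    intro v hv
    simp only [Set.mem_compl_iff, Set.mem_ofPred_eq, not_forall, not_not] at hv
    obtain ⟨w, hw, rfl⟩ := hv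
    rw [Finset.mem_coe, Finset.mem_union]
    by_cases h : w ∈ dom D r J
    · exact .inl (hJ w h hw)
    · exact .inr (Finset.mem_image_of_mem _ (Finset.mem_compl.2 h))
  have h1 := Set.ncard_le_ncard hsub
  rw [Set.ncard_coe_finset] at h1
  have h2 := Finset.card_union_le J ((dom D r J)ᶜ.image par)
  have h3 := Finset.card_image_le (s := (dom D r J)ᶜ) (f := par)
  have h4 := Finset.card_compl_add_card (dom D r J)
  have h5 := Set.ncard_add_ncard_compl {v : V | ∀ u, ¬ (treeOf r par).Adj v u}
  rw [Nat.card_eq_fintype_card] at h5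
  rw [leafCount]
  omega

/-! ### From an out-branching to its internal vertices -/

theorem Reach.mono_graph {D T : Digraph V} (h : T ≤ D) {J : Finset V} {u : V}
    (hu : Reach T r J u) : Reach D r J u := by
  induction hu with
  | root => exact .root
  | step _ h2 h3 ih => exact .step ih h2 (h h3)

/-- The internal vertices of an out-branching. -/
theorem exists_good_of_isOutBranching [Fintype V] {T : Digraph V} (hT : IsOutBranching D T) :
    ∃ r J, Good D r J ∧ (∀ w, Reach D r J w) ∧ leafCount T + J.card ≤ (dom D r J).card := by
  classical
  obtain ⟨r, hr, huniq⟩ := hT.root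
  have hpar : ∀ w : {w // w ≠ r}, ∃ u, T.Adj u w := by
    rintro ⟨w, hw⟩
    by_contra hne
    push Not at hne
    exact hw (huniq w hne)
  choose par hpar using hpar
  have hedge : ∀ w : {w // w ≠ r}, s(par w, w.1) ∈ T.toSimpleGraphInclusive.edgeSet := by
    intro w
    rw [SimpleGraph.mem_edgeSet, Digraph.toSimpleGraphInclusive, SimpleGraph.fromRel_adj]
    refine ⟨fun h => ?_, .inl (hpar w)⟩
    have := hpar w
    rw [h] at this
    exact hT.asymm _ _ this this
  let f : {w // w ≠ r} → T.toSimpleGraphInclusive.edgeSet := fun w => ⟨_, hedge w⟩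
  have hf : Function.Injective f := by
    intro w w' h
    have h := congrArg Subtype.val h
    simp only [f, Sym2.eq_iff] at h
    rcases h with ⟨-, h⟩ | ⟨h1, h2⟩
    · exact Subtype.ext h
    · have h3 := hpar w
      have h4 := hpar w'
      rw [h1] at h3
      rw [← h2] at h4
      exact absurd h4 (hT.asymm _ _ h3)
  -- A tree has exactly as many edges as there are vertices other than `r`; hence every edge joins a
  -- vertex to its chosen parent, which gives unique in-neighbours.
  have hsurj : Function.Surjective f := by
    refine (Fintype.bijective_iff_injective_and_card f).2 ⟨hf, ?_⟩ |>.2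
    have h1 := (SimpleGraph.isTree_iff_connected_and_card.1 hT.isTree).2
    rw [Nat.card_eq_fintype_card, Nat.card_eq_fintype_card] at h1
    have h2 := Fintype.card_subtype_compl (fun w => w = r)
    rw [Fintype.card_subtype_eq] at h2
    change Fintype.card {w // ¬ w = r} = _
    omega
  have hin : ∀ u u' w, T.Adj u w → T.Adj u' w → u = u' := by
    have key : ∀ u w, T.Adj u w → ∀ hw : w ≠ r, u = par ⟨w, hw⟩ := by
      intro u w huw hw
      have he : s(u, w) ∈ T.toSimpleGraphInclusive.edgeSet := by
        rw [SimpleGraph.mem_edgeSet, Digraph.toSimpleGraphInclusive, SimpleGraph.fromRel_adj]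
        refine ⟨fun h => ?_, .inl huw⟩
        subst h
        exact hT.asymm _ _ huw huw
      obtain ⟨z, hz⟩ := hsurj ⟨_, he⟩
      have hz := congrArg Subtype.val hz
      simp only [f, Sym2.eq_iff] at hz
      rcases hz with ⟨h1, h2⟩ | ⟨h1, h2⟩
      · subst h2; exact h1.symm
      · have := hpar z
        rw [h1, h2] at this
        exact absurd this (hT.asymm _ _ huw)
    intro u u' w h h'
    have hw : w ≠ r := fun e => hr u (e ▸ h)
    rw [key u w h hw, key u' w h' hw]
  let J : Finset V := Finset.univ.filter fun u => ∃ w, T.Adj u w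
  have hJ : ∀ {u w}, T.Adj u w → u ∈ J := fun h => by simpa [J] using ⟨_, h⟩
  -- Going against an arc leads to the unique parent, which has been reached before its child. So
  -- walks in the underlying tree preserve directed reachability.
  have hadj : ∀ a b, T.toSimpleGraphInclusive.Adj a b → Reach T r J a → Reach T r J b := by
    intro a b hab ha
    rw [Digraph.toSimpleGraphInclusive, SimpleGraph.fromRel_adj] at hab
    rcases hab.2 with h | h
    · exact .step ha (hJ h) h
    · cases ha with
      | root => exact absurd h (hr b)
      | step h1 h2 h3 => exact hin _ _ _ h h3 ▸ h1
  have hall : ∀ w, Reach T r J w := by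
    intro w
    obtain ⟨p⟩ := hT.isTree.connected.preconnected r w
    have : ∀ {a b} (p : T.toSimpleGraphInclusive.Walk a b), Reach T r J a → Reach T r J b := by
      intro a b p
      induction p with
      | nil => exact id
      | cons h _ ih => exact fun ha => ih (hadj _ _ h ha)
    exact this p .root
  have hall' : ∀ w, Reach D r J w := fun w => (hall w).mono_graph hT.le
  refine ⟨r, J, fun u _ => hall' u, hall', ?_⟩
  have h1 : dom D r J = Finset.univ := Finset.eq_univ_of_forall fun w => (hall' w).mem_dom
  have h2 : ((J : Set V)ᶜ) = {v : V | ∀ u, ¬ T.Adj v u} := by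
    ext v; simp [J]
  have h5 := Set.ncard_add_ncard_compl (J : Set V)
  rw [h2, Set.ncard_coe_finset, Nat.card_eq_fintype_card] at h5
  rw [h1, Finset.card_univ, leafCount]
  omega

end

end MaxLeaf

namespace RAM

open Classical in
theorem adjArray_apply {n : ℕ} (D : Digraph (Fin n)) (i j : Fin n) :
    adjArray D (i * n + j) = if D.Adj i j then 1 else 0 := by
  have : (∃ i' j' : Fin n, (i : ℕ) * n + j = i' * n + j' ∧ D.Adj i' j') ↔ D.Adj i j := by
    constructor
    · rintro ⟨i', j', h, ha⟩
      have hn0 : 0 < n := i.pos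
      have e1 : (i : ℕ) = i' := by
        have := congrArg (· / n) h
        simpa [Nat.add_div_of_dvd_right, Nat.div_eq_of_lt, hn0] using this
      have e2 : (j : ℕ) = j' := by
        rw [e1] at h; omega
      rw [Fin.ext e1, Fin.ext e2]; exact ha
    · exact fun h => ⟨i, j, rfl, h⟩
  simp [adjArray, this]

/-! ### Derived expressions -/

namespace Expr

def and (e f : Expr) : Expr := .cond e f (.lit 0)
def or (e f : Expr) : Expr := .cond e (.lit 1) f
def not (e : Expr) : Expr := .cond e (.lit 0) (.lit 1)

/-- Whether `e` is nonzero for some value of `x`. -/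
def any (x : ℕ) (e : Expr) : Expr := .lt (.lit 0) (.sum x e)

/-- The least value of `x` for which `e` is nonzero, or the number of vertices if there is none. -/
def find (x y : ℕ) (e : Expr) : Expr :=
  .sum y (.cond (any x (.cond (.lt (.reg y) (.reg x)) (.lit 0) e)) (.lit 0) (.lit 1))

/-- The entry of the adjacency matrix with row and column in the registers `u` and `w`. -/
def arc (u w : ℕ) : Expr :=
  .eq (.get 0 (.add (.sum 29 (.cond (.lt (.reg 29) (.reg u)) (.reg 2) (.lit 0))) (.reg w)))
    (.lit 1)

/-- Every nonzero value counts as true, hence the form `≠ 0` of these equivalences. -/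
theorem eval_and_ne (e f : Expr) (s : State) :
    (and e f).eval s ≠ 0 ↔ e.eval s ≠ 0 ∧ f.eval s ≠ 0 := by
  simp only [and, eval]; split_ifs with h <;> simp [h]

theorem eval_or_ne (e f : Expr) (s : State) :
    (or e f).eval s ≠ 0 ↔ e.eval s ≠ 0 ∨ f.eval s ≠ 0 := by
  simp only [or, eval]; split_ifs with h <;> simp [h]

theorem eval_not_ne (e : Expr) (s : State) : (not e).eval s ≠ 0 ↔ e.eval s = 0 := by
  simp only [not, eval]; split_ifs with h <;> simp [h]

theorem eval_eq_ne (e f : Expr) (s : State) :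
    (eq e f).eval s ≠ 0 ↔ e.eval s = f.eval s := by
  simp [eval]

theorem eval_lt_ne (e f : Expr) (s : State) :
    (lt e f).eval s ≠ 0 ↔ e.eval s < f.eval s := by
  simp [eval]

theorem eval_any_ne {x : ℕ} {e : Expr} {s : State} {n : ℕ} (hn : s.reg 2 = n) :
    (any x e).eval s ≠ 0 ↔ ∃ i : Fin n, e.eval (s.setReg x i) ≠ 0 := by
  rw [any, eval_lt_ne]
  simp only [eval, Finset.sum_pos_iff, Finset.mem_range, hn]
  constructor
  · rintro ⟨i, hi, h⟩
    exact ⟨⟨i, hi⟩, by simp only; omega⟩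
  · rintro ⟨i, h⟩
    exact ⟨i, i.2, by have := i.2; omega⟩

theorem eval_sum_ind {x : ℕ} {e : Expr} {s : State} {n : ℕ} (hn : s.reg 2 = n) {p : Fin n → Prop}
    [DecidablePred p]
    (h : ∀ i : Fin n, e.eval (s.setReg x i) = if p i then 1 else 0) :
    (sum x e).eval s = (Finset.univ.filter p).card := by
  rw [eval, hn, Finset.sum_range, Finset.card_filter]
  refine Finset.sum_congr rfl fun i _ => ?_
  rw [h i]
  have := i.2
  split_ifs <;> omega

/-- The expression counts the `j` such that no `i ≤ j` satisfies `p`. These form the initial segment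
below the least solution. -/
theorem eval_find {x y : ℕ} {e : Expr} {s : State} {n : ℕ} (hn : s.reg 2 = n) (hxy : x ≠ y)
    (hy : y ≠ 2) {p : Fin n → Prop}
    (h : ∀ j, ∀ i : Fin n, e.eval ((s.setReg y j).setReg x i) ≠ 0 ↔ p i) :
    (∃ i : Fin n, p i ∧ (find x y e).eval s = i) ∨
      (∀ i, ¬ p i) ∧ (find x y e).eval s = n := by
  classical
  have h1 : (find x y e).eval s = (Finset.univ.filter fun j : Fin n => ∀ i ≤ j, ¬ p i).card := by
    refine eval_sum_ind hn fun j => ?_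
    have h2 : (any x (.cond (.lt (.reg y) (.reg x)) (.lit 0) e)).eval (s.setReg y j) ≠ 0 ↔
        ∃ i : Fin n, i ≤ j ∧ p i := by
      rw [eval_any_ne (n := n) (by simp [hy.symm, hn])]
      refine exists_congr fun i => ?_
      simp only [eval]
      rw [← h j i]
      have : (((s.setReg y j).setReg x i).reg y < ((s.setReg y j).setReg x i).reg x) ↔ ¬ i ≤ j := by
        simp [hxy.symm]
      simp only [this]
      split_ifs with hij <;> simp_all
    rw [eval]
    by_cases hc : ∃ i : Fin n, i ≤ j ∧ p i
    · rw [if_neg (h2.2 hc), if_neg]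
      · rfl
      · obtain ⟨i, hi, hp⟩ := hc
        exact fun hall => hall i hi hp
    · rw [if_pos (by by_contra hne; exact hc (h2.1 hne)), if_pos]
      · rfl
      · intro i hi hp
        exact hc ⟨i, hi, hp⟩
  by_cases hex : ∃ i, p i
  · left
    obtain ⟨i, hi, hmin⟩ : ∃ i, p i ∧ ∀ j, j < i → ¬ p j := by
      obtain ⟨i, hi⟩ := hex
      have hne : (Finset.univ.filter p).Nonempty := ⟨i, by simpa using hi⟩
      refine ⟨(Finset.univ.filter p).min' hne, ?_, ?_⟩
      · simpa using Finset.min'_mem _ hne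
      · intro j hj hp
        exact absurd (Finset.min'_le (Finset.univ.filter p) j (by simpa using hp)) (not_le.2 hj)
    refine ⟨i, hi, ?_⟩
    rw [h1]
    have : (Finset.univ.filter fun j : Fin n => ∀ i ≤ j, ¬ p i) = Finset.Iio i := by
      ext j
      simp only [Finset.mem_filter, Finset.mem_univ, true_and, Finset.mem_Iio]
      refine ⟨fun hj => not_le.1 fun hij => hj i hij hi, fun hj k hk => hmin k (hk.trans_lt hj)⟩
    rw [this, Fin.card_Iio]
  · right
    push Not at hex
    refine ⟨hex, ?_⟩
    rw [h1]
    simp [hex]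

/-- In the absence of multiplication the row offset is a sum of copies of `n`. The caps in `add` and
`sum` are harmless because columns are below `n` and the summands are at most `n`. -/
theorem eval_arc_ne {n : ℕ} {D : Digraph (Fin n)} {s : State} (hn : s.reg 2 = n)
    (hD : s.arr 0 = adjArray D) {u w : ℕ} (hu : u ≠ 29) (i j : Fin n)
    (hi : s.reg u = i) (hj : s.reg w = j) : (arc u w).eval s ≠ 0 ↔ D.Adj i j := by
  have h1 : (sum 29 (.cond (.lt (.reg 29) (.reg u)) (.reg 2) (.lit 0))).eval s = i * n := by
    rw [eval, hn]
    have : ∀ k ∈ Finset.range n, min ((cond (.lt (.reg 29) (.reg u)) (.reg 2) (.lit 0)).eval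
        (s.setReg 29 k)) n = if k < i then n else 0 := by
      intro k hk
      simp only [eval, State.setReg_reg, hu, hi, hn, if_true, if_false]
      by_cases h : k < (i : ℕ) <;> simp [h]
    rw [Finset.sum_congr rfl this, ← Finset.sum_filter]
    have : (Finset.range n).filter (· < (i : ℕ)) = Finset.range i := by
      ext k; simp; omega
    rw [this]; simp
  rw [arc, eval_eq_ne]
  change s.arr 0 ((sum 29 _).eval s + min (s.reg w) (s.reg 2)) = 1 ↔ _
  rw [h1]
  rw [hn, hj, hD, min_eq_left j.2.le, adjArray_apply]
  split_ifs with h <;> simp [h]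

end Expr

end RAM

namespace RAM

open MaxLeaf

/-! ### The program -/

/-- The truth value of an expression. -/
def Expr.bool (e : Expr) : Expr := .cond e (.lit 1) (.lit 0)

/-- Whether vertex `u` is internal. -/
def internalE (u : ℕ) : Expr := .eq (.get 4 (.reg u)) (.lit 1)

/-- Whether vertex `w` is in the tree. -/
def domE (w : ℕ) : Expr := .or (.eq (.reg w) (.reg 10)) (.any 21 (.and (internalE 21) (.arc 21 w)))

/-- Load the first state of the queue and choose an undecided vertex. -/
def loadCmd : Cmd :=
  .seq (.fill 4 20 (.lit 0) (.get 2 (.add (.reg 3) (.reg 20)))) <|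
  .seq (.assign 10 (.get 3 (.reg 3))) <|
  .seq (.fill 5 20 (.lit 0) (.bool (domE 20))) <|
  .assign 5 (.find 20 21 (.and (.eq (.get 4 (.reg 20)) (.lit 0)) (.get 5 (.reg 20))))

/-- Register 5 holds `v`, registers 6 and 9 the numbers of fresh vertices and rivals, registers 7
and 8 hold `x` and `y`. Array 4 holds the statuses, array 5 the covered vertices, arrays 9 and 10
the fresh vertices and the rivals. -/
def freshE : Expr := .and (.arc 5 20) (.not (.get 5 (.reg 20)))

def rivalE : Expr :=
  .and (.eq (.get 4 (.reg 20)) (.lit 0)) <| .and (.not (.eq (.reg 20) (.reg 5))) <|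
    .and (.not (.get 9 (.reg 20))) <| .any 21 (.and (.get 9 (.reg 21)) (.arc 20 21))

/-- Compute the data which determine the branches. -/
def analyseCmd : Cmd :=
  .seq (.fill 9 20 (.lit 0) (.bool freshE)) <|
  .seq (.assign 6 (.sum 20 (.get 9 (.reg 20)))) <|
  .seq (.assign 7 (.find 20 21 (.get 9 (.reg 20)))) <|
  .seq (.assign 8 (.find 20 21 (.and (.not (.eq (.reg 20) (.reg 7))) (.get 9 (.reg 20))))) <|
  .seq (.fill 10 20 (.lit 0) (.bool rivalE)) <|
  .assign 9 (.sum 20 (.get 10 (.reg 20)))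

/-- Append a state to the queue. -/
def pushCmd (c e : Expr) : Cmd :=
  .ite c (.seq (.fill 2 20 (.reg 4) e) <| .seq (.store 3 (.reg 4) (.reg 10)) <|
    .assign 4 (.add (.reg 4) (.reg 2))) .skip

def pairE : Expr := .and (.eq (.reg 6) (.lit 2)) (.not (.eq (.reg 9) (.lit 0)))

def branchCmd : Cmd :=
  .seq (pushCmd (.not (.and (.eq (.reg 6) (.lit 2)) (.eq (.reg 9) (.lit 0))))
    (.cond (.eq (.reg 20) (.reg 5)) (.lit 2) (.get 4 (.reg 20)))) <|
  .seq (pushCmd (.and (.or (.eq (.reg 6) (.lit 1)) pairE) (.eq (.get 4 (.reg 7)) (.lit 0)))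
    (.cond (.or (.eq (.reg 20) (.reg 5)) (.eq (.reg 20) (.reg 7))) (.lit 1)
      (.get 4 (.reg 20)))) <|
  .seq (pushCmd (.and pairE (.eq (.get 4 (.reg 8)) (.lit 0)))
    (.cond (.or (.eq (.reg 20) (.reg 5)) (.eq (.reg 20) (.reg 8))) (.lit 1)
      (.cond (.eq (.reg 20) (.reg 7)) (.lit 2) (.get 4 (.reg 20))))) <|
  pushCmd (.lt (.lit 1) (.reg 6))
    (.cond (.eq (.reg 20) (.reg 5)) (.lit 1)
      (.cond (.and pairE (.or (.get 9 (.reg 20)) (.get 10 (.reg 20)))) (.lit 2)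
        (.get 4 (.reg 20))))

/-- A covered vertex may only be attached to a decided internal vertex, which protects the leaf
bound; an uncovered one may be attached to any vertex of the tree. -/
def parentE : Expr :=
  .find 21 22 (.and (.get 6 (.reg 21)) (.and (.arc 21 20)
    (.or (internalE 21) (.not (.get 5 (.reg 20))))))

/-- One round of growing a tree. -/
def growCmd : Cmd :=
  .seq (.fill 7 20 (.lit 0) (.cond (.get 6 (.reg 20)) (.get 6 (.reg 20))
    (.cond (.lt parentE (.reg 2)) (.add (.lit 2) parentE) (.lit 0)))) <|
  .fill 6 20 (.lit 0) (.get 7 (.reg 20))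

def leafE : Expr := .not (.any 22 (.eq (.get 6 (.reg 22)) (.add (.lit 2) (.reg 20))))

/-- Grow a tree with the internal vertices that have been decided, and record it if it is spanning
and has more leaves than the best one so far. -/
def recordCmd : Cmd :=
  .seq (.fill 6 20 (.lit 0) (.bool (.eq (.reg 20) (.reg 10)))) <|
  .seq (.rep growCmd) <|
  .seq (.assign 13 (.sum 20 (.bool leafE))) <|
  .ite (.and (.not (.any 20 (.not (.get 6 (.reg 20)))))
      (.or (.eq (.reg 0) (.lit 0)) (.lt (.reg 1) (.reg 13))))
    (.seq (.assign 0 (.lit 1)) <| .seq (.assign 1 (.reg 13)) <|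
      .fill 8 20 (.lit 0) (.get 6 (.reg 20))) .skip

/-- Process the first state of the queue. -/
def bodyCmd : Cmd :=
  .seq loadCmd <|
  .seq (.ite (.lt (.reg 5) (.reg 2)) (.seq analyseCmd branchCmd) recordCmd) <|
  .assign 3 (.add (.reg 3) (.reg 2))

/-- Initialize the queue with one state for every root. -/
def initCmd : Cmd :=
  .seq (.assign 0 (.lit 0)) <|
  .rep <| .seq (.fill 2 20 (.reg 4) (.lit 0)) <| .seq (.store 3 (.reg 4) (.reg 11)) <|
    .seq (.assign 4 (.add (.reg 4) (.reg 2))) <| .assign 11 (.add (.reg 11) (.lit 1))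

/-- Write the adjacency matrix of the best tree. -/
def outputCmd : Cmd :=
  .seq (.assign 11 (.lit 0)) <| .seq (.assign 12 (.lit 0)) <|
  .rep <| .seq (.fill 1 20 (.reg 12) (.bool (.eq (.get 8 (.reg 20)) (.add (.lit 2) (.reg 11))))) <|
    .seq (.assign 11 (.add (.reg 11) (.lit 1))) <| .assign 12 (.add (.reg 12) (.reg 2))

/-- The algorithm. -/
def maxLeafProg : Prog :=
  .seq (.copy 2 0) <| .seq (initCmd.compile 30) <|
    .seq (.loop (.lt 3 4) (bodyCmd.compile 30)) (outputCmd.compile 30)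

/-- Registers below 30 belong to the commands, those from 30 on to the compiled code. -/
theorem initCmd_ok : initCmd.ok 30 := by decide
theorem bodyCmd_ok : bodyCmd.ok 30 := by decide
theorem outputCmd_ok : outputCmd.ok 30 := by decide

/-! ### Effects of the commands -/

theorem Expr.eval_bool {e : Expr} {s : State} {p : Prop} [Decidable p] (h : e.eval s ≠ 0 ↔ p) :
    e.bool.eval s = if p then 1 else 0 := by
  rw [Expr.bool, Expr.eval]
  by_cases hp : p
  · rw [if_neg (h.2 hp), if_pos hp, Expr.eval]
  · rw [if_pos (not_not.1 fun hne => hp (h.1 hne)), if_neg hp, Expr.eval]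

theorem Cmd.eval_fill_arr {n a x : ℕ} {e : Expr} {s : State} (hn : s.reg 2 = n) (i : Fin n) :
    ((Cmd.fill a x (.lit 0) e).eval s).arr a i = e.eval (s.setReg x i) := by
  simp [Cmd.eval, Expr.eval, hn]

/-- The invariable part of the memory. -/
def Base {n : ℕ} (D : Digraph (Fin n)) (s : State) : Prop := s.reg 2 = n ∧ s.arr 0 = adjArray D

section

variable {n : ℕ} {D : Digraph (Fin n)} {s : State}

theorem Base.eval (h : Base D s) {c : Cmd} (h2 : c.keepsReg 2) (h0 : c.keepsArr 0) :
    Base D (c.eval s) :=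
  ⟨by rw [Cmd.eval_reg h2, h.1], by rw [Cmd.eval_arr h0, h.2]⟩

/-- The first state of the queue has been loaded. -/
structure Loaded (D : Digraph (Fin n)) (r : Fin n) (st : Fin n → ℕ) (s : State) : Prop where
  base : Base D s
  status : ∀ i : Fin n, s.arr 4 i = st i
  root : s.reg 10 = r
  inDom : ∀ i : Fin n, s.arr 5 i = if i ∈ dom D r (ones st) then 1 else 0

/-- The value `n` in register 5 signals that the tree is completely decided. -/
theorem eval_loadCmd (hs : Base D s) {r : Fin n} {st : Fin n → ℕ} (hr : s.arr 3 (s.reg 3) = r)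
    (hst : ∀ i : Fin n, s.arr 2 (s.reg 3 + i) = st i) :
    Loaded D r st (loadCmd.eval s) ∧
      ((∃ v : Fin n, (st v = 0 ∧ v ∈ dom D r (ones st)) ∧ (loadCmd.eval s).reg 5 = v) ∨
      (∀ v : Fin n, ¬ (st v = 0 ∧ v ∈ dom D r (ones st))) ∧ (loadCmd.eval s).reg 5 = n) := by
  simp only [loadCmd, Cmd.eval.eq_5]
  generalize h1 : Cmd.eval (.fill 4 _ _ _) s = s1
  have b1 : Base D s1 := h1 ▸ hs.eval rfl rfl
  have c1 : ∀ i : Fin n, s1.arr 4 i = st i := fun i => by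
    rw [← h1, Cmd.eval_fill_arr hs.1]
    simp [Expr.eval, hs.1, hst]
  have r1 : s1.arr 3 (s1.reg 3) = r := by
    rw [← h1, Cmd.eval_arr rfl, Cmd.eval_reg rfl, hr]
  generalize h2 : Cmd.eval (.assign 10 _) s1 = s2
  have b2 : Base D s2 := h2 ▸ b1.eval rfl rfl
  have c2 : ∀ i : Fin n, s2.arr 4 i = st i := fun i => by
    rw [← h2, Cmd.eval_arr rfl, c1]
  have r2 : s2.reg 10 = r := by rw [← h2]; simpa [Cmd.eval, Expr.eval] using r1
  generalize h3 : Cmd.eval (.fill 5 _ _ _) s2 = s3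
  have b3 : Base D s3 := h3 ▸ b2.eval rfl rfl
  have c3 : ∀ i : Fin n, s3.arr 4 i = st i := fun i => by
    rw [← h3, Cmd.eval_arr rfl, c2]
  have r3 : s3.reg 10 = r := by rw [← h3, Cmd.eval_reg rfl, r2]
  have d3 : ∀ i : Fin n, s3.arr 5 i = if i ∈ dom D r (ones st) then 1 else 0 := fun i => by
    rw [← h3, Cmd.eval_fill_arr b2.1]
    refine Expr.eval_bool ?_
    rw [domE, Expr.eval_or_ne, Expr.eval_eq_ne,
      Expr.eval_any_ne (n := n) (by simp [b2.1]), mem_dom_iff]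
    refine or_congr ?_ (exists_congr fun u => ?_)
    · simp [Expr.eval, r2, Fin.ext_iff]
    · rw [Expr.eval_and_ne, Expr.eval_arc_ne (D := D) (by simp [b2.1]) (by simpa using b2.2)
        (by simp) u i (by simp) (by simp), mem_ones]
      simp [internalE, Expr.eval, c2]
  generalize h4 : Cmd.eval (.assign 5 _) s3 = s4
  refine ⟨⟨h4 ▸ b3.eval rfl rfl, ?_, ?_, ?_⟩, ?_⟩
  · intro i; rw [← h4, Cmd.eval_arr rfl, c3]
  · rw [← h4, Cmd.eval_reg rfl, r3]
  · intro i; rw [← h4, Cmd.eval_arr rfl, d3]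
  · have := Expr.eval_find (s := s3) (x := 20) (y := 21)
      (e := .and (.eq (.get 4 (.reg 20)) (.lit 0)) (.get 5 (.reg 20)))
      (p := fun v : Fin n => st v = 0 ∧ v ∈ dom D r (ones st)) b3.1 (by simp) (by simp) ?_
    · rw [← h4]
      simpa only [Cmd.eval, State.setReg_reg, if_true] using this
    · intro j i
      rw [Expr.eval_and_ne]
      simp [Expr.eval, c3, d3]

/-- The data which determine the branches have been computed. -/
structure Analysed (D : Digraph (Fin n)) (r : Fin n) (st : Fin n → ℕ) (v x y : Fin n)
    (s : State) : Prop where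
  base : Base D s
  status : ∀ i : Fin n, s.arr 4 i = st i
  root : s.reg 10 = r
  vertex : s.reg 5 = v
  card : s.reg 6 = (fresh D r st v).card
  first : 1 ≤ (fresh D r st v).card → s.reg 7 = x
  second : 2 ≤ (fresh D r st v).card → s.reg 8 = y
  cardRivals : s.reg 9 = (rivals D r st v).card
  inFresh : ∀ i : Fin n, s.arr 9 i = if i ∈ fresh D r st v then 1 else 0
  inRivals : ∀ i : Fin n, s.arr 10 i = if i ∈ rivals D r st v then 1 else 0

theorem eval_analyseCmd {r : Fin n} {st : Fin n → ℕ} (hs : Loaded D r st s) {v : Fin n}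
    (hv : s.reg 5 = v) :
    ∃ x y, (1 ≤ (fresh D r st v).card → x ∈ fresh D r st v) ∧
      (2 ≤ (fresh D r st v).card → y ∈ fresh D r st v ∧ y ≠ x) ∧
      Analysed D r st v x y (analyseCmd.eval s) := by
  obtain ⟨b0, c0, r0, d0⟩ := hs
  simp only [analyseCmd, Cmd.eval.eq_5]
  generalize h1 : Cmd.eval (.fill 9 _ _ _) s = s1
  have b1 : Base D s1 := h1 ▸ b0.eval rfl rfl
  have f1 : ∀ i : Fin n, s1.arr 9 i = if i ∈ fresh D r st v then 1 else 0 := fun i => by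
    rw [← h1, Cmd.eval_fill_arr b0.1]
    refine Expr.eval_bool ?_
    rw [freshE, Expr.eval_and_ne, Expr.eval_not_ne, Expr.eval_arc_ne (D := D) (by simp [b0.1])
      (by simpa using b0.2) (by simp) v i (by simp [hv]) (by simp), mem_fresh]
    simp [Expr.eval, d0]
  have k1 : (∀ i : Fin n, s1.arr 4 i = st i) ∧ s1.reg 10 = r ∧ s1.reg 5 = v := by
    rw [← h1, Cmd.eval_arr rfl, Cmd.eval_reg rfl, Cmd.eval_reg rfl]
    exact ⟨c0, r0, hv⟩
  clear h1
  generalize h2 : Cmd.eval (.assign 6 _) s1 = s2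
  have b2 : Base D s2 := h2 ▸ b1.eval rfl rfl
  have f2 : ∀ i : Fin n, s2.arr 9 i = if i ∈ fresh D r st v then 1 else 0 := fun i => by
    rw [← h2, Cmd.eval_arr rfl, f1]
  have k2 : (∀ i : Fin n, s2.arr 4 i = st i) ∧ s2.reg 10 = r ∧ s2.reg 5 = v := by
    rw [← h2, Cmd.eval_arr rfl, Cmd.eval_reg rfl, Cmd.eval_reg rfl]
    exact k1
  have e2 : s2.reg 6 = (fresh D r st v).card := by
    rw [← h2, Cmd.eval, State.setReg_reg, if_pos rfl,
      Expr.eval_sum_ind (p := fun i => i ∈ fresh D r st v) b1.1 (fun i => by simp [Expr.eval, f1])]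
    simp
  clear h2
  generalize h3 : Cmd.eval (.assign 7 _) s2 = s3
  have b3 : Base D s3 := h3 ▸ b2.eval rfl rfl
  have f3 : ∀ i : Fin n, s3.arr 9 i = if i ∈ fresh D r st v then 1 else 0 := fun i => by
    rw [← h3, Cmd.eval_arr rfl, f2]
  have k3 : (∀ i : Fin n, s3.arr 4 i = st i) ∧ s3.reg 10 = r ∧ s3.reg 5 = v ∧
      s3.reg 6 = (fresh D r st v).card := by
    rw [← h3, Cmd.eval_arr rfl, Cmd.eval_reg rfl, Cmd.eval_reg rfl, Cmd.eval_reg rfl]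
    exact ⟨k2.1, k2.2.1, k2.2.2, e2⟩
  have hx : ∃ x, 1 ≤ (fresh D r st v).card → x ∈ fresh D r st v ∧ s3.reg 7 = x := by
    have := Expr.eval_find (s := s2) (x := 20) (y := 21) (e := .get 9 (.reg 20))
      (p := fun i : Fin n => i ∈ fresh D r st v) b2.1 (by simp) (by simp)
      (fun j i => by simp [Expr.eval, f2])
    rw [← h3]
    simp only [Cmd.eval, State.setReg_reg, if_true]
    rcases this with ⟨i, hi, he⟩ | ⟨hi, he⟩
    · exact ⟨i, fun _ => ⟨hi, he⟩⟩
    -- Without fresh vertices `x` is irrelevant, and `v` serves as a default.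
    · refine ⟨v, fun h => ?_⟩
      obtain ⟨i, h⟩ := Finset.card_pos.1 h
      exact absurd h (hi i)
  clear h3
  obtain ⟨x, hx⟩ := hx
  generalize h4 : Cmd.eval (.assign 8 _) s3 = s4
  have b4 : Base D s4 := h4 ▸ b3.eval rfl rfl
  have f4 : ∀ i : Fin n, s4.arr 9 i = if i ∈ fresh D r st v then 1 else 0 := fun i => by
    rw [← h4, Cmd.eval_arr rfl, f3]
  have k4 : (∀ i : Fin n, s4.arr 4 i = st i) ∧ s4.reg 10 = r ∧ s4.reg 5 = v ∧
      s4.reg 6 = (fresh D r st v).card ∧ (1 ≤ (fresh D r st v).card → s4.reg 7 = x) := by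
    rw [← h4, Cmd.eval_arr rfl, Cmd.eval_reg rfl, Cmd.eval_reg rfl, Cmd.eval_reg rfl,
      Cmd.eval_reg rfl]
    exact ⟨k3.1, k3.2.1, k3.2.2.1, k3.2.2.2, fun h => (hx h).2⟩
  have hy : ∃ y, 2 ≤ (fresh D r st v).card →
      (y ∈ fresh D r st v ∧ y ≠ x) ∧ s4.reg 8 = y := by
    by_cases h2 : 2 ≤ (fresh D r st v).card
    swap
    · exact ⟨v, fun h => absurd h h2⟩
    have := Expr.eval_find (s := s3) (x := 20) (y := 21)
      (e := .and (.not (.eq (.reg 20) (.reg 7))) (.get 9 (.reg 20)))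
      (p := fun i : Fin n => i ≠ x ∧ i ∈ fresh D r st v) b3.1 (by simp) (by simp)
      (fun j i => by
        rw [Expr.eval_and_ne, Expr.eval_not_ne]
        simp [Expr.eval, f3, (hx (by omega)).2, Fin.ext_iff])
    rw [← h4]
    simp only [Cmd.eval, State.setReg_reg, if_true]
    rcases this with ⟨i, hi, he⟩ | ⟨hi, he⟩
    · exact ⟨i, fun _ => ⟨hi.symm, he⟩⟩
    · obtain ⟨i, hi1, hi2⟩ := Finset.exists_mem_ne (by omega : 1 < (fresh D r st v).card) x
      exact absurd ⟨hi2, hi1⟩ (hi i)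
  clear h4
  obtain ⟨y, hy⟩ := hy
  generalize h5 : Cmd.eval (.fill 10 _ _ _) s4 = s5
  have b5 : Base D s5 := h5 ▸ b4.eval rfl rfl
  have f5 : ∀ i : Fin n, s5.arr 9 i = if i ∈ fresh D r st v then 1 else 0 := fun i => by
    rw [← h5, Cmd.eval_arr rfl, f4]
  have g5 : ∀ i : Fin n, s5.arr 10 i = if i ∈ rivals D r st v then 1 else 0 := fun i => by
    rw [← h5, Cmd.eval_fill_arr b4.1]
    refine Expr.eval_bool ?_
    rw [rivalE, Expr.eval_and_ne, Expr.eval_and_ne, Expr.eval_and_ne, Expr.eval_not_ne,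
      Expr.eval_not_ne, Expr.eval_any_ne (n := n) (by simp [b4.1]), mem_rivals]
    refine and_congr (by simp [Expr.eval, k4.1]) (and_congr (by simp [Expr.eval, k4.2.2.1,
      Fin.ext_iff]) (and_congr (by simp [Expr.eval, f4]) (exists_congr fun u => ?_)))
    rw [Expr.eval_and_ne, Expr.eval_arc_ne (D := D) (by simp [b4.1]) (by simpa using b4.2)
        (by simp) i u (by simp) (by simp)]
    simp [Expr.eval, f4]
  have k5 : (∀ i : Fin n, s5.arr 4 i = st i) ∧ s5.reg 10 = r ∧ s5.reg 5 = v ∧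
      s5.reg 6 = (fresh D r st v).card ∧ (1 ≤ (fresh D r st v).card → s5.reg 7 = x) ∧
      (2 ≤ (fresh D r st v).card → s5.reg 8 = y) := by
    rw [← h5, Cmd.eval_arr rfl, Cmd.eval_reg rfl, Cmd.eval_reg rfl, Cmd.eval_reg rfl,
      Cmd.eval_reg rfl, Cmd.eval_reg rfl]
    exact ⟨k4.1, k4.2.1, k4.2.2.1, k4.2.2.2.1, k4.2.2.2.2, fun h => (hy h).2⟩
  clear h5
  refine ⟨x, y, fun h => (hx h).1, fun h => (hy h).1, ?_⟩
  generalize h6 : Cmd.eval (.assign 9 _) s5 = s6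
  refine ⟨h6 ▸ b5.eval rfl rfl, ?_, ?_, ?_, ?_, ?_, ?_, ?_, ?_, ?_⟩
  · rw [← h6, Cmd.eval_arr rfl]; exact k5.1
  · rw [← h6, Cmd.eval_reg rfl]; exact k5.2.1
  · rw [← h6, Cmd.eval_reg rfl]; exact k5.2.2.1
  · rw [← h6, Cmd.eval_reg rfl]; exact k5.2.2.2.1
  · rw [← h6, Cmd.eval_reg rfl]; exact k5.2.2.2.2.1
  · rw [← h6, Cmd.eval_reg rfl]; exact k5.2.2.2.2.2
  · rw [← h6, Cmd.eval, State.setReg_reg, if_pos rfl,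
      Expr.eval_sum_ind (p := fun i => i ∈ rivals D r st v) b5.1 (fun i => by simp [Expr.eval, g5])]
    simp
  · rw [← h6, Cmd.eval_arr rfl]; exact f5
  · rw [← h6, Cmd.eval_arr rfl]; exact g5

end

end RAM

namespace RAM

open MaxLeaf

/-! ### The queue -/

/-- The states between the indices `h` and `t` of the queue: statuses are stored in `Q`, in blocks
of length `n`, and roots in `R`, at the beginning of each block. -/
def IsQueue {n : ℕ} (Q R : ℕ → ℕ) : ℕ → List (Fin n × (Fin n → ℕ)) → ℕ → Prop
  | h, [], t => h = t
  | h, (r, f) :: L, t => R h = r ∧ (∀ i : Fin n, Q (h + i) = f i) ∧ IsQueue Q R (h + n) L t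

theorem IsQueue.le {n : ℕ} {Q R : ℕ → ℕ} {h t : ℕ} {L : List (Fin n × (Fin n → ℕ))}
    (H : IsQueue Q R h L t) : h ≤ t := by
  induction L generalizing h with
  | nil => exact le_of_eq H
  | cons a L ih => have := ih H.2.2; omega

theorem IsQueue.append {n : ℕ} {Q R Q' R' : ℕ → ℕ} {h t : ℕ} {L : List (Fin n × (Fin n → ℕ))}
    (H : IsQueue Q R h L t) {r : Fin n} {f : Fin n → ℕ} (hQ : ∀ m < t, Q' m = Q m)
    (hR : ∀ m < t, R' m = R m) (hr : R' t = r) (hf : ∀ i : Fin n, Q' (t + i) = f i) :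
    IsQueue Q' R' h (L ++ [(r, f)]) (t + n) := by
  induction L generalizing h with
  | nil =>
    obtain rfl : h = t := H
    exact ⟨hr, hf, rfl⟩
  | cons a L ih =>
    obtain ⟨h1, h2, h3⟩ := H
    have h4 := h3.le
    have hn := a.1.pos
    exact ⟨by rw [hR h (by omega), h1], fun i => by rw [hQ _ (by omega), h2], ih h3⟩

/-- The queue of a memory state. -/
def Queue {n : ℕ} (s : State) (L : List (Fin n × (Fin n → ℕ))) : Prop :=
  IsQueue (s.arr 2) (s.arr 3) (s.reg 3) L (s.reg 4)

section

variable {n : ℕ} {D : Digraph (Fin n)} {s : State}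

theorem Expr.eval_cond {c e f : Expr} {p : Prop} [Decidable p] (h : c.eval s ≠ 0 ↔ p) :
    (Expr.cond c e f).eval s = if p then e.eval s else f.eval s := by
  rw [Expr.eval]
  by_cases hp : p
  · rw [if_neg (h.2 hp), if_pos hp]
  · rw [if_pos (not_not.1 fun hne => hp (h.1 hne)), if_neg hp]

theorem eval_push {r : Fin n} {f : Fin n → ℕ} {L : List (Fin n × (Fin n → ℕ))} (hn : s.reg 2 = n)
    {x : ℕ} (hr : s.reg x = r) {e : Expr}
    (he : ∀ i : Fin n, e.eval (s.setReg 20 i) = f i) (hQ : Queue s L) :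
    Queue ((Cmd.seq (.fill 2 20 (.reg 4) e) <| .seq (.store 3 (.reg 4) (.reg x)) <|
      .assign 4 (.add (.reg 4) (.reg 2))).eval s) (L ++ [(r, f)]) := by
  have : s.reg 4 + min n n = s.reg 4 + n := by simp
  simp only [Queue, Cmd.eval, Expr.eval, State.setReg_reg, State.setArr_reg, State.setBlock_reg,
    State.setReg_arr, hn, if_true, if_false, Nat.reduceEqDiff, this]
  refine IsQueue.append hQ ?_ ?_ ?_ ?_
  · intro m hm
    simp [hn]; omega
  · intro m hm
    simp; omega
  · simp [hr]
  · intro i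
    have := i.2
    simp [hn, he]

theorem Analysed.eval_pushCmd {r v x y : Fin n} {st : Fin n → ℕ}
    (hs : Analysed D r st v x y s) {L : List (Fin n × (Fin n → ℕ))} (hQ : Queue s L) {c e : Expr}
    {p : Prop} [Decidable p] (hc : c.eval s ≠ 0 ↔ p) {f : Fin n → ℕ}
    (he : p → ∀ i : Fin n, e.eval (s.setReg 20 i) = f i) :
    Analysed D r st v x y ((pushCmd c e).eval s) ∧
      Queue ((pushCmd c e).eval s) (L ++ if p then [(r, f)] else []) := by
  refine ⟨?_, ?_⟩
  · obtain ⟨h1, h2, h3, h4, h5, h6, h7, h8, h9, h10⟩ := hs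
    refine ⟨h1.eval rfl rfl, ?_, ?_, ?_, ?_, ?_, ?_, ?_, ?_, ?_⟩ <;>
      first | rwa [Cmd.eval_arr rfl] | rwa [Cmd.eval_reg rfl]
  · rw [pushCmd, Cmd.eval]
    by_cases hp : p
    · rw [if_neg (hc.2 hp), if_pos hp]
      exact eval_push hs.base.1 hs.root (he hp) hQ
    · rw [if_pos (not_not.1 fun hne => hp (hc.1 hne)), if_neg hp, Cmd.eval, List.append_nil]
      exact hQ

theorem Analysed.eval_pairE_ne {r v x y : Fin n} {st : Fin n → ℕ}
    (hs : Analysed D r st v x y s) {s' : State} (h6 : s'.reg 6 = s.reg 6)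
    (h9 : s'.reg 9 = s.reg 9) :
    pairE.eval s' ≠ 0 ↔ (fresh D r st v).card = 2 ∧ rivals D r st v ≠ ∅ := by
  rw [pairE, Expr.eval_and_ne, Expr.eval_eq_ne, Expr.eval_not_ne]
  simp [Expr.eval, h6, h9, hs.card, hs.cardRivals]

theorem Analysed.eval_branchCmd {r v x y : Fin n} {st : Fin n → ℕ}
    (hs : Analysed D r st v x y s) {L : List (Fin n × (Fin n → ℕ))} (hQ : Queue s L) :
    Queue (branchCmd.eval s) (L ++ (branches D r st v x y).map fun f => (r, f)) := by
  classical
  simp only [branchCmd, Cmd.eval.eq_5]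
  obtain ⟨k1, q1⟩ := hs.eval_pushCmd hQ
    (c := .not (.and (.eq (.reg 6) (.lit 2)) (.eq (.reg 9) (.lit 0))))
    (e := .cond (.eq (.reg 20) (.reg 5)) (.lit 2) (.get 4 (.reg 20)))
    (p := ¬ ((fresh D r st v).card = 2 ∧ rivals D r st v = ∅)) (f := optLeaf st v) (by
      rw [Expr.eval_not_ne, ← not_iff_not, not_not, ← ne_eq, Expr.eval_and_ne, Expr.eval_eq_ne,
        Expr.eval_eq_ne]
      simp [Expr.eval, hs.card, hs.cardRivals])
    (fun _ i => by
      by_cases hi : i = v <;>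
        simp [Expr.eval, hs.vertex, hs.status, optLeaf, Fin.val_inj, hi])
  generalize Cmd.eval (pushCmd _ _) s = s1 at k1 q1 ⊢
  obtain ⟨k2, q2⟩ := k1.eval_pushCmd q1
    (c := .and (.or (.eq (.reg 6) (.lit 1)) pairE) (.eq (.get 4 (.reg 7)) (.lit 0)))
    (e := .cond (.or (.eq (.reg 20) (.reg 5)) (.eq (.reg 20) (.reg 7))) (.lit 1)
      (.get 4 (.reg 20)))
    (p := ((fresh D r st v).card = 1 ∨ (fresh D r st v).card = 2 ∧ rivals D r st v ≠ ∅) ∧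
      st x = 0) (f := optPath st v x) (by
      rw [Expr.eval_and_ne, Expr.eval_or_ne, Expr.eval_eq_ne, Expr.eval_eq_ne,
        k1.eval_pairE_ne rfl rfl]
      simp only [Expr.eval, k1.card]
      refine and_congr_right fun h => ?_
      rw [k1.first (by omega), k1.status])
    (fun hp i => by
      have h7 := k1.first (by omega)
      by_cases hi : i = v <;> by_cases hix : i = x <;>
        simp [Expr.eval, Expr.or, k1.vertex, k1.status, h7, optPath, Fin.val_inj, hi, hix])
  generalize Cmd.eval (pushCmd _ _) s1 = s2 at k2 q2 ⊢
  obtain ⟨k3, q3⟩ := k2.eval_pushCmd q2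
    (c := .and pairE (.eq (.get 4 (.reg 8)) (.lit 0)))
    (e := .cond (.or (.eq (.reg 20) (.reg 5)) (.eq (.reg 20) (.reg 8))) (.lit 1)
      (.cond (.eq (.reg 20) (.reg 7)) (.lit 2) (.get 4 (.reg 20))))
    (p := ((fresh D r st v).card = 2 ∧ rivals D r st v ≠ ∅) ∧ st y = 0)
    (f := optSecond st v x y) (by
      rw [Expr.eval_and_ne, Expr.eval_eq_ne, k2.eval_pairE_ne rfl rfl]
      simp only [Expr.eval]
      refine and_congr_right fun h => ?_
      rw [k2.second (by omega), k2.status])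
    (fun hp i => by
      have h7 := k2.first (by omega)
      have h8 := k2.second (by omega)
      rw [Expr.eval_cond (p := i = v ∨ i = y), Expr.eval_cond (p := i = x)]
      · simp only [Expr.eval, State.setReg_reg, State.setReg_arr, if_true, k2.status, optSecond]
        congr!
      · simp [Expr.eval, h7, Fin.val_inj]
      · rw [Expr.eval_or_ne]
        simp [Expr.eval, h8, k2.vertex, Fin.val_inj])
  generalize Cmd.eval (pushCmd _ _) s2 = s3 at k3 q3 ⊢
  obtain ⟨k4, q4⟩ := k3.eval_pushCmd q3
    (c := .lt (.lit 1) (.reg 6))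
    (e := .cond (.eq (.reg 20) (.reg 5)) (.lit 1)
      (.cond (.and pairE (.or (.get 9 (.reg 20)) (.get 10 (.reg 20)))) (.lit 2)
        (.get 4 (.reg 20))))
    (p := 2 ≤ (fresh D r st v).card)
    (f := optInternal st v (if (fresh D r st v).card = 2 ∧ rivals D r st v ≠ ∅ then
      fresh D r st v ∪ rivals D r st v else ∅)) (by
      rw [Expr.eval_lt_ne]
      simp only [Expr.eval, k3.card]
      exact Nat.succ_le_iff.symm)
    (fun hp i => by
      rw [Expr.eval_cond (p := i = v), Expr.eval_cond
        (p := ((fresh D r st v).card = 2 ∧ rivals D r st v ≠ ∅) ∧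
            (i ∈ fresh D r st v ∨ i ∈ rivals D r st v))]
      · rw [optInternal]
        by_cases hP : (fresh D r st v).card = 2 ∧ rivals D r st v ≠ ∅
        · rw [if_pos hP]
          simp only [Finset.mem_union]
          simp [Expr.eval, k3.status, hP.1, hP.2]
        · rw [if_neg hP]
          simp only [hP, false_and, if_false, Finset.notMem_empty]
          simp [Expr.eval, k3.status]
      · rw [Expr.eval_and_ne, Expr.eval_or_ne, k3.eval_pairE_ne (by simp) (by simp)]
        simp [Expr.eval, k3.inFresh, k3.inRivals]
      · simp [Expr.eval, k3.vertex, Fin.val_inj])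
  convert q4 using 1
  simp only [branches, List.map_append, List.append_assoc, ite_not,
    apply_ite (List.map fun f => (r, f)), List.map_cons, List.map_nil]
  congr!

end

end RAM

namespace MaxLeaf

/-! ### Growing a tree -/

section

variable {n : ℕ} (D : Digraph (Fin n)) (r : Fin n) (st : Fin n → ℕ)

/-- `u` may become the parent of `w`. Parent functions are encoded as follows: `0` if the vertex is
not yet in the tree, `1` for the root, and `2 + u` if the parent is `u`. -/
def Allowed (P : Fin n → ℕ) (u w : Fin n) : Prop :=
  P u ≠ 0 ∧ D.Adj u w ∧ (st u = 1 ∨ w ∉ dom D r (ones st))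

/-- `P` describes a tree with root `r`. -/
structure Grown (P : Fin n → ℕ) : Prop where
  root : P r = 1
  val : ∀ w, P w = 0 ∨ (w = r ∧ P w = 1) ∨ w ≠ r ∧ ∃ u : Fin n, P w = 2 + u ∧ D.Adj u w ∧
    (st u = 1 ∨ w ∉ dom D r (ones st))
  rank : ∃ rk : Fin n → ℕ, ∀ w u : Fin n, P w = 2 + u → P u ≠ 0 ∧ rk u < rk w

/-- One round of growing. -/
def Grow (P P' : Fin n → ℕ) : Prop :=
  ∀ w, (P w ≠ 0 ∧ P' w = P w) ∨ (P w = 0 ∧ ((∃ u, Allowed D r st P u w ∧ P' w = 2 + (u : ℕ)) ∨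
    (∀ u, ¬ Allowed D r st P u w) ∧ P' w = 0))

/-- The tree cannot grow any more. -/
def Full (P : Fin n → ℕ) : Prop := ∀ w u, P w = 0 → ¬ Allowed D r st P u w

variable {D r st} {P P' : Fin n → ℕ}

theorem Grown.grow (h : Grown D r st P) (hg : Grow D r st P P') : Grown D r st P' := by
  have mono : ∀ w, P w ≠ 0 → P' w = P w := fun w hw => by
    rcases hg w with h1 | h1
    · exact h1.2
    · exact absurd h1.1 hw
  refine ⟨by rw [mono r (by rw [h.root]; simp), h.root], fun w => ?_, ?_⟩
  · rcases hg w with ⟨-, h1⟩ | ⟨h0, ⟨u, hu, h1⟩ | ⟨-, h1⟩⟩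
    · rw [h1]; exact h.val w
    · refine .inr (.inr ⟨?_, u, h1, hu.2⟩)
      rintro rfl
      rw [h.root] at h0
      simp at h0
    · exact .inl h1
  · obtain ⟨rk, hrk⟩ := h.rank
    -- All vertices added in this round get the same rank, above all old ranks; their parents are
    -- old.
    refine ⟨fun w => if P w = 0 then Finset.univ.sup rk + 1 else rk w, fun w u hwu => ?_⟩
    rcases hg w with ⟨h0, h1⟩ | ⟨h0, ⟨u', hu', h1⟩ | ⟨-, h1⟩⟩
    · rw [h1] at hwu
      obtain ⟨h2, h3⟩ := hrk w u hwu
      exact ⟨by rw [mono u h2]; exact h2, by simpa [h2, h0] using h3⟩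
    · obtain rfl : u' = u := Fin.ext (by omega)
      refine ⟨by rw [mono u' hu'.1]; exact hu'.1, ?_⟩
      simp only [hu'.1, h0, if_true, if_false]
      exact Nat.lt_succ_of_le (Finset.le_sup (Finset.mem_univ u'))
    · omega

theorem Full.grow (h : Full D r st P) (hg : Grow D r st P P') : Full D r st P' := by
  have : P' = P := by
    funext w
    rcases hg w with h1 | ⟨h0, ⟨u, hu, h1⟩ | h1⟩
    · exact h1.2
    · exact absurd hu (h w u h0)
    · rw [h0, h1.2]
  rwa [this]

theorem card_grow (h : ¬ Full D r st P) (hg : Grow D r st P P') :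
    (Finset.univ.filter fun w => P w ≠ 0).card < (Finset.univ.filter fun w => P' w ≠ 0).card := by
  simp only [Full, not_forall, not_not] at h
  obtain ⟨w, u, hw, hu⟩ := h
  refine Finset.card_lt_card (Finset.ssubset_iff_of_subset ?_ |>.2 ⟨w, ?_, ?_⟩)
  · intro z hz
    simp only [Finset.mem_filter, Finset.mem_univ, true_and] at hz ⊢
    rcases hg z with h1 | h1
    · rw [h1.2]; exact hz
    · exact absurd h1.1 hz
  · simp only [Finset.mem_filter, Finset.mem_univ, true_and]
    rcases hg w with h1 | ⟨h0, ⟨u, hu, h1⟩ | h1⟩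
    · exact absurd hw h1.1
    · omega
    · exact absurd hu (h1.1 u)
  · simp [hw]

/-- A full tree is spanning. -/
theorem Full.ne_zero (hf : Full D r st P) (h : Grown D r st P) (hI : Good D r (ones st))
    {J : Finset (Fin n)} (hJ : ∀ w, Reach D r J w) (w : Fin n) : P w ≠ 0 := by
  have h1 : ∀ w, Reach D r (ones st) w → P w ≠ 0 := by
    intro w hw
    induction hw with
    | root => rw [h.root]; simp
    | step _ h2 h3 ih => exact fun h0 => hf _ _ h0 ⟨ih, h3, .inl (mem_ones.1 h2)⟩
  -- Covered vertices are handled by `h1`. For an uncovered vertex, any vertex already in the tree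
  -- is an admissible parent, so reachability through `J` suffices.
  have := hJ w
  induction this with
  | root => rw [h.root]; simp
  | @step u w _ h2 h3 ih =>
    by_cases hw : w ∈ dom D r (ones st)
    · exact h1 w (hI.reach hw)
    · exact fun h0 => hf _ _ h0 ⟨ih, h3, .inr hw⟩

/-- A spanning tree is an out-branching. -/
theorem Grown.exists_isOutBranching (h : Grown D r st P) (hP : ∀ w, P w ≠ 0) :
    ∃ T, IsOutBranching D T ∧ (∀ u w : Fin n, T.Adj u w ↔ P w = 2 + u) ∧
      ∀ k, k + (ones st).card ≤ (dom D r (ones st)).card → k ≤ leafCount T := by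
  have hval : ∀ w, w ≠ r → ∃ u : Fin n, P w = 2 + u ∧ D.Adj u w ∧
      (st u = 1 ∨ w ∉ dom D r (ones st)) := fun w hw => by
    rcases h.val w with h0 | h0 | h0
    · exact absurd h0 (hP w)
    · exact absurd h0.1 hw
    · exact h0.2
  choose par hpar using hval
  let par' : Fin n → Fin n := fun w => if hw : w ≠ r then par w hw else r
  have hpar' : ∀ w, w ≠ r → P w = 2 + par' w ∧ D.Adj (par' w) w ∧
      (st (par' w) = 1 ∨ w ∉ dom D r (ones st)) := fun w hw => by
    have := hpar w hw
    simpa only [par', dif_pos hw] using this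
  obtain ⟨rk, hrk⟩ := h.rank
  refine ⟨treeOf r par', isOutBranching_treeOf (rk := rk) (fun w hw => (hpar' w hw).2.1)
    (fun w hw => (hrk w _ (hpar' w hw).1).2), fun u w => ?_, fun k hk => ?_⟩
  · constructor
    · rintro ⟨hw, rfl⟩
      exact (hpar' w hw).1
    · intro hu
      have hw : w ≠ r := by
        rintro rfl
        rw [h.root] at hu
        omega
      have := (hpar' w hw).1
      exact ⟨hw, Fin.ext (by omega)⟩
  · refine le_leafCount_treeOf (J := ones st) (fun w hw hwr => ?_) hk
    rcases (hpar' w hwr).2.2 with h1 | h1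
    · exact mem_ones.2 h1
    · exact absurd hw h1

end

end MaxLeaf

/-! ### Growing and recording a tree on the machine -/

namespace RAM

open MaxLeaf

section

variable {n : ℕ} {D : Digraph (Fin n)} {s : State} {r : Fin n} {st : Fin n → ℕ}

theorem Loaded.eval (h : Loaded D r st s) {c : Cmd} (h2 : c.keepsReg 2) (h10 : c.keepsReg 10)
    (h0 : c.keepsArr 0) (h4 : c.keepsArr 4) (h5 : c.keepsArr 5) : Loaded D r st (c.eval s) := by
  refine ⟨h.base.eval h2 h0, ?_, ?_, ?_⟩
  · rw [Cmd.eval_arr h4]; exact h.status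
  · rw [Cmd.eval_reg h10]; exact h.root
  · rw [Cmd.eval_arr h5]; exact h.inDom

theorem Loaded.eval_growCmd (h : Loaded D r st s) :
    Loaded D r st (growCmd.eval s) ∧
      Grow D r st (fun i => s.arr 6 i) (fun i => (growCmd.eval s).arr 6 i) := by
  refine ⟨h.eval rfl rfl rfl rfl rfl, fun w => ?_⟩
  simp only [growCmd, Cmd.eval.eq_5]
  generalize h1 : Cmd.eval (.fill 7 _ _ _) s = s1
  have b1 : Base D s1 := h1 ▸ h.base.eval rfl rfl
  have e2 : (Cmd.eval (.fill 6 20 (.lit 0) (.get 7 (.reg 20))) s1).arr 6 w = s1.arr 7 w := by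
    rw [Cmd.eval_fill_arr b1.1]; simp [Expr.eval]
  rw [e2, ← h1, Cmd.eval_fill_arr h.base.1, Expr.eval_cond (p := s.arr 6 w ≠ 0) (by simp [Expr.eval])]
  by_cases hw : s.arr 6 w = 0
  swap
  · exact .inl ⟨hw, by simp [Expr.eval, hw]⟩
  refine .inr ⟨hw, ?_⟩
  rw [if_neg (not_not.2 hw)]
  have := Expr.eval_find (s := s.setReg 20 w) (n := n) (x := 21) (y := 22)
    (e := .and (.get 6 (.reg 21)) (.and (.arc 21 20)
      (.or (internalE 21) (.not (.get 5 (.reg 20))))))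
    (p := fun u => Allowed D r st (fun i => s.arr 6 i) u w)
    (by simp [h.base.1]) (by simp) (by simp) ?_
  · rcases this with ⟨u, hu, he⟩ | ⟨hu, he⟩
    · refine .inl ⟨u, hu, ?_⟩
      rw [Expr.eval_cond (p := True)]
      · rw [if_pos trivial, Expr.eval, parentE, he]
        simp [Expr.eval, h.base.1]
      · rw [Expr.eval_lt_ne, parentE, he]
        simp [Expr.eval, h.base.1]
    · refine .inr ⟨hu, ?_⟩
      rw [Expr.eval_cond (p := False)]
      · simp [Expr.eval]
      · rw [Expr.eval_lt_ne, parentE, he]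
        simp [Expr.eval, h.base.1]
  · intro j u
    rw [Expr.eval_and_ne, Expr.eval_and_ne, Expr.eval_or_ne, Expr.eval_not_ne,
      Expr.eval_arc_ne (D := D) (by simp [h.base.1]) (by simpa using h.base.2)
        (by simp) u w (by simp) (by simp)]
    simp [Expr.eval, internalE, h.status, h.inDom, Allowed]

/-- A round that starts from a tree which is not full adds a vertex. As the root is present at the
start, a tree not full after `n` rounds would have more than `n` vertices. -/
theorem Loaded.eval_rep_growCmd (h : Loaded D r st s)
    (hP : Grown D r st fun i => s.arr 6 i) : Loaded D r st ((Cmd.rep growCmd).eval s) ∧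
      Grown D r st (fun i => ((Cmd.rep growCmd).eval s).arr 6 i) ∧
      Full D r st (fun i => ((Cmd.rep growCmd).eval s).arr 6 i) := by
  have key : ∀ k, Loaded D r st (growCmd.eval^[k] s) ∧
      Grown D r st (fun i => (growCmd.eval^[k] s).arr 6 i) ∧
      (Full D r st (fun i => (growCmd.eval^[k] s).arr 6 i) ∨
        k < (Finset.univ.filter fun i : Fin n => (growCmd.eval^[k] s).arr 6 i ≠ 0).card) := by
    intro k
    induction k with
    | zero =>
      refine ⟨h, hP, .inr (Finset.card_pos.2 ⟨r, ?_⟩)⟩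
      have : s.arr 6 r = 1 := hP.root
      exact Finset.mem_filter.2 ⟨Finset.mem_univ r, by change s.arr 6 r ≠ 0; simp [this]⟩
    | succ k ih =>
      rw [Function.iterate_succ_apply']
      obtain ⟨h1, h2, h3⟩ := ih
      obtain ⟨g1, g2⟩ := h1.eval_growCmd
      refine ⟨g1, h2.grow g2, ?_⟩
      by_cases hf : Full D r st (fun i => (growCmd.eval^[k] s).arr 6 i)
      · exact .inl (hf.grow g2)
      · have := card_grow hf g2
        have := h3.resolve_left hf
        right; omega
  obtain ⟨h1, h2, h3⟩ := key n
  have e : (Cmd.rep growCmd).eval s = growCmd.eval^[n] s := by rw [Cmd.eval, h.base.1]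
  rw [e]
  refine ⟨h1, h2, h3.resolve_right fun hlt => ?_⟩
  have := Finset.card_le_univ (Finset.univ.filter fun i : Fin n => (growCmd.eval^[n] s).arr 6 i ≠ 0)
  rw [Fintype.card_fin] at this
  omega

/-- The best out-branching found so far, if any, is stored. -/
def Stored (D : Digraph (Fin n)) (s : State) : Prop :=
  s.reg 0 = 0 ∨ s.reg 0 = 1 ∧ ∃ T, IsOutBranching D T ∧ leafCount T = s.reg 1 ∧
    ∀ u w : Fin n, T.Adj u w ↔ s.arr 8 w = 2 + u

/-- Processing a decided state never worsens the record, and if the root reaches all vertices, the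
record afterwards beats every leaf count promised by the state. -/
theorem Loaded.eval_recordCmd (h : Loaded D r st s) (hI : Good D r (ones st)) (hs : Stored D s) :
    Stored D (recordCmd.eval s) ∧
      (s.reg 0 = 1 → (recordCmd.eval s).reg 0 = 1 ∧ s.reg 1 ≤ (recordCmd.eval s).reg 1) ∧
      ∀ J, (∀ w, Reach D r J w) → ∀ k, k + (ones st).card ≤ (dom D r (ones st)).card →
        (recordCmd.eval s).reg 0 = 1 ∧ k ≤ (recordCmd.eval s).reg 1 := by
  simp only [recordCmd, Cmd.eval.eq_5]
  generalize h1 : Cmd.eval (.fill 6 _ _ _) s = s1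
  have l1 : Loaded D r st s1 := h1 ▸ h.eval rfl rfl rfl rfl rfl
  have g1 : ∀ i : Fin n, s1.arr 6 i = if i = r then 1 else 0 := fun i => by
    rw [← h1, Cmd.eval_fill_arr h.base.1]
    refine Expr.eval_bool ?_
    rw [Expr.eval_eq_ne]
    simp [Expr.eval, h.root, Fin.ext_iff]
  have k1 : s1.reg 0 = s.reg 0 ∧ s1.reg 1 = s.reg 1 ∧ s1.arr 8 = s.arr 8 := by
    rw [← h1]; exact ⟨Cmd.eval_reg rfl s, Cmd.eval_reg rfl s, Cmd.eval_arr rfl s⟩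
  have p1 : Grown D r st (fun i => s1.arr 6 i) := by
    refine ⟨by simp [g1], fun w => ?_, 0, fun w u hw => ?_⟩
    · by_cases hw : w = r <;> simp [g1, hw]
    · rw [g1] at hw
      split_ifs at hw <;> omega
  clear h1
  obtain ⟨l2, p2, f2⟩ := l1.eval_rep_growCmd p1
  have k2 : ((Cmd.rep growCmd).eval s1).reg 0 = s.reg 0 ∧
      ((Cmd.rep growCmd).eval s1).reg 1 = s.reg 1 ∧
      ((Cmd.rep growCmd).eval s1).arr 8 = s.arr 8 :=
    ⟨(Cmd.eval_reg rfl s1).trans k1.1, (Cmd.eval_reg rfl s1).trans k1.2.1,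
      (Cmd.eval_arr rfl s1).trans k1.2.2⟩
  generalize Cmd.eval (.rep growCmd) s1 = s2 at l2 p2 f2 k2 ⊢
  have e3 : (Expr.sum 20 (Expr.bool leafE)).eval s2 = (Finset.univ.filter fun v : Fin n =>
      ¬ ∃ w : Fin n, s2.arr 6 w = 2 + v).card := by
    classical
    refine (Expr.eval_sum_ind (p := fun v : Fin n => ¬ ∃ w : Fin n, s2.arr 6 w = 2 + v) l2.base.1
      fun i => Expr.eval_bool ?_).trans (by congr!)
    rw [leafE, Expr.eval_not_ne, ← not_iff_not, not_not, ← ne_eq,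
      Expr.eval_any_ne (n := n) (by simp [l2.base.1])]
    refine exists_congr fun w => ?_
    rw [Expr.eval_eq_ne]
    simp [Expr.eval, l2.base.1]
  generalize h3 : Cmd.eval (.assign 13 _) s2 = s3
  have l3 : Loaded D r st s3 := h3 ▸ l2.eval rfl rfl rfl rfl rfl
  have a3 : s3.arr 6 = s2.arr 6 := h3 ▸ Cmd.eval_arr rfl s2
  have k3 : s3.reg 0 = s.reg 0 ∧ s3.reg 1 = s.reg 1 ∧ s3.arr 8 = s.arr 8 := by
    rw [← h3]
    exact ⟨(Cmd.eval_reg rfl s2).trans k2.1, (Cmd.eval_reg rfl s2).trans k2.2.1,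
      (Cmd.eval_arr rfl s2).trans k2.2.2⟩
  have r3 : s3.reg 13 = (Finset.univ.filter fun v : Fin n =>
      ¬ ∃ w : Fin n, s3.arr 6 w = 2 + v).card := by
    rw [a3, ← e3, ← h3]; simp [Cmd.eval]
  rw [← a3] at p2 f2
  clear h3 e3
  have hcond : (Expr.and (.not (.any 20 (.not (.get 6 (.reg 20)))))
      (.or (.eq (.reg 0) (.lit 0)) (.lt (.reg 1) (.reg 13)))).eval s3 ≠ 0 ↔
      (∀ w : Fin n, s3.arr 6 w ≠ 0) ∧ (s.reg 0 = 0 ∨ s.reg 1 < s3.reg 13) := by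
    rw [Expr.eval_and_ne, Expr.eval_not_ne, ← not_not (a := Expr.eval (.any _ _) _ = 0), ← ne_eq,
      Expr.eval_any_ne l3.base.1, Expr.eval_or_ne, Expr.eval_eq_ne, Expr.eval_lt_ne]
    simp [Expr.eval_not_ne, Expr.eval, k3]
  have hleaf : (∀ w : Fin n, s3.arr 6 w ≠ 0) → ∃ T, IsOutBranching D T ∧
      leafCount T = s3.reg 13 ∧ (∀ u w : Fin n, T.Adj u w ↔ s3.arr 6 w = 2 + u) ∧
      ∀ k, k + (ones st).card ≤ (dom D r (ones st)).card → k ≤ leafCount T := by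
    intro hall
    obtain ⟨T, hT, hadj, hk⟩ := p2.exists_isOutBranching hall
    refine ⟨T, hT, ?_, hadj, hk⟩
    rw [r3, leafCount, ← Set.ncard_coe_finset]
    congr 1
    ext v
    simp [hadj]
  rw [Cmd.eval.eq_6]
  by_cases hc : (∀ w : Fin n, s3.arr 6 w ≠ 0) ∧ (s.reg 0 = 0 ∨ s.reg 1 < s3.reg 13)
  · rw [if_neg (hcond.2 hc)]
    obtain ⟨T, hT, hl, hadj, hk⟩ := hleaf hc.1
    simp only [Cmd.eval.eq_5]
    generalize h4 : Cmd.eval (.assign 0 _) s3 = s4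
    generalize h5 : Cmd.eval (.assign 1 _) s4 = s5
    have q5 : s5.reg 0 = 1 ∧ s5.reg 1 = s3.reg 13 ∧ s5.arr 6 = s3.arr 6 ∧ s5.reg 2 = n := by
      rw [← h5, ← h4]; simp [Cmd.eval, Expr.eval, l3.base.1]
    clear h4 h5
    generalize h6 : Cmd.eval (.fill 8 _ _ _) s5 = s6
    have q6 : s6.reg 0 = 1 ∧ s6.reg 1 = s3.reg 13 ∧ ∀ i : Fin n, s6.arr 8 i = s3.arr 6 i := by
      rw [← h6]
      refine ⟨(Cmd.eval_reg rfl s5).trans q5.1, (Cmd.eval_reg rfl s5).trans q5.2.1, fun i => ?_⟩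
      rw [Cmd.eval_fill_arr q5.2.2.2, ← q5.2.2.1]
      simp [Expr.eval]
    refine ⟨.inr ⟨q6.1, T, hT, by rw [hl, q6.2.1], fun u w => by rw [hadj, q6.2.2]⟩,
      fun h0 => ⟨q6.1, ?_⟩, fun J hJ k hk' => ⟨q6.1, ?_⟩⟩
    · rw [q6.2.1]
      have := hc.2
      omega
    · rw [q6.2.1, ← hl]; exact hk k hk'
  · rw [if_pos (not_not.1 fun hne => hc (hcond.1 hne)), Cmd.eval]
    refine ⟨?_, fun h0 => ⟨by rw [k3.1, h0], by rw [k3.2.1]⟩, fun J hJ k hk => ?_⟩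
    · rcases hs with h0 | ⟨h0, T, hT⟩
      · exact .inl (by rw [k3.1, h0])
      · exact .inr ⟨by rw [k3.1, h0], T, by rw [k3.2.1, k3.2.2]; exact hT⟩
    -- The grown tree is spanning, so it was rejected only because the record is at least as good.
    · have hall := f2.ne_zero p2 hI hJ
      obtain ⟨T, hT, hl, hadj, hk'⟩ := hleaf hall
      have h0 : s.reg 0 ≠ 0 ∧ ¬ s.reg 1 < s3.reg 13 := by
        constructor <;> intro hh <;> exact hc ⟨hall, by tauto⟩
      have h1 := hk' k hk
      refine ⟨?_, ?_⟩
      · rw [k3.1]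
        rcases hs with hh | hh
        · exact absurd hh h0.1
        · exact hh.1
      · rw [k3.2.1]; omega

end

end RAM

namespace RAM

open MaxLeaf

/-! ### Correctness and running time -/

section

variable {n : ℕ} {D : Digraph (Fin n)} {s : State}

/-- The invariant of the main loop. Every out-branching is beaten by the best one found so far, or
will be by one which arises from a state in the queue; `φ` bounds the number of iterations. -/
def Inv (D : Digraph (Fin n)) (s : State) (φ : ℝ) : Prop :=
  Base D s ∧ Stored D s ∧ ∃ L : List (Fin n × (Fin n → ℕ)), Queue s L ∧
    (∀ a ∈ L, Good D a.1 (ones a.2)) ∧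
    (∀ T, IsOutBranching D T → (s.reg 0 = 1 ∧ leafCount T ≤ s.reg 1) ∨
      ∃ a ∈ L, (∃ J, ∀ w, Reach D a.1 J w) ∧ Ach D a.1 a.2 (leafCount T)) ∧
    φ = (L.map fun a => 100 * (1.035 : ℝ) ^ measure D a.1 a.2).sum

theorem Inv.nonneg {φ : ℝ} (h : Inv D s φ) : 0 ≤ φ := by
  obtain ⟨-, -, L, -, -, -, rfl⟩ := h
  refine List.sum_nonneg fun x hx => ?_
  obtain ⟨a, -, rfl⟩ := List.mem_map.1 hx
  positivity

theorem Stored.congr (h : Stored D s) {s' : State} (h0 : s'.reg 0 = s.reg 0)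
    (h1 : s'.reg 1 = s.reg 1) (h8 : s'.arr 8 = s.arr 8) : Stored D s' := by
  rwa [Stored, h0, h1, h8]

/-- Branching replaces a summand `100 * 1.035 ^ m` by at most 0.99 of it, a loss of at least 1 since
`1.035 ^ m ≥ 1`; recording removes the summand altogether. -/
theorem Inv.eval_bodyCmd {φ : ℝ} (h : Inv D s φ) (hlt : s.reg 3 < s.reg 4) :
    ∃ φ', Inv D (bodyCmd.eval s) φ' ∧ φ' + 1 ≤ φ := by
  obtain ⟨hB, hS, L, hQ, hG, hA, rfl⟩ := h
  obtain _ | ⟨⟨r, st⟩, L⟩ := L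
  · exact absurd (show s.reg 3 = s.reg 4 from hQ) hlt.ne
  have hr := hQ.1
  have hst := hQ.2.1
  have hI : Good D r (ones st) := hG _ List.mem_cons_self
  have hG' : ∀ a ∈ L, Good D a.1 (ones a.2) := fun a ha => hG a (List.mem_cons_of_mem _ ha)
  have hpow : (1 : ℝ) ≤ 1.035 ^ measure D r st := one_le_pow₀ (by norm_num)
  have hB' : Base D (bodyCmd.eval s) := hB.eval rfl rfl
  simp only [bodyCmd, Cmd.eval.eq_5] at hB' ⊢
  obtain ⟨l1, hv⟩ := eval_loadCmd hB hr hst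
  have k1 : (loadCmd.eval s).reg 0 = s.reg 0 ∧ (loadCmd.eval s).reg 1 = s.reg 1 ∧
      (loadCmd.eval s).arr 8 = s.arr 8 :=
    ⟨Cmd.eval_reg rfl s, Cmd.eval_reg rfl s, Cmd.eval_arr rfl s⟩
  have q1 : Queue (loadCmd.eval s) ((r, st) :: L) := by
    rw [Queue, Cmd.eval_arr rfl, Cmd.eval_arr rfl, Cmd.eval_reg rfl, Cmd.eval_reg rfl]
    exact hQ
  generalize loadCmd.eval s = s1 at *
  have hpop : ∀ {s2 : State} {L' : List (Fin n × (Fin n → ℕ))}, s2.reg 2 = n →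
      Queue s2 ((r, st) :: L') →
      Queue ((Cmd.assign 3 (.add (.reg 3) (.reg 2))).eval s2) L' := by
    intro s2 L' h2 hq
    have := hq.2.2
    simpa [Queue, Cmd.eval, Expr.eval, h2] using this
  have hkeep : ∀ s2 : State, ((Cmd.assign 3 (.add (.reg 3) (.reg 2))).eval s2).reg 0 = s2.reg 0 ∧
      ((Cmd.assign 3 (.add (.reg 3) (.reg 2))).eval s2).reg 1 = s2.reg 1 ∧
      ((Cmd.assign 3 (.add (.reg 3) (.reg 2))).eval s2).arr 8 = s2.arr 8 := fun s2 =>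
    ⟨Cmd.eval_reg rfl s2, Cmd.eval_reg rfl s2, Cmd.eval_arr rfl s2⟩
  rw [Cmd.eval.eq_6] at hB' ⊢
  rcases hv with ⟨v, ⟨hv0, hvd⟩, hv⟩ | ⟨hall, hv⟩
  · have hc : ¬ (Expr.lt (.reg 5) (.reg 2)).eval s1 = 0 := by
      rw [← ne_eq, Expr.eval_lt_ne]
      simp [Expr.eval, hv, l1.base.1]
    rw [if_neg hc] at hB' ⊢
    simp only [Cmd.eval.eq_5] at hB' ⊢
    obtain ⟨x, y, hx, hy, a2⟩ := eval_analyseCmd l1 hv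
    have hch : Choice D r st v x y := ⟨hI, hv0, hvd, hx, hy⟩
    have k2 : (analyseCmd.eval s1).reg 0 = s.reg 0 ∧ (analyseCmd.eval s1).reg 1 = s.reg 1 ∧
        (analyseCmd.eval s1).arr 8 = s.arr 8 :=
      ⟨(Cmd.eval_reg rfl s1).trans k1.1, (Cmd.eval_reg rfl s1).trans k1.2.1,
        (Cmd.eval_arr rfl s1).trans k1.2.2⟩
    have q2 : Queue (analyseCmd.eval s1) ((r, st) :: L) := by
      rw [Queue, Cmd.eval_arr rfl, Cmd.eval_arr rfl, Cmd.eval_reg rfl, Cmd.eval_reg rfl]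
      exact q1
    generalize analyseCmd.eval s1 = s2 at *
    have q3 := a2.eval_branchCmd q2
    have k3 : (branchCmd.eval s2).reg 0 = s.reg 0 ∧ (branchCmd.eval s2).reg 1 = s.reg 1 ∧
        (branchCmd.eval s2).arr 8 = s.arr 8 :=
      ⟨(Cmd.eval_reg rfl s2).trans k2.1, (Cmd.eval_reg rfl s2).trans k2.2.1,
        (Cmd.eval_arr rfl s2).trans k2.2.2⟩
    have b3 : (branchCmd.eval s2).reg 2 = n := (Cmd.eval_reg rfl s2).trans a2.base.1
    generalize branchCmd.eval s2 = s3 at *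
    obtain ⟨e0, e1, e8⟩ := hkeep s3
    refine ⟨_, ⟨hB', hS.congr (e0.trans k3.1) (e1.trans k3.2.1) (e8.trans k3.2.2),
      L ++ (branches D r st v x y).map fun f => (r, f), hpop b3 q3, ?_, ?_, rfl⟩, ?_⟩
    · intro a ha
      rcases List.mem_append.1 ha with ha | ha
      · exact hG' a ha
      · obtain ⟨f, hf, rfl⟩ := List.mem_map.1 ha
        exact hch.good_branches hf
    · intro T hT
      rw [e0, e1, k3.1, k3.2.1]
      refine (hA T hT).imp_right ?_
      rintro ⟨a, ha, hJ, hach⟩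
      rcases List.mem_cons.1 ha with rfl | ha
      · obtain ⟨f, hf, hf'⟩ := hch.exists_ach hach
        exact ⟨(r, f), List.mem_append_right _ (List.mem_map_of_mem hf), hJ, hf'⟩
      · exact ⟨a, List.mem_append_left _ ha, hJ, hach⟩
    · have hsum := hch.sum_branches_le
      have e : ((List.map (fun f => (r, f)) (branches D r st v x y)).map
          fun a : Fin n × (Fin n → ℕ) => 100 * (1.035 : ℝ) ^ measure D a.1 a.2).sum =
          100 * ((branches D r st v x y).map fun f => (1.035 : ℝ) ^ measure D r f).sum := by
        rw [List.map_map, ← List.sum_map_mul_left]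
        rfl
      rw [List.map_append, List.sum_append, e, List.map_cons, List.sum_cons]
      simp only
      linarith
  · have hc : (Expr.lt (.reg 5) (.reg 2)).eval s1 = 0 := by
      simp [Expr.eval, hv, l1.base.1]
    rw [if_pos hc] at hB' ⊢
    obtain ⟨c1, c2, c3⟩ := l1.eval_recordCmd hI (hS.congr k1.1 k1.2.1 k1.2.2)
    have q2 : Queue (recordCmd.eval s1) ((r, st) :: L) := by
      rw [Queue, Cmd.eval_arr rfl, Cmd.eval_arr rfl, Cmd.eval_reg rfl, Cmd.eval_reg rfl]
      exact q1
    have b2 : (recordCmd.eval s1).reg 2 = n := (Cmd.eval_reg rfl s1).trans l1.base.1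
    generalize recordCmd.eval s1 = s2 at *
    obtain ⟨e0, e1, e8⟩ := hkeep s2
    refine ⟨_, ⟨hB', c1.congr e0 e1 e8, L, hpop b2 q2, hG', ?_, rfl⟩, ?_⟩
    · intro T hT
      rw [e0, e1]
      rcases hA T hT with hh | ⟨a, ha, ⟨J, hJ⟩, hach⟩
      · rw [← k1.1, ← k1.2.1] at hh
        have := c2 hh.1
        exact .inl ⟨this.1, by omega⟩
      · rcases List.mem_cons.1 ha with rfl | ha
        · exact .inl (c3 J hJ _ (hach.of_decided fun v hvd hv0 => hall v ⟨hv0, hvd⟩))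
        · exact .inr ⟨a, ha, ⟨J, hJ⟩, hach⟩
    · rw [List.map_cons, List.sum_cons]
      simp only
      linarith

/-- Every out-branching is promised by the undecided state of its own root, with its internal
vertices as witness. -/
theorem eval_initCmd (hB : Base D s) (h3 : s.reg 3 = 0) (h4 : s.reg 4 = 0) (h11 : s.reg 11 = 0) :
    ∃ φ, Inv D (initCmd.eval s) φ ∧ φ ≤ n * (100 * 1.035 ^ (20 * n)) := by
  simp only [initCmd, Cmd.eval.eq_5]
  generalize hs1 : Cmd.eval (.assign 0 _) s = s1
  have k1 : s1.reg 0 = 0 ∧ Base D s1 ∧ s1.reg 3 = 0 ∧ s1.reg 4 = 0 ∧ s1.reg 11 = 0 := by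
    rw [← hs1]
    refine ⟨by simp [Cmd.eval, Expr.eval], hB.eval rfl rfl, ?_, ?_, ?_⟩ <;>
      rwa [Cmd.eval_reg rfl]
  clear hs1
  rw [Cmd.eval, k1.2.1.1]
  generalize hc : (Cmd.seq (.fill 2 20 (.reg 4) (.lit 0)) <| .seq (.store 3 (.reg 4) (.reg 11)) <|
    .seq (.assign 4 (.add (.reg 4) (.reg 2))) <| .assign 11 (.add (.reg 11) (.lit 1))) = c
  have key : ∀ k ≤ n, Base D (c.eval^[k] s1) ∧ (c.eval^[k] s1).reg 0 = 0 ∧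
      (c.eval^[k] s1).reg 11 = k ∧ ∃ L : List (Fin n × (Fin n → ℕ)), Queue (c.eval^[k] s1) L ∧
      (∀ a ∈ L, a.2 = fun _ => 0) ∧ L.length = k ∧
      ∀ i : Fin n, i < k → (i, fun _ => 0) ∈ L := by
    intro k
    induction k with
    | zero =>
      intro _
      refine ⟨k1.2.1, k1.1, k1.2.2.2.2, [], ?_, by simp, rfl, by simp⟩
      change s1.reg 3 = s1.reg 4
      rw [k1.2.2.1, k1.2.2.2.1]
    | succ k ih =>
      intro hk
      obtain ⟨i1, i2, i3, L, i4, i5, i6, i7⟩ := ih (by omega)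
      rw [Function.iterate_succ_apply']
      generalize c.eval^[k] s1 = s2 at *
      have hq := eval_push (r := ⟨k, hk⟩) (f := fun _ => 0) (x := 11) (e := .lit 0) i1.1
        i3 (fun i => rfl) i4
      have h0 : (c.eval s2).reg 0 = 0 := by rw [← hc, Cmd.eval_reg rfl, i2]
      have hb : Base D (c.eval s2) := by rw [← hc]; exact i1.eval rfl rfl
      subst hc
      -- Addition caps its second summand at `n`; the cap on 1 is harmless because a round is
      -- executed only for `n ≥ 1`.
      have e11 : min 1 n = 1 := by omega
      refine ⟨hb, h0, ?_, L ++ [(⟨k, hk⟩, fun _ => 0)], ?_, ?_, by simp [i6], ?_⟩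
      · simp [Cmd.eval, Expr.eval, i3, i1.1, e11]
      · simpa [Queue, Cmd.eval, Expr.eval] using hq
      · intro a ha
        rcases List.mem_append.1 ha with ha | ha
        · exact i5 a ha
        · rw [List.mem_singleton.1 ha]
      · intro i hi
        by_cases hik : (i : ℕ) < k
        · exact List.mem_append_left _ (i7 i hik)
        · have : i = ⟨k, hk⟩ := Fin.ext (by simp only; omega)
          simp [this]
  obtain ⟨i1, i2, i3, L, i4, i5, i6, i7⟩ := key n le_rfl
  have hz : ∀ a ∈ L, ones a.2 = ∅ := fun a ha => by rw [i5 a ha]; simp [ones]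
  refine ⟨_, ⟨i1, .inl i2, L, i4, fun a ha => ?_, fun T hT => .inr ?_, rfl⟩, ?_⟩
  · rw [hz a ha]; intro u hu; simp at hu
  · obtain ⟨r, J, hJ, hall, hk⟩ := exists_good_of_isOutBranching hT
    exact ⟨_, i7 r r.2, ⟨J, hall⟩, J, hJ, by simp, by simp, hk⟩
  · have : ∀ x ∈ L.map (fun a => 100 * (1.035 : ℝ) ^ measure D a.1 a.2),
        x ≤ 100 * 1.035 ^ (20 * n) := by
      intro x hx
      obtain ⟨a, -, rfl⟩ := List.mem_map.1 hx
      have := measure_le (D := D) (r := a.1) a.2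
      rw [Fintype.card_fin] at this
      exact mul_le_mul_of_nonneg_left (pow_le_pow_right₀ (by norm_num) this) (by norm_num)
    have := List.sum_le_card_nsmul _ _ this
    rwa [List.length_map, i6, nsmul_eq_mul] at this

theorem eval_outputCmd (hn : s.reg 2 = n) (u w : Fin n) :
    (outputCmd.eval s).arr 1 (u * n + w) = if s.arr 8 w = 2 + u then 1 else 0 := by
  simp only [outputCmd, Cmd.eval.eq_5]
  generalize hs1 : Cmd.eval (.assign 11 _) s = s1
  generalize hs2 : Cmd.eval (.assign 12 _) s1 = s2
  have k2 : s2.reg 2 = n ∧ s2.reg 11 = 0 ∧ s2.reg 12 = 0 ∧ s2.arr 8 = s.arr 8 := by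
    rw [← hs2, ← hs1]
    simp [Cmd.eval, Expr.eval, hn]
  clear hs1 hs2
  rw [Cmd.eval, k2.1]
  generalize hc : (Cmd.seq (.fill 1 20 (.reg 12)
    (.bool (.eq (.get 8 (.reg 20)) (.add (.lit 2) (.reg 11))))) <|
    .seq (.assign 11 (.add (.reg 11) (.lit 1))) <| .assign 12 (.add (.reg 12) (.reg 2))) = c
  have key : ∀ k ≤ n, (c.eval^[k] s2).reg 2 = n ∧ (c.eval^[k] s2).reg 11 = k ∧
      (c.eval^[k] s2).reg 12 = k * n ∧ (c.eval^[k] s2).arr 8 = s.arr 8 ∧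
      ∀ u w : Fin n, u < k → (c.eval^[k] s2).arr 1 (u * n + w) =
        if s.arr 8 w = 2 + u then 1 else 0 := by
    intro k
    induction k with
    | zero =>
      intro _
      exact ⟨k2.1, k2.2.1, by simpa using k2.2.2.1, k2.2.2.2, by simp⟩
    | succ k ih =>
      intro hk
      obtain ⟨i1, i2, i3, i4, i5⟩ := ih (by omega)
      rw [Function.iterate_succ_apply']
      generalize c.eval^[k] s2 = s3 at *
      have h2 : (c.eval s3).reg 2 = n := by rw [← hc, Cmd.eval_reg rfl, i1]
      have h8 : (c.eval s3).arr 8 = s.arr 8 := by rw [← hc, Cmd.eval_arr rfl, i4]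
      have e11 : min 1 n = 1 := by omega
      refine ⟨h2, ?_, ?_, h8, fun u w hu => ?_⟩
      · rw [← hc]; simp [Cmd.eval, Expr.eval, i1, i2, e11]
      · rw [← hc]; simp [Cmd.eval, Expr.eval, i1, i3]; ring
      · have e : (c.eval s3).arr 1 = ((Cmd.fill 1 20 (.reg 12)
            (.bool (.eq (.get 8 (.reg 20)) (.add (.lit 2) (.reg 11))))).eval s3).arr 1 := by
          rw [← hc]; rfl
        rw [e, Cmd.eval, State.setBlock_arr, Expr.eval, i3, i1]
        by_cases huk : (u : ℕ) = k
        · have h1 : k * n ≤ u * n + w ∧ u * n + w < k * n + n := by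
            rw [huk]; have := w.2; omega
          have h3 : (u : ℕ) * n + w - k * n = w := by rw [huk]; omega
          rw [if_pos ⟨rfl, h1⟩, h3]
          refine Expr.eval_bool ?_
          rw [Expr.eval_eq_ne]
          simp [Expr.eval, i1, i2, i4, huk, min_eq_left (by omega : k ≤ n)]
        -- Earlier rows end before index `k * n`, so this round leaves them intact.
        · have h1 : ¬ k * n ≤ u * n + w := by
            have h4 : ((u : ℕ) + 1) * n ≤ k * n := Nat.mul_le_mul_right n (by omega)
            have := w.2
            rw [add_mul] at h4
            omega
          rw [if_neg (fun h => h1 h.2.1), i5 u w (by omega)]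
  exact (key n le_rfl).2.2.2.2 u w u.2

/-- The program is correct. -/
theorem exec_maxLeafProg (D : Digraph (Fin n)) : ∃ t s, Exec maxLeafProg (input D) t s ∧
    IsAnswer D s ∧ (t : ℝ) ≤ 1 + (initCmd.cost n +
      ((n * (100 * 1.035 ^ (20 * n)) * (bodyCmd.cost n + 1) + 1) + outputCmd.cost n)) := by
  let s0 : State := (input D).setReg 2 n
  have e0 : Exec (.copy 2 0) (input D) 1 s0 := Exec.copy 2 0 (input D)
  have b0 : Base D s0 := ⟨by simp [s0], by simp [s0, input]⟩
  obtain ⟨t1, s1, e1, ht1, a1⟩ := Cmd.run_compile (by simp) initCmd_ok le_rfl s0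
  obtain ⟨φ, hInv, hφ⟩ := eval_initCmd b0 (by simp [s0, input]) (by simp [s0, input])
    (by simp [s0, input])
  obtain ⟨t2, s2, e2, ht2, s2', φ', a2, ⟨hB, hS, L, hQ, -, hA, -⟩, hlt⟩ :=
    Run.whileLoop (K := 30) (by simp) bodyCmd_ok (x := 3) (y := 4)
    (by simp) (by simp) (n := n) (Inv := Inv D) (fun s φ h => h.1.1) (fun s φ h => h.nonneg)
    (fun s φ h => h.eval_bodyCmd) a1 hInv
  obtain ⟨t3, s3, e3, ht3, a3⟩ := Cmd.run_compile (by simp) outputCmd_ok le_rfl s2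
  have a3' := (Cmd.eval_agree (by simp) outputCmd_ok le_rfl a2).trans a3
  refine ⟨1 + (t1 + (t2 + t3)), s3, .seq e0 (.seq e1 (.seq e2 e3)), ?_, ?_⟩
  -- Each queued state occupies `n > 0` indices, so a nonempty queue would have its head strictly
  -- below its tail.
  · have hL : L = [] := by
      obtain _ | ⟨a, L⟩ := L
      · rfl
      · have := IsQueue.le hQ.2.2
        have := a.1.pos
        omega
    subst hL
    have hA' : ∀ T, IsOutBranching D T → s2'.reg 0 = 1 ∧ leafCount T ≤ s2'.reg 1 := fun T hT =>
      (hA T hT).resolve_right (by simp)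
    have r0 : s3.reg 0 = s2'.reg 0 := (a3'.1 0 (by simp)).trans (Cmd.eval_reg rfl s2')
    have r1 : s3.reg 1 = s2'.reg 1 := (a3'.1 1 (by simp)).trans (Cmd.eval_reg rfl s2')
    rcases hS with h0 | ⟨h1, T, hT, hl, hadj⟩
    · refine .inl ⟨r0.trans h0, fun T hT => ?_⟩
      have := (hA' T hT).1
      omega
    · refine .inr ⟨r0.trans h1, T, ⟨hT, fun T' hT' => ?_⟩, r1.trans hl.symm, fun m hm => ?_⟩
      · rw [hl]; exact (hA' T' hT').2
      · have hn : 0 < n := Nat.pos_of_ne_zero fun h => by subst h; simp at hm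
        have := eval_outputCmd hB.1 ⟨m / n, Nat.div_lt_of_lt_mul hm⟩ ⟨m % n, Nat.mod_lt m hn⟩
        have h2 := adjArray_apply T ⟨m / n, Nat.div_lt_of_lt_mul hm⟩ ⟨m % n, Nat.mod_lt m hn⟩
        simp only [hadj] at h2
        simp only [Nat.div_add_mod'] at this h2
        rw [a3'.2, this, h2]
  · have h2 : s0.reg 2 = n := b0.1
    rw [h2] at ht1
    have h3 : s2.reg 2 = n := (a2.1 2 (by simp)).trans hB.1
    rw [h3] at ht3
    have h4 : φ * ((bodyCmd.cost n : ℝ) + 1) ≤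
      n * (100 * 1.035 ^ (20 * n)) * (bodyCmd.cost n + 1) :=
      mul_le_mul_of_nonneg_right hφ (by positivity)
    have h5 : (t1 : ℝ) ≤ initCmd.cost n := by exact_mod_cast ht1
    have h6 : (t3 : ℝ) ≤ outputCmd.cost n := by exact_mod_cast ht3
    push_cast
    linarith

end

/-- Polynomials are dominated by exponential functions. -/
theorem PolyBdd.exists_le {f : ℕ → ℕ} (hf : PolyBdd f) {ρ σ : ℝ} (h0 : 0 < ρ) (h : ρ < σ) :
    ∃ C : ℝ, ∀ n, (f n : ℝ) * ρ ^ n ≤ C * σ ^ n := by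
  obtain ⟨c, d, hf⟩ := hf
  have hσ : 0 < σ := h0.trans h
  have hq : 0 < ρ / σ := by positivity
  have hlim := tendsto_pow_const_mul_const_pow_of_abs_lt_one d (r := ρ / σ)
    (by rw [abs_of_pos hq]; exact (div_lt_one hσ).2 h)
  obtain ⟨B, hB⟩ := hlim.bddAbove_range
  -- The bound `B` is applied at `n + 1`, since the polynomial is in `n + 1`; the surplus factor `ρ
  -- / σ` is divided out.
  refine ⟨c * (B / (ρ / σ)), fun n => ?_⟩
  have h1 : ((n + 1 : ℕ) : ℝ) ^ d * (ρ / σ) ^ (n + 1) ≤ B := hB ⟨n + 1, rfl⟩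
  have h2 : ((n : ℝ) + 1) ^ d * (ρ / σ) ^ n ≤ B / (ρ / σ) := by
    rw [le_div_iff₀ hq]
    push_cast at h1
    rwa [pow_succ, ← mul_assoc] at h1
  have h3 : (f n : ℝ) ≤ c * ((n : ℝ) + 1) ^ d := by exact_mod_cast hf n
  have h4 : ρ ^ n = (ρ / σ) ^ n * σ ^ n := by
    rw [← mul_pow, div_mul_cancel₀ _ hσ.ne']
  calc (f n : ℝ) * ρ ^ n ≤ (c * ((n : ℝ) + 1) ^ d) * ρ ^ n := by gcongr
    _ = c * (((n : ℝ) + 1) ^ d * (ρ / σ) ^ n) * σ ^ n := by rw [h4]; ring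
    _ ≤ c * (B / (ρ / σ)) * σ ^ n := by gcongr

end RAM

theorem mainTheorem3 :
    ∃ (p : RAM.Prog) (C : ℝ), ∀ (n : ℕ) (D : Digraph (Fin n)),
      ∃ (t : ℕ) (s : RAM.State), RAM.Exec p (RAM.input D) t s ∧
        RAM.IsAnswer D s ∧ (t : ℝ) ≤ C * (1.9973 : ℝ) ^ n := by
  have hpoly : RAM.PolyBdd fun n => 1 + (RAM.initCmd.cost n +
      ((n * 100 * (RAM.bodyCmd.cost n + 1) + 1) + RAM.outputCmd.cost n)) :=
    (RAM.PolyBdd.const 1).add (RAM.initCmd.polyBdd_cost.add ((((RAM.PolyBdd.id.mul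
      (.const 100)).mul (RAM.bodyCmd.polyBdd_cost.add (.const 1))).add (.const 1)).add
        RAM.outputCmd.polyBdd_cost))
  -- Numerically `1.035 ^ 20` is about 1.9898, which leaves room below 1.9973 for the polynomial
  -- factor.
  obtain ⟨C, hC⟩ := hpoly.exists_le (ρ := 1.035 ^ 20) (σ := 1.9973) (by norm_num) (by norm_num)
  refine ⟨RAM.maxLeafProg, C, fun n D => ?_⟩
  obtain ⟨t, s, he, ha, ht⟩ := RAM.exec_maxLeafProg D
  refine ⟨t, s, he, ha, ht.trans (le_trans ?_ (hC n))⟩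
  -- The costs outside the main loop carry no exponential factor; being nonnegative, they may be
  -- multiplied by one.
  have h1 : (1 : ℝ) ≤ (1.035 ^ 20) ^ n := one_le_pow₀ (by norm_num)
  rw [pow_mul]
  push_cast
  generalize ((1.035 : ℝ) ^ 20) ^ n = q at h1
  have h2 : (0 : ℝ) ≤ RAM.initCmd.cost n := by positivity
  have h3 : (0 : ℝ) ≤ RAM.outputCmd.cost n := by positivity
  nlinarith
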